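/- **Notation.** Let $d,m\ge 1$; repeated indices are summed. For $F\in L^2_{loc}(\mathbb R^d)$ (possibly matrix valued) put $\|F\|_{S^2_R}=\sup_{x\in\mathbb R^d}\big(\frac1{|B(x,R)|}\int_{B(x,R)}|F|^2\big)^{1/2}$, $\|F\|_{W^2}=\limsup_{R\to\infty}\|F\|_{S^2_R}$ and $\|F\|_{B^2}=\limsup_{R\to\infty}\big(\frac1{|B(0,R)|}\int_{B(0,R)}|F|^2\big)^{1/2}$. Write $F\in L^2_{loc,unif}$ if $\sup_x\int_{B(x,1)}|F|^2<\infty$, and $F\in APW^2(\mathbb R^d)$ if $F\in L^2_{loc,unif}$ and $\|F-t_n\|_{W^2}\to0$ for a sequence $t_n$ of real trigonometric polynomials. A number $\langle f\rangle$ is the mean value of $f\in L^1_{loc}(\mathbb R^d)$ if $\int f(x/\varepsilon)\varphi(x)\,dx\to\langle f\rangle\int\varphi$ as $\varepsilon\to0^+$ for all $\varphi\in C_0^\infty(\mathbb R^d)$. Let $V^2_{pot}$ be the closure, with respect to $\|\cdot\|_{B^2}$, of the gradients $(\partial_iP^\alpha)$ of $\mathbb R^m$-valued trigonometric polynomials $P$.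 **Coefficients and correctors.** Let $A=(a_{ij}^{\alpha\beta})$, $1\le i,j\le d$, $1\le\alpha,\beta\le m$, be real, bounded and measurable on $\mathbb R^d$, with every entry in $APW^2(\mathbb R^d)$ and, for some $\mu>0$, $$\mu|\xi|^2\le a_{ij}^{\alpha\beta}(y)\xi_i^\alpha\xi_j^\beta\le\mu^{-1}|\xi|^2\quad\text{for a.e. }y\in\mathbb R^d\text{ and all }\xi\in\mathbb R^{m\times d}.$$ Let $\psi=(\psi_{ij}^{\alpha\beta})$ be determined by $\psi_j^\beta=(\psi_{ij}^{\alpha\beta})_{i,\alpha}\in V^2_{pot}$ and $\langle (a_{ij}^{\alpha\beta}+a_{ik}^{\alpha\gamma}\psi_{kj}^{\gamma\beta})\,\phi_i^\alpha\rangle=0$ for all $\phi\in V^2_{pot}$, and let $\widehat a_{ij}^{\alpha\beta}=\langle a_{ij}^{\alpha\beta}+a_{ik}^{\alpha\gamma}\psi_{kj}^{\gamma\beta}\rangle$ be the homogenized matrix. Put $\mathcal L_\varepsilon=-\operatorname{div}(A(x/\varepsilon)\nabla)$ and $\mathcal L_0=-\operatorname{div}(\widehat A\nabla)$. For $T>0$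 let $\chi_{T,j}^\beta=(\chi_{T,j}^{\alpha\beta})_\alpha$ be the weak solution $u\in H^1_{loc}(\mathbb R^d;\mathbb R^m)$ with $u,\nabla u\in L^2_{loc,unif}$ of $$-\operatorname{div}(A\nabla u)+T^{-2}u=\operatorname{div}(A\nabla P_j^\beta)\ \text{ in }\mathbb R^d,\qquad P_j^\beta(y)=y_je^\beta,$$ where $e^\beta$ is the $\beta$-th standard basis vector of $\mathbb R^m$. Let $b_T=A+A\nabla\chi_T-\widehat A$, that is, $b_{T,ij}^{\alpha\beta}=a_{ij}^{\alpha\beta}+a_{ik}^{\alpha\gamma}\partial_k\chi_{T,j}^{\gamma\beta}-\widehat a_{ij}^{\alpha\beta}$, and let $\phi_T=(\phi_{T,ij}^{\alpha\beta})$ be the weak solution in $H^1_{loc}(\mathbb R^d)$, with $\phi_T,\nabla\phi_T\in L^2_{loc,unif}$, of $-\Delta\phi_T+T^{-2}\phi_T=b_T-\langle b_T\rangle$ in $\mathbb R^d$. **Smoothing.** Let $\Omega\subset\mathbb R^d$ be a bounded Lipschitz domain and $\Omega_\delta=\{x\in\Omega:\operatorname{dist}(x,\partial\Omega)<\delta\}$.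 Fix a nonnegative $\zeta\in C_0^\infty(B(0,1))$ with $\int\zeta=1$, put $\zeta_\varepsilon(y)=\varepsilon^{-d}\zeta(y/\varepsilon)$, and fix a constant $C_\eta$. For $\delta>0$ let $\eta_\delta\in C_0^\infty(\Omega)$ be a cut-off function with $\eta_\delta=0$ in $\Omega_\delta$, $\eta_\delta=1$ in $\Omega\setminus\Omega_{2\delta}$ and $|\nabla\eta_\delta|\le C_\eta\delta^{-1}$, and let $K_{\varepsilon,\delta}f=\zeta_\varepsilon*(\eta_\delta f)$. **Theorem.** Let $0<\varepsilon<1$, $T=\varepsilon^{-1}$ and $$\delta=2T^{-1}+\|\nabla\chi_T-\psi\|_{B^2}+T^{-1}\|\chi_T\|_{S^2_1}+T^{-2}\|\phi_T\|_{S^2_1}+T^{-1}\|\nabla\phi_T\|_{S^2_1}.$$ Let $F\in H^{-1}(\Omega;\mathbb R^m)$, and let $u_\varepsilon,u_0\in H^1(\Omega;\mathbb R^m)$ be weak solutions of $\mathcal L_\varepsilon(u_\varepsilon)=F$ and $\mathcal L_0(u_0)=F$ in $\Omega$ with $u_\varepsilon=u_0$ on $\partial\Omega$ (that is, $u_\varepsilon-u_0\in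 H^1_0(\Omega;\mathbb R^m)$) and $u_0\in H^2(\Omega;\mathbb R^m)$. Then $$w_\varepsilon=u_\varepsilon-u_0-\varepsilon\chi_{T,k}^{\beta}(x/\varepsilon)\,K_{\varepsilon,\delta}\Big(\frac{\partial u_0^\beta}{\partial x_k}\Big)$$ belongs to $H^1_0(\Omega;\mathbb R^m)$, and $$\|w_\varepsilon\|_{H^1_0(\Omega)}\le C\,\delta^{1/2}\,\|u_0\|_{H^2(\Omega)},$$ where $\|\cdot\|_{H^1_0(\Omega)}$ is the norm of $H^1(\Omega;\mathbb R^m)$ and $C$ depends only on $A$, $\Omega$ and the fixed $\zeta$, $C_\eta$ (in particular not on $\varepsilon$, $F$, $u_\varepsilon$, $u_0$ or the choice of $\eta_\delta$). -/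

import Mathlib

open MeasureTheory Filter Topology Set
open scoped ENNReal NNReal ContDiff InnerProductSpace

noncomputable section

/-- `d`-dimensional Euclidean space. -/
abbrev E (d : ℕ) : Type := EuclideanSpace ℝ (Fin d)

/-- The `i`-th standard basis vector. -/
def basisVec {d : ℕ} (i : Fin d) : E d := EuclideanSpace.single i (1 : ℝ)

/-- The classical partial derivative `∂f/∂x_i`. -/
def pderiv {d : ℕ} (i : Fin d) (f : E d → ℝ) (x : E d) : ℝ := fderiv ℝ f x (basisVec i)

/-- `φ ∈ C_0^∞(Ω)`. -/
def IsTest {d : ℕ} (Ω : Set (E d)) (φ : E d → ℝ) : Prop :=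
  ContDiff ℝ ∞ φ ∧ HasCompactSupport φ ∧ tsupport φ ⊆ Ω

/-! ### Almost periodic functions -/

/-- The `L²` average `(⨍_{B(x,R)} |f|²)^{1/2}` of a finite family `f` of functions
(`|f|² = ∑ |f_i|²`). -/
def l2Avg {d : ℕ} {ι : Type} [Fintype ι] (f : ι → E d → ℝ) (x : E d) (R : ℝ) : ℝ≥0∞ :=
  (⨍⁻ y in Metric.ball x R, (∑ i, ‖f i y‖ₑ ^ 2) ∂volume) ^ (1 / 2 : ℝ)

/-- `‖f‖_{S²_R} = sup_x (⨍_{B(x,R)} |f|²)^{1/2}`. -/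
def stepanovNorm {d : ℕ} {ι : Type} [Fintype ι] (f : ι → E d → ℝ) (R : ℝ) : ℝ≥0∞ :=
  ⨆ x : E d, l2Avg f x R

/-- `‖f‖_{W²} = limsup_{R → ∞} sup_x (⨍_{B(x,R)} |f|²)^{1/2}`. -/
def weylSeminorm {d : ℕ} {ι : Type} [Fintype ι] (f : ι → E d → ℝ) : ℝ≥0∞ :=
  limsup (fun R : ℝ => stepanovNorm f R) atTop

/-- `‖f‖_{B²} = limsup_{R → ∞} (⨍_{B(0,R)} |f|²)^{1/2}`. -/
def besicovitchSeminorm {d : ℕ} {ι : Type} [Fintype ι] (f : ι → E d → ℝ) : ℝ≥0∞ :=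
  limsup (fun R : ℝ => l2Avg f 0 R) atTop

/-- `f ∈ L²_loc(ℝ^d)`. -/
def MemL2Loc {d : ℕ} (f : E d → ℝ) : Prop :=
  ∀ R : ℝ, MemLp f 2 (volume.restrict (Metric.ball 0 R))

/-- `f ∈ L²_{loc,unif}(ℝ^d)`. -/
def MemL2LocUnif {d : ℕ} (f : E d → ℝ) : Prop :=
  MemL2Loc f ∧ (⨆ x : E d, ∫⁻ y in Metric.ball x 1, ‖f y‖ₑ ^ 2) < ⊤

/-- The real trigonometric polynomials on `ℝ^d`: the finite linear combinations of
`cos (l · x)` and `sin (l · x)` with arbitrary frequencies `l ∈ ℝ^d`. -/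
def trigPoly (d : ℕ) : Submodule ℝ (E d → ℝ) :=
  Submodule.span ℝ
    (range (fun l : E d => fun x : E d => Real.cos (inner ℝ l x)) ∪
      range (fun l : E d => fun x : E d => Real.sin (inner ℝ l x)))

/-- `g ∈ APW²(ℝ^d)`: almost periodic in the sense of Weyl. -/
def IsAPW2 {d : ℕ} (g : E d → ℝ) : Prop :=
  MemL2LocUnif g ∧ ∃ t : ℕ → E d → ℝ, (∀ n, t n ∈ trigPoly d) ∧
    Tendsto (fun n => weylSeminorm (fun _ : Unit => g - t n)) atTop (𝓝 0)

/-- `f ∈ L¹_loc(ℝ^d)` has the mean value `c`: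
`∫ f(x/ε) φ(x) dx → c ∫ φ` as `ε → 0⁺` for every `φ ∈ C_0^∞(ℝ^d)`. -/
def HasMeanValue {d : ℕ} (f : E d → ℝ) (c : ℝ) : Prop :=
  LocallyIntegrable f volume ∧ ∀ φ : E d → ℝ, IsTest univ φ →
    Tendsto (fun ε : ℝ => ∫ x, f (ε⁻¹ • x) * φ x) (𝓝[>] 0) (𝓝 (c * ∫ x, φ x))

/-- `p = (p_i^α) ∈ V²_pot`: the `B²`-closure of the potential trigonometric polynomials with
mean value zero. The latter are exactly the gradients `(∂P^α/∂x_i)` of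
trigonometric polynomials `P = (P^α)`. -/
def MemVpot {d m : ℕ} (p : Fin d → Fin m → E d → ℝ) : Prop :=
  (∀ i α, MemL2Loc (p i α)) ∧ ∃ P : ℕ → Fin m → E d → ℝ, (∀ n α, P n α ∈ trigPoly d) ∧
    Tendsto (fun n => besicovitchSeminorm
      (fun q : Fin d × Fin m => fun x => p q.1 q.2 x - pderiv q.1 (P n q.2) x)) atTop (𝓝 0)

/-! ### Sobolev spaces -/

/-- `v` is the weak derivative `∂u/∂x_i` in the open set `Ω`. -/
def HasWeakDeriv {d : ℕ} (Ω : Set (E d)) (i : Fin d) (u v : E d → ℝ) : Prop :=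
  LocallyIntegrableOn u Ω volume ∧ LocallyIntegrableOn v Ω volume ∧
    ∀ φ : E d → ℝ, IsTest Ω φ → ∫ x in Ω, u x * pderiv i φ x = -∫ x in Ω, v x * φ x

open Classical in
/-- The weak derivative `∂u/∂x_i` in `Ω` (unique up to null sets; `0` if there is none). -/
def weakDeriv {d : ℕ} (Ω : Set (E d)) (i : Fin d) (u : E d → ℝ) : E d → ℝ :=
  if h : ∃ v, HasWeakDeriv Ω i u v then h.choose else 0

/-- `u ∈ H¹(Ω)`, scalar valued. -/
def MemH1 {d : ℕ} (Ω : Set (E d)) (u : E d → ℝ) : Prop :=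
  MemLp u 2 (volume.restrict Ω) ∧
    ∀ i, HasWeakDeriv Ω i u (weakDeriv Ω i u) ∧ MemLp (weakDeriv Ω i u) 2 (volume.restrict Ω)

/-- `u ∈ H²(Ω)`, scalar valued. -/
def MemH2 {d : ℕ} (Ω : Set (E d)) (u : E d → ℝ) : Prop :=
  MemH1 Ω u ∧ ∀ i, MemH1 Ω (weakDeriv Ω i u)

/-- The norm of `H¹(Ω; ℝ^m)`. -/
def h1Norm {d m : ℕ} (Ω : Set (E d)) (u : Fin m → E d → ℝ) : ℝ≥0∞ :=
  (∑ α, (eLpNorm (u α) 2 (volume.restrict Ω) ^ 2 +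
    ∑ i, eLpNorm (weakDeriv Ω i (u α)) 2 (volume.restrict Ω) ^ 2)) ^ (1 / 2 : ℝ)

/-- The norm of `H²(Ω; ℝ^m)`. -/
def h2Norm {d m : ℕ} (Ω : Set (E d)) (u : Fin m → E d → ℝ) : ℝ≥0∞ :=
  (∑ α, (eLpNorm (u α) 2 (volume.restrict Ω) ^ 2 +
    ∑ i, eLpNorm (weakDeriv Ω i (u α)) 2 (volume.restrict Ω) ^ 2 +
    ∑ i, ∑ j, eLpNorm (weakDeriv Ω j (weakDeriv Ω i (u α))) 2 (volume.restrict Ω) ^ 2))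
      ^ (1 / 2 : ℝ)

/-- `u ∈ H¹_0(Ω; ℝ^m)`: the closure of `C_0^∞(Ω; ℝ^m)` in `H¹(Ω; ℝ^m)`. -/
def MemH10 {d m : ℕ} (Ω : Set (E d)) (u : Fin m → E d → ℝ) : Prop :=
  (∀ α, MemH1 Ω (u α)) ∧ ∃ φ : ℕ → Fin m → E d → ℝ, (∀ n α, IsTest Ω (φ n α)) ∧
    Tendsto (fun n => h1Norm Ω (u - φ n)) atTop (𝓝 0)

/-- `F ∈ H^{-1}(Ω; ℝ^m)`, given through its values on test functions: it is bounded on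
`C_0^∞(Ω; ℝ^m)` with respect to the `H¹` norm. -/
def IsHMinusOne {d m : ℕ} (Ω : Set (E d)) (F : (Fin m → E d → ℝ) →ₗ[ℝ] ℝ) : Prop :=
  ∃ K : ℝ, ∀ φ : Fin m → E d → ℝ, (∀ α, IsTest Ω (φ α)) → |F φ| ≤ K * (h1Norm Ω φ).toReal

/-- `Ω` has Lipschitz boundary: near each boundary point, for a suitable unit vector `e`
(the vertical direction), `Ω` is the region above the graph of a Lipschitz function `γ` of the
variables orthogonal to `e`. -/
def HasLipschitzBoundary {d : ℕ} (Ω : Set (E d)) : Prop :=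
  ∀ p ∈ frontier Ω, ∃ (e : E d) (γ : E d → ℝ) (K : ℝ≥0) (r : ℝ),
    ‖e‖ = 1 ∧ LipschitzWith K γ ∧ (∀ (x : E d) (t : ℝ), γ (x + t • e) = γ x) ∧ 0 < r ∧
    ∀ x ∈ Metric.ball p r, (x ∈ Ω ↔ γ x < inner ℝ e x)

/-- A bounded Lipschitz domain. -/
def IsBoundedLipschitzDomain {d : ℕ} (Ω : Set (E d)) : Prop :=
  IsOpen Ω ∧ Bornology.IsBounded Ω ∧ HasLipschitzBoundary Ω

/-! ### The operators -/

/-- A coefficient matrix: `A i j α β y` is `a_{ij}^{αβ}(y)`. -/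
abbrev Coeff (d m : ℕ) : Type := Fin d → Fin d → Fin m → Fin m → E d → ℝ

/-- `A` is bounded and measurable. -/
def IsBoundedMeasurable {d m : ℕ} (A : Coeff d m) : Prop :=
  (∀ i j α β, AEMeasurable (A i j α β) volume) ∧
    ∃ M : ℝ, ∀ i j α β, ∀ᵐ y, |A i j α β y| ≤ M

/-- The ellipticity condition
`μ |ξ|² ≤ a_{ij}^{αβ}(y) ξ_i^α ξ_j^β ≤ μ⁻¹ |ξ|²` for a.e. `y` and all `ξ`. -/
def IsElliptic {d m : ℕ} (μ : ℝ) (A : Coeff d m) : Prop :=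
  ∀ᵐ y : E d, ∀ ξ : Fin d → Fin m → ℝ,
    μ * ∑ i, ∑ α, ξ i α ^ 2 ≤ ∑ i, ∑ j, ∑ α, ∑ β, A i j α β y * ξ i α * ξ j β ∧
    ∑ i, ∑ j, ∑ α, ∑ β, A i j α β y * ξ i α * ξ j β ≤ μ⁻¹ * ∑ i, ∑ α, ξ i α ^ 2

/-- The rescaled matrix `A(x/ε)`. -/
def rescale {d m : ℕ} (ε : ℝ) (A : Coeff d m) : Coeff d m :=
  fun i j α β x => A i j α β (ε⁻¹ • x)

/-- A constant matrix as a coefficient matrix. -/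
def constCoeff {d m : ℕ} (Ahat : Fin d → Fin d → Fin m → Fin m → ℝ) : Coeff d m :=
  fun i j α β _ => Ahat i j α β

/-- `-div (A ∇u) = F` in `Ω` in the weak sense:
`∫_Ω a_{ij}^{αβ} ∂_j u^β ∂_i φ^α = F(φ)` for all `φ ∈ C_0^∞(Ω; ℝ^m)`. -/
def IsWeakSolution {d m : ℕ} (Ω : Set (E d)) (A : Coeff d m)
    (F : (Fin m → E d → ℝ) →ₗ[ℝ] ℝ) (u : Fin m → E d → ℝ) : Prop :=
  ∀ φ : Fin m → E d → ℝ, (∀ α, IsTest Ω (φ α)) →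
    ∫ x in Ω, ∑ i, ∑ j, ∑ α, ∑ β, A i j α β x * weakDeriv Ω j (u β) x * pderiv i (φ α) x = F φ

/-! ### Correctors and homogenized coefficients -/

/-- `ψ = (ψ_{ij}^{αβ})`: for each `j`, `β` the function `ψ_j^β = (ψ_{ij}^{αβ})_{i,α}` lies in
`V²_pot` and `⟨(a_{ij}^{αβ} + a_{ik}^{αγ} ψ_{kj}^{γβ}) φ_i^α⟩ = 0` for all `φ ∈ V²_pot`. -/
def IsPotentialCorrector {d m : ℕ} (A ψ : Coeff d m) : Prop :=
  ∀ (j : Fin d) (β : Fin m), MemVpot (fun i α => ψ i j α β) ∧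
    ∀ φ : Fin d → Fin m → E d → ℝ, MemVpot φ →
      HasMeanValue (fun y => ∑ i, ∑ α,
        (A i j α β y + ∑ k, ∑ γ, A i k α γ y * ψ k j γ β y) * φ i α y) 0

/-- `Ahat` is the homogenized matrix, `⟨a_{ij}^{αβ} + a_{ik}^{αγ} ψ_{kj}^{γβ}⟩`. -/
def IsHomogenized {d m : ℕ} (A ψ : Coeff d m)
    (Ahat : Fin d → Fin d → Fin m → Fin m → ℝ) : Prop :=
  ∀ i j α β, HasMeanValue (fun y => A i j α β y + ∑ k, ∑ γ, A i k α γ y * ψ k j γ β y)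
    (Ahat i j α β)

/-- `u ∈ H¹_loc(ℝ^d)` with `u, ∇u ∈ L²_{loc,unif}(ℝ^d)`. -/
def MemH1LocUnif {d : ℕ} (u : E d → ℝ) : Prop :=
  MemL2LocUnif u ∧
    ∀ i, HasWeakDeriv univ i u (weakDeriv univ i u) ∧ MemL2LocUnif (weakDeriv univ i u)

/-- The approximate correctors, `χ j α β = χ_{T,j}^{αβ}`: for each `j`, `β` the function
`u = (χ_{T,j}^{αβ})_α` is the weak solution, with `u` and `∇u` in `L²_{loc,unif}`, of
`-div (A ∇u) + T⁻² u = div (A ∇P_j^β)` in `ℝ^d`, where `P_j^β(y) = y_j e^β`. -/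
def IsApproxCorrector {d m : ℕ} (A : Coeff d m) (T : ℝ)
    (χ : Fin d → Fin m → Fin m → E d → ℝ) : Prop :=
  (∀ j α β, MemH1LocUnif (χ j α β)) ∧
  ∀ (j : Fin d) (β : Fin m) (v : Fin m → E d → ℝ), (∀ α, IsTest univ (v α)) →
    (∫ y, ∑ i, ∑ k, ∑ α, ∑ γ, A i k α γ y * weakDeriv univ k (χ j γ β) y * pderiv i (v α) y) +
      (T ^ 2)⁻¹ * (∫ y, ∑ α, χ j α β y * v α y) =
    -∫ y, ∑ i, ∑ α, A i j α β y * pderiv i (v α) y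

/-- `b_T = A + A ∇χ_T - Ahat`. -/
def bT {d m : ℕ} (A : Coeff d m) (Ahat : Fin d → Fin d → Fin m → Fin m → ℝ)
    (χ : Fin d → Fin m → Fin m → E d → ℝ) : Coeff d m :=
  fun i j α β y => A i j α β y +
    (∑ k, ∑ γ, A i k α γ y * weakDeriv univ k (χ j γ β) y) - Ahat i j α β

/-- The dual approximate correctors `φ_T = (φ_{T,ij}^{αβ})`: the weak solutions, with `φ_T` and
`∇φ_T` in `L²_{loc,unif}`, of `-Δφ_T + T⁻² φ_T = b_T - ⟨b_T⟩` in `ℝ^d`. -/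
def IsDualApproxCorrector {d m : ℕ} (A : Coeff d m)
    (Ahat : Fin d → Fin d → Fin m → Fin m → ℝ) (T : ℝ)
    (χ : Fin d → Fin m → Fin m → E d → ℝ) (φ : Coeff d m) : Prop :=
  ∀ i j α β, MemH1LocUnif (φ i j α β) ∧
    ∃ c : ℝ, HasMeanValue (bT A Ahat χ i j α β) c ∧
      ∀ v : E d → ℝ, IsTest univ v →
        (∫ y, ∑ k, weakDeriv univ k (φ i j α β) y * pderiv k v y) +
          (T ^ 2)⁻¹ * (∫ y, φ i j α β y * v y) =
        ∫ y, (bT A Ahat χ i j α β y - c) * v y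

/-- `2 T⁻¹ + ‖∇χ_T - ψ‖_{B²} + T⁻¹ ‖χ_T‖_{S²_1} + T⁻² ‖φ_T‖_{S²_1} + T⁻¹ ‖∇φ_T‖_{S²_1}`. -/
def errorParam {d m : ℕ} (T : ℝ) (ψ : Coeff d m) (χ : Fin d → Fin m → Fin m → E d → ℝ)
    (φ : Coeff d m) : ℝ :=
  2 * T⁻¹ +
  (besicovitchSeminorm (fun q : Fin d × Fin d × Fin m × Fin m => fun y =>
    weakDeriv univ q.1 (χ q.2.1 q.2.2.1 q.2.2.2) y - ψ q.1 q.2.1 q.2.2.1 q.2.2.2 y)).toReal +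
  T⁻¹ * (stepanovNorm (fun q : Fin d × Fin m × Fin m => χ q.1 q.2.1 q.2.2) 1).toReal +
  (T ^ 2)⁻¹ * (stepanovNorm (fun q : Fin d × Fin d × Fin m × Fin m =>
    φ q.1 q.2.1 q.2.2.1 q.2.2.2) 1).toReal +
  T⁻¹ * (stepanovNorm (fun q : Fin d × Fin d × Fin d × Fin m × Fin m =>
    weakDeriv univ q.1 (φ q.2.1 q.2.2.1 q.2.2.2.1 q.2.2.2.2)) 1).toReal

/-! ### The smoothing operator -/

/-- A mollifier: a nonnegative `ζ ∈ C_0^∞(B(0,1))` with `∫ ζ = 1`. -/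
def IsMollifier {d : ℕ} (ζ : E d → ℝ) : Prop :=
  IsTest (Metric.ball 0 1) ζ ∧ (∀ x, 0 ≤ ζ x) ∧ ∫ x, ζ x = 1

/-- The boundary layer `Ω_δ = {x ∈ Ω : dist(x, ∂Ω) < δ}`. -/
def boundaryLayer {d : ℕ} (Ω : Set (E d)) (δ : ℝ) : Set (E d) :=
  {x ∈ Ω | Metric.infDist x (frontier Ω) < δ}

/-- A cut-off function `η ∈ C_0^∞(Ω)` with `η = 0` in `Ω_δ`, `η = 1` in `Ω \ Ω_{2δ}` and
`|∇η| ≤ Cη / δ`. -/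
def IsCutoff {d : ℕ} (Ω : Set (E d)) (Cη δ : ℝ) (η : E d → ℝ) : Prop :=
  IsTest Ω η ∧ (∀ x ∈ boundaryLayer Ω δ, η x = 0) ∧
    (∀ x ∈ Ω \ boundaryLayer Ω (2 * δ), η x = 1) ∧ ∀ x, ‖fderiv ℝ η x‖ ≤ Cη / δ

/-- `K_{ε,δ} f = ζ_ε * (η f)` with `ζ_ε(y) = ε^{-d} ζ(y/ε)`. -/
def smoothing {d : ℕ} (ζ η : E d → ℝ) (ε : ℝ) (f : E d → ℝ) (x : E d) : ℝ :=
  ∫ y, (ε ^ d)⁻¹ * ζ (ε⁻¹ • y) * (η (x - y) * f (x - y))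

/-- The two-scale expansion error
`w^α = u_ε^α - u_0^α - ε χ_{T,k}^{αβ}(x/ε) K_{ε,δ}(∂u_0^β/∂x_k)`. -/
def twoScaleError {d m : ℕ} (Ω : Set (E d)) (ζ η : E d → ℝ) (ε : ℝ)
    (χ : Fin d → Fin m → Fin m → E d → ℝ) (uε u₀ : Fin m → E d → ℝ) : Fin m → E d → ℝ :=
  fun α x => uε α x - u₀ α x -
    ε * ∑ k, ∑ β, χ k α β (ε⁻¹ • x) * smoothing ζ η ε (weakDeriv Ω k (u₀ β)) x

end

/-!
Write `g = ζ_ε * (η ∇u₀)`, so that `w = u_ε - u₀ - ε χ_T(x/ε) g`. Because `u_ε` and `u₀` solve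
their equations with the same right-hand side, testing `-div(A(x/ε)∇w)` with a test function `v`
leaves three terms (`form_identity`):

* `∫ (Â - A(x/ε)) (∇u₀ - g) ∇v`,
* `-∫ b_T(x/ε) g ∇v`,
* `-ε ∫ A(x/ε) χ_T(x/ε) ∇g ∇v`.

Each of them is at most `C δ^{1/2} ‖u₀‖_{H²} ‖∇v‖_{L²}`. Ellipticity, the Poincaré inequality and
the density of test functions then give the bound for `w` (`exists_energy_estimate`).

In the first term `∇u₀ - g` consists of `(1 - η)∇u₀`, which lives in the boundary layer
`Ω_{2δ}`, where an `H¹` function has `L²` norm `O(δ^{1/2})` (`exists_boundaryLayer_le`), and of the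
mollification error of `η∇u₀`, which is at most `ε ‖∇(η∇u₀)‖`. The same boundary layer estimate
absorbs half of the loss in `∇η = O(δ⁻¹)`, so `η∇u₀` has `H¹` norm `O(δ^{-1/2})`, and `2ε ≤ δ`
(`exists_smoothing_bounds`). It remains to gain a full factor `δ` in the other two terms, in
terms of the `H¹` norm of `η∇u₀`.

For the third term this is immediate: an `L²_{loc,unif}` function at scale `ε`, multiplied by a
function mollified at scale `ε`, is bounded in `L²` by the Stepanov norm of the former
(`isMultiplier_rescale`), and `ε ‖χ_T‖_{S²_1} ≤ δ`.

For the second term the equation of `φ_T` writes the rescaled `b_T` as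
`⟨b_T⟩ + ε² φ_T - ε² Δ(φ_T(x/ε))`. The mean value `⟨b_T⟩` is at most a multiple of
`‖∇χ_T - ψ‖_{B²}`, since `A + Aψ - Â` has mean value zero (`exists_bT_mean_bound`), and the second
summand is a multiplier of norm `O(ε² ‖φ_T‖_{S²_1})`. In the last summand the second derivatives
`∂_k ∂_k φ_{T,i}` are written as
`∂_k (∂_k φ_{T,i} - ∂_i φ_{T,k}) + ∂_i ∂_k φ_{T,k}`. After integration by parts the skew-symmetric
part meets only first derivatives of `v`, so it is bounded by `ε ‖∇φ_T‖_{S²_1}`. The rest is the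
gradient of `h = div φ_T`, which solves `-Δh + T⁻² h = div b_T = T⁻² χ_T`. Rescaled, this reads
`Δh = h - χ_T(x/ε)`, so that `∇h` is controlled by `h` and `χ_T` without any regularity theory:
the function `z ↦ ∫ h(x + z) G(x) dx` is smooth, and the gradient of a smooth function is bounded
by the suprema of the function and of its Laplacian (`exists_gradient_bound`). This proves the
flux estimate (`exists_abs_sum_flux_le`, `exists_abs_bT_le`).

Finally `w ∈ H¹_0(Ω)`, because `η` vanishes at distance less than `δ > ε` from the boundary, which
makes `g` a test function in `Ω`.
-/

noncomputable section

variable {d m : ℕ}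

/-! ### Test functions -/

lemma IsTest.continuous {Ω : Set (E d)} {φ : E d → ℝ} (h : IsTest Ω φ) : Continuous φ :=
  h.1.continuous

lemma IsTest.differentiable {Ω : Set (E d)} {φ : E d → ℝ} (h : IsTest Ω φ) :
    Differentiable ℝ φ := h.1.differentiable (by simp)

lemma IsTest.mono {Ω Ω' : Set (E d)} {φ : E d → ℝ} (h : IsTest Ω φ) (hs : Ω ⊆ Ω') :
    IsTest Ω' φ := ⟨h.1, h.2.1, h.2.2.trans hs⟩

lemma IsTest.toUniv {Ω : Set (E d)} {φ : E d → ℝ} (h : IsTest Ω φ) : IsTest univ φ :=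
  h.mono (subset_univ _)

lemma IsTest.eq_zero {Ω : Set (E d)} {φ : E d → ℝ} (h : IsTest Ω φ) {x : E d} (hx : x ∉ Ω) :
    φ x = 0 := image_eq_zero_of_notMem_tsupport (fun h' => hx (h.2.2 h'))

lemma IsTest.memLp {Ω : Set (E d)} {φ : E d → ℝ} (h : IsTest Ω φ) (p : ℝ≥0∞)
    (μ : Measure (E d)) [IsFiniteMeasureOnCompacts μ] : MemLp φ p μ :=
  h.continuous.memLp_of_hasCompactSupport h.2.1

lemma IsTest.integrable {Ω : Set (E d)} {φ : E d → ℝ} (h : IsTest Ω φ) : Integrable φ :=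
  h.continuous.integrable_of_hasCompactSupport h.2.1

lemma IsTest.exists_bound {Ω : Set (E d)} {φ : E d → ℝ} (h : IsTest Ω φ) :
    ∃ M : ℝ, 0 ≤ M ∧ ∀ x, |φ x| ≤ M := by
  obtain ⟨M, hM⟩ := h.continuous.bounded_above_of_compact_support h.2.1
  exact ⟨M, (norm_nonneg _).trans (hM 0), hM⟩

lemma IsTest.zero {Ω : Set (E d)} : IsTest Ω (fun _ => (0 : ℝ)) := by
  refine ⟨contDiff_const, HasCompactSupport.zero, ?_⟩
  have : tsupport (fun _ : E d => (0 : ℝ)) = ∅ := by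
    rw [tsupport_eq_empty_iff]; rfl
  simp [this]

lemma IsTest.mul_left {Ω : Set (E d)} {f φ : E d → ℝ} (hf : ContDiff ℝ ∞ f) (h : IsTest Ω φ) :
    IsTest Ω (fun x => f x * φ x) :=
  ⟨hf.mul h.1, h.2.1.mul_left, (tsupport_mul_subset_right (f := f) (g := φ)).trans h.2.2⟩

lemma IsTest.mul_right {Ω : Set (E d)} {f φ : E d → ℝ} (h : IsTest Ω φ) (hf : ContDiff ℝ ∞ f) :
    IsTest Ω (fun x => φ x * f x) :=
  ⟨h.1.mul hf, h.2.1.mul_right, (tsupport_mul_subset_left (f := φ) (g := f)).trans h.2.2⟩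

lemma IsTest.const_mul {Ω : Set (E d)} {φ : E d → ℝ} (c : ℝ) (h : IsTest Ω φ) :
    IsTest Ω (fun x => c * φ x) := IsTest.mul_left contDiff_const h

lemma IsTest.add {Ω : Set (E d)} {φ ψ : E d → ℝ} (h : IsTest Ω φ) (h' : IsTest Ω ψ) :
    IsTest Ω (fun x => φ x + ψ x) :=
  ⟨h.1.add h'.1, h.2.1.add h'.2.1,
    (tsupport_add φ ψ).trans (union_subset h.2.2 h'.2.2)⟩

lemma IsTest.neg {Ω : Set (E d)} {φ : E d → ℝ} (h : IsTest Ω φ) :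
    IsTest Ω (fun x => - φ x) := by
  simpa using h.const_mul (-1)

lemma IsTest.sub {Ω : Set (E d)} {φ ψ : E d → ℝ} (h : IsTest Ω φ) (h' : IsTest Ω ψ) :
    IsTest Ω (fun x => φ x - ψ x) := by
  simpa [sub_eq_add_neg] using h.add h'.neg

lemma contDiff_pderiv {f : E d → ℝ} (hf : ContDiff ℝ ∞ f) (i : Fin d) :
    ContDiff ℝ ∞ (pderiv i f) :=
  (hf.fderiv_right (m := ∞) (by simp)).clm_apply contDiff_const

lemma IsTest.pderiv {Ω : Set (E d)} {φ : E d → ℝ} (h : IsTest Ω φ) (i : Fin d) :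
    IsTest Ω (pderiv i φ) := by
  refine ⟨contDiff_pderiv h.1 i, h.2.1.fderiv_apply (𝕜 := ℝ) _, ?_⟩
  exact (tsupport_fderiv_apply_subset ℝ (basisVec i)).trans h.2.2

/-- Affine changes of variables keep test functions on the whole space. -/
lemma IsTest.comp_affine {φ : E d → ℝ} (h : IsTest univ φ) {c : ℝ} (hc : c ≠ 0) (z : E d) :
    IsTest univ (fun x => φ (c • x + z)) := by
  refine ⟨h.1.comp ((contDiff_const_smul c).add contDiff_const), ?_, subset_univ _⟩
  have := h.2.1.comp_homeomorph ((Homeomorph.smulOfNeZero c hc).trans (Homeomorph.addRight z))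
  simpa [Function.comp_def] using this

lemma pderiv_sub {f g : E d → ℝ} (hf : Differentiable ℝ f) (hg : Differentiable ℝ g) (i : Fin d)
    (x : E d) : pderiv i (fun x => f x - g x) x = pderiv i f x - pderiv i g x := by
  simp only [pderiv]
  rw [fderiv_fun_sub (hf x) (hg x)]; simp

lemma pderiv_mul {f g : E d → ℝ} (hf : Differentiable ℝ f) (hg : Differentiable ℝ g) (i : Fin d)
    (x : E d) : pderiv i (fun x => f x * g x) x = pderiv i f x * g x + f x * pderiv i g x := by
  simp only [pderiv]
  rw [fderiv_fun_mul (hf x) (hg x)]; simp; ring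

lemma pderiv_comp_affine {f : E d → ℝ} (hf : Differentiable ℝ f) (c : ℝ) (z : E d) (i : Fin d)
    (x : E d) : pderiv i (fun x => f (c • x + z)) x = c * pderiv i f (c • x + z) := by
  have h1 : HasFDerivAt (fun x : E d => c • x + z) (c • ContinuousLinearMap.id ℝ (E d)) x :=
    ((hasFDerivAt_id x).const_smul c).add_const z
  have := (hf (c • x + z)).hasFDerivAt.comp x h1
  simp only [pderiv]
  rw [show (fun x => f (c • x + z)) = f ∘ (fun x => c • x + z) from rfl, this.fderiv]
  simp

lemma pderiv_comm {f : E d → ℝ} (hf : ContDiff ℝ ∞ f) (i j : Fin d) (x : E d) :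
    pderiv i (pderiv j f) x = pderiv j (pderiv i f) x := by
  have hd : DifferentiableAt ℝ (fderiv ℝ f) x :=
    ((hf.fderiv_right (m := ∞) (by simp)).differentiable (by simp)) x
  have key : ∀ i j : Fin d, pderiv i (pderiv j f) x
      = fderiv ℝ (fderiv ℝ f) x (basisVec i) (basisVec j) := by
    intro i j
    have : HasFDerivAt (fun y => fderiv ℝ f y (basisVec j))
      ((fderiv ℝ (fderiv ℝ f) x).flip (basisVec j)) x := by
      simpa using hd.hasFDerivAt.clm_apply (hasFDerivAt_const (basisVec j) x)
    show fderiv ℝ (fun y => fderiv ℝ f y (basisVec j)) x (basisVec i) = _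
    rw [this.fderiv]; rfl
  rw [key, key]
  exact ((contDiff_infty.1 hf 2).contDiffAt.isSymmSndFDerivAt (by simp)) _ _

lemma fderiv_apply_eq_sum_pderiv (f : E d → ℝ) (x v : E d) :
    fderiv ℝ f x v = ∑ i, v i * pderiv i f x := by
  conv_lhs => rw [show v = ∑ i, v i • (basisVec i : E d) from by
    ext j; simp [basisVec, Finset.sum_apply, Pi.single_apply]]
  simp [pderiv]

/-! ### Integration against test functions -/

/-- The product of a locally integrable function and a test function is integrable. -/
lemma integrable_mul_test {Ω : Set (E d)} {u φ : E d → ℝ} (hu : LocallyIntegrableOn u Ω)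
    (hφ : IsTest Ω φ) : Integrable (fun x => u x * φ x) := by
  have hK : IsCompact (tsupport φ) := hφ.2.1
  have h1 : IntegrableOn u (tsupport φ) := hu.integrableOn_compact_subset hφ.2.2 hK
  have h2 : IntegrableOn (fun x => u x * φ x) (tsupport φ) :=
    h1.mul_continuousOn hφ.continuous.continuousOn hK
  refine (integrableOn_iff_integrable_of_support_subset ?_).1 h2
  intro x hx
  apply subset_tsupport
  intro h0
  simp [h0] at hx

lemma setIntegral_mul_test {Ω : Set (E d)} (u : E d → ℝ) {φ : E d → ℝ} (hφ : IsTest Ω φ) :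
    ∫ x in Ω, u x * φ x = ∫ x, u x * φ x :=
  setIntegral_eq_integral_of_forall_compl_eq_zero (fun x hx => by simp [hφ.eq_zero hx])

lemma integral_mul_pderiv {f g : E d → ℝ} (hf : ContDiff ℝ ∞ f) (hg : IsTest univ g) (i : Fin d) :
    ∫ x, f x * pderiv i g x = - ∫ x, pderiv i f x * g x := by
  have hf' : LocallyIntegrableOn f univ := hf.continuous.locallyIntegrable.locallyIntegrableOn _
  have hf'' : LocallyIntegrableOn (pderiv i f) univ :=
    (contDiff_pderiv hf i).continuous.locallyIntegrable.locallyIntegrableOn _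
  exact integral_mul_fderiv_eq_neg_fderiv_mul_of_integrable (integrable_mul_test hf'' hg)
    (integrable_mul_test hf' (hg.pderiv i)) (integrable_mul_test hf' hg)
    (fun x _ => (hf.differentiable (by simp)) x) (fun x _ => hg.differentiable x)

lemma integral_pderiv_eq_zero {g : E d → ℝ} (hg : IsTest univ g) (i : Fin d) :
    ∫ x, pderiv i g x = 0 := by
  have := integral_mul_pderiv (f := fun _ => 1) contDiff_const hg i
  simpa [pderiv] using this

/-- Integration by parts with the derivative moved from a test function to a smooth function. -/
lemma integral_pderiv_mul {f g : E d → ℝ} (hf : ContDiff ℝ ∞ f) (hg : IsTest univ g) (i : Fin d) :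
    ∫ x, pderiv i f x * g x = - ∫ x, f x * pderiv i g x := by
  rw [integral_mul_pderiv hf hg, neg_neg]

/-! ### Weak derivatives -/

lemma HasWeakDeriv.integral_eq {Ω : Set (E d)} {i : Fin d} {u v : E d → ℝ}
    (h : HasWeakDeriv Ω i u v) {φ : E d → ℝ} (hφ : IsTest Ω φ) :
    ∫ x, u x * pderiv i φ x = -∫ x, v x * φ x := by
  rw [← setIntegral_mul_test u (hφ.pderiv i), ← setIntegral_mul_test v hφ]
  exact h.2.2 φ hφ

lemma hasWeakDeriv_of_integral_eq {Ω : Set (E d)} {i : Fin d} {u v : E d → ℝ}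
    (hu : LocallyIntegrableOn u Ω) (hv : LocallyIntegrableOn v Ω)
    (h : ∀ φ, IsTest Ω φ → ∫ x, u x * pderiv i φ x = -∫ x, v x * φ x) :
    HasWeakDeriv Ω i u v :=
  ⟨hu, hv, fun φ hφ => by
    rw [setIntegral_mul_test u (hφ.pderiv i), setIntegral_mul_test v hφ]; exact h φ hφ⟩

lemma HasWeakDeriv.mono {Ω Ω' : Set (E d)} {i : Fin d} {u v : E d → ℝ}
    (h : HasWeakDeriv Ω i u v) (hs : Ω' ⊆ Ω) : HasWeakDeriv Ω' i u v :=
  hasWeakDeriv_of_integral_eq (h.1.mono_set hs) (h.2.1.mono_set hs)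
    (fun _ hφ => h.integral_eq (hφ.mono hs))

lemma HasWeakDeriv.ae_eq {Ω : Set (E d)} (hΩ : IsOpen Ω) {i : Fin d} {u v v' : E d → ℝ}
    (h : HasWeakDeriv Ω i u v) (h' : HasWeakDeriv Ω i u v') :
    v =ᵐ[volume.restrict Ω] v' := by
  have h0 : ∀ᵐ x, x ∈ Ω → (fun x => v x - v' x) x = 0 := by
    refine hΩ.ae_eq_zero_of_integral_contDiff_smul_eq_zero (h.2.1.sub h'.2.1) ?_
    intro g hg hgc hgs
    have hT : IsTest Ω g := ⟨hg, hgc, hgs⟩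
    have e := h.integral_eq hT
    rw [h'.integral_eq hT] at e
    have : ∀ x, g x • (v x - v' x) = v x * g x - v' x * g x := fun x => by
      simp [smul_eq_mul]; ring
    simp only [this]
    rw [integral_sub (integrable_mul_test h.2.1 hT) (integrable_mul_test h'.2.1 hT)]
    linarith
  rw [Filter.EventuallyEq, ae_restrict_iff' hΩ.measurableSet]
  filter_upwards [h0] with x hx hxΩ
  exact sub_eq_zero.1 (hx hxΩ)

lemma HasWeakDeriv.weakDeriv_spec {Ω : Set (E d)} {i : Fin d} {u v : E d → ℝ}
    (h : HasWeakDeriv Ω i u v) : HasWeakDeriv Ω i u (weakDeriv Ω i u) := by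
  have he : ∃ v, HasWeakDeriv Ω i u v := ⟨v, h⟩
  rw [weakDeriv, dif_pos he]
  exact he.choose_spec

lemma HasWeakDeriv.weakDeriv_ae_eq {Ω : Set (E d)} (hΩ : IsOpen Ω) {i : Fin d} {u v : E d → ℝ}
    (h : HasWeakDeriv Ω i u v) : weakDeriv Ω i u =ᵐ[volume.restrict Ω] v :=
  h.weakDeriv_spec.ae_eq hΩ h

lemma HasWeakDeriv.sub {Ω : Set (E d)} {i : Fin d} {u v u' v' : E d → ℝ}
    (h : HasWeakDeriv Ω i u v) (h' : HasWeakDeriv Ω i u' v') :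
    HasWeakDeriv Ω i (fun x => u x - u' x) (fun x => v x - v' x) := by
  refine hasWeakDeriv_of_integral_eq (h.1.sub h'.1) (h.2.1.sub h'.2.1) (fun φ hφ => ?_)
  simp only [sub_mul]
  rw [integral_sub (integrable_mul_test h.1 (hφ.pderiv i))
      (integrable_mul_test h'.1 (hφ.pderiv i)),
    integral_sub (integrable_mul_test h.2.1 hφ) (integrable_mul_test h'.2.1 hφ),
    h.integral_eq hφ, h'.integral_eq hφ]
  ring

lemma HasWeakDeriv.add {Ω : Set (E d)} {i : Fin d} {u v u' v' : E d → ℝ}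
    (h : HasWeakDeriv Ω i u v) (h' : HasWeakDeriv Ω i u' v') :
    HasWeakDeriv Ω i (fun x => u x + u' x) (fun x => v x + v' x) := by
  refine hasWeakDeriv_of_integral_eq (h.1.add h'.1) (h.2.1.add h'.2.1) (fun φ hφ => ?_)
  simp only [add_mul]
  rw [integral_add (integrable_mul_test h.1 (hφ.pderiv i))
      (integrable_mul_test h'.1 (hφ.pderiv i)),
    integral_add (integrable_mul_test h.2.1 hφ) (integrable_mul_test h'.2.1 hφ),
    h.integral_eq hφ, h'.integral_eq hφ]
  ring

lemma hasWeakDeriv_zero {Ω : Set (E d)} {i : Fin d} :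
    HasWeakDeriv Ω i (fun _ => (0 : ℝ)) (fun _ => 0) :=
  hasWeakDeriv_of_integral_eq (locallyIntegrableOn_zero) (locallyIntegrableOn_zero) (by simp)

lemma HasWeakDeriv.sum {ι : Type*} (s : Finset ι) {Ω : Set (E d)} {i : Fin d}
    {u v : ι → E d → ℝ} (h : ∀ k, HasWeakDeriv Ω i (u k) (v k)) :
    HasWeakDeriv Ω i (fun x => ∑ k ∈ s, u k x) (fun x => ∑ k ∈ s, v k x) := by
  classical
  induction s using Finset.induction_on with
  | empty => simpa using hasWeakDeriv_zero
  | insert a s ha ih => simpa [Finset.sum_insert ha] using (h a).add ih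

lemma IsTest.hasWeakDeriv {Ω' : Set (E d)} {φ : E d → ℝ} (h : IsTest Ω' φ) (Ω : Set (E d))
    (i : Fin d) : HasWeakDeriv Ω i φ (_root_.pderiv i φ) := by
  refine hasWeakDeriv_of_integral_eq (h.continuous.locallyIntegrable.locallyIntegrableOn _)
    ((h.pderiv i).continuous.locallyIntegrable.locallyIntegrableOn _) (fun g hg => ?_)
  exact integral_mul_pderiv h.1 hg.toUniv i

/-- Leibniz rule for the product with a test function; the product has a weak derivative in the
whole space, with the functions extended by zero. -/
lemma HasWeakDeriv.mul_test {Ω : Set (E d)} {i : Fin d} {u v θ : E d → ℝ}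
    (h : HasWeakDeriv Ω i u v) (hθ : IsTest Ω θ) :
    HasWeakDeriv univ i (fun x => θ x * u x) (fun x => pderiv i θ x * u x + θ x * v x) := by
  have i1 : Integrable (fun x => θ x * u x) := by
    simpa [mul_comm] using integrable_mul_test h.1 hθ
  have i2 : Integrable (fun x => pderiv i θ x * u x) := by
    simpa [mul_comm] using integrable_mul_test h.1 (hθ.pderiv i)
  have i3 : Integrable (fun x => θ x * v x) := by
    simpa [mul_comm] using integrable_mul_test h.2.1 hθ
  refine hasWeakDeriv_of_integral_eq (i1.locallyIntegrable.locallyIntegrableOn _)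
    ((i2.add i3).locallyIntegrable.locallyIntegrableOn _) (fun φ hφ => ?_)
  have hT : IsTest Ω (fun x => θ x * φ x) := hθ.mul_right hφ.1
  have e := h.integral_eq hT
  simp only [pderiv_mul hθ.differentiable hφ.differentiable] at e
  have j1 : Integrable (fun x => u x * (pderiv i θ x * φ x)) :=
    integrable_mul_test h.1 ((hθ.pderiv i).mul_right hφ.1)
  have j2 : Integrable (fun x => u x * (θ x * pderiv i φ x)) :=
    integrable_mul_test h.1 (hθ.mul_right (contDiff_pderiv hφ.1 i))
  have j3 : Integrable (fun x => v x * (θ x * φ x)) := integrable_mul_test h.2.1 hT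
  have e1 : ∀ x, u x * (pderiv i θ x * φ x + θ x * pderiv i φ x)
    = u x * (pderiv i θ x * φ x) + u x * (θ x * pderiv i φ x) := fun x => by ring
  simp only [e1] at e
  rw [integral_add j1 j2] at e
  have e2 : ∀ x, (pderiv i θ x * u x + θ x * v x) * φ x
    = u x * (pderiv i θ x * φ x) + v x * (θ x * φ x) := fun x => by ring
  have e3 : ∀ x, θ x * u x * pderiv i φ x = u x * (θ x * pderiv i φ x) := fun x => by ring
  simp only [e2, e3]
  rw [integral_add j1 j3]
  linarith

lemma memH1_of_hasWeakDeriv {Ω : Set (E d)} (hΩ : IsOpen Ω) {u : E d → ℝ} {v : Fin d → E d → ℝ}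
    (hu : MemLp u 2 (volume.restrict Ω)) (h : ∀ i, HasWeakDeriv Ω i u (v i))
    (hv : ∀ i, MemLp (v i) 2 (volume.restrict Ω)) : MemH1 Ω u :=
  ⟨hu, fun i => ⟨(h i).weakDeriv_spec, (hv i).ae_eq ((h i).weakDeriv_ae_eq hΩ).symm⟩⟩

/-! ### Square integrals -/

lemma eLpNorm_two_sq {α : Type*} [MeasurableSpace α] (f : α → ℝ) (μ : Measure α) :
    eLpNorm f 2 μ ^ 2 = ∫⁻ x, ‖f x‖ₑ ^ 2 ∂μ := by
  have := eLpNorm_nnreal_pow_eq_lintegral (f := f) (μ := μ) (p := 2) (by norm_num)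
  simpa using this

lemma eLpNorm_two_le_iff {α : Type*} [MeasurableSpace α] (f : α → ℝ) (μ : Measure α) (c : ℝ≥0∞) :
    eLpNorm f 2 μ ≤ c ↔ ∫⁻ x, ‖f x‖ₑ ^ 2 ∂μ ≤ c ^ 2 := by
  rw [← eLpNorm_two_sq]
  exact (ENNReal.pow_le_pow_left_iff two_ne_zero).symm

/-- The Cauchy–Schwarz inequality against the constant function `1`. -/
lemma lintegral_sq_le {α : Type*} [MeasurableSpace α] {μ : Measure α} {f : α → ℝ≥0∞}
    (hf : AEMeasurable f μ) : (∫⁻ x, f x ∂μ) ^ 2 ≤ μ univ * ∫⁻ x, f x ^ 2 ∂μ := by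
  have h := ENNReal.lintegral_mul_le_Lp_mul_Lq μ Real.HolderConjugate.two_two hf
    (g := fun _ => 1) aemeasurable_const
  simp only [Pi.mul_apply, mul_one, ENNReal.one_rpow, lintegral_const, one_mul] at h
  calc (∫⁻ x, f x ∂μ) ^ 2
      ≤ ((∫⁻ a, f a ^ (2 : ℝ) ∂μ) ^ (1 / 2 : ℝ) * μ univ ^ (1 / 2 : ℝ)) ^ 2 := by gcongr
    _ = μ univ * ∫⁻ x, f x ^ 2 ∂μ := by
        rw [mul_pow, ← ENNReal.rpow_natCast, ← ENNReal.rpow_natCast, ← ENNReal.rpow_mul,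
          ← ENNReal.rpow_mul]
        norm_num [mul_comm]

lemma abs_integral_mul_le {α : Type*} [MeasurableSpace α] {μ : Measure α} {f g : α → ℝ}
    (hf : MemLp f 2 μ) (hg : MemLp g 2 μ) :
    |∫ x, f x * g x ∂μ| ≤ (eLpNorm f 2 μ).toReal * (eLpNorm g 2 μ).toReal := by
  have h := eLpNorm_smul_le_mul_eLpNorm (p := 2) (q := 2) (r := 1) hg.1 hf.1
  rw [← ENNReal.toReal_mul]
  refine le_trans ?_ (ENNReal.toReal_mono
    (ENNReal.mul_ne_top hf.eLpNorm_ne_top hg.eLpNorm_ne_top) h)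
  rw [← Real.norm_eq_abs]
  refine (norm_integral_le_lintegral_norm _).trans ?_
  rw [eLpNorm_one_eq_lintegral_enorm]
  refine le_of_eq (congrArg _ (lintegral_congr fun x => ?_))
  rw [ofReal_norm]; rfl

/-! ### Kernels and mollification -/

/-- `k` is a smoothing kernel of radius `s`: a nonnegative test function supported in `B(0, s)`
with integral one. -/
structure IsKernel (k : E d → ℝ) (s : ℝ) : Prop where
  test : IsTest (Metric.ball 0 s) k
  nonneg : ∀ x, 0 ≤ k x
  integral_eq : ∫ x, k x = 1

/-- The convolution `k * F`. -/
def mollify (k F : E d → ℝ) (x : E d) : ℝ := ∫ y, k y * F (x - y)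

lemma mollify_eq_convolution (k F : E d → ℝ) :
    mollify k F = convolution k F (ContinuousLinearMap.mul ℝ ℝ) volume := rfl

lemma mollify_swap (k F : E d → ℝ) (x : E d) : mollify k F x = ∫ y, k (x - y) * F y := by
  rw [mollify_eq_convolution, convolution_eq_swap]; rfl

lemma exists_isKernel {s : ℝ} (hs : 0 < s) : ∃ k : E d → ℝ, IsKernel k s := by
  let f : ContDiffBump (0 : E d) := ⟨s / 4, s / 2, by positivity, by linarith⟩
  refine ⟨f.normed volume, ⟨f.contDiff_normed, f.hasCompactSupport_normed, ?_⟩,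
    f.nonneg_normed, f.integral_normed⟩
  rw [f.tsupport_normed_eq]
  exact Metric.closedBall_subset_ball (by simp [f]; linarith)

/-- The dilation `ζ_ε(y) = ε^{-d} ζ(y/ε)`. -/
def dilate (ζ : E d → ℝ) (ε : ℝ) (y : E d) : ℝ := (ε ^ d)⁻¹ * ζ (ε⁻¹ • y)

lemma IsMollifier.isKernel_dilate {ζ : E d → ℝ} (h : IsMollifier ζ) {ε : ℝ} (hε : 0 < ε) :
    IsKernel (dilate ζ ε) ε := by
  obtain ⟨h1, h2, h3⟩ := h
  have hT : IsTest univ (fun y => ζ (ε⁻¹ • y)) := by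
    simpa using h1.toUniv.comp_affine (inv_ne_zero hε.ne') 0
  refine ⟨⟨(hT.const_mul _).1, (hT.const_mul _).2.1, ?_⟩, fun x => mul_nonneg (by positivity) (h2 _),
    ?_⟩
  · have hcl : tsupport (dilate ζ ε) ⊆ (fun y => ε⁻¹ • y) ⁻¹' tsupport ζ := by
      refine closure_minimal ?_ ((isClosed_tsupport ζ).preimage (continuous_const_smul _))
      intro y hy
      apply subset_tsupport
      intro h0
      simp [dilate, h0] at hy
    intro y hy
    have := h1.2.2 (hcl hy)
    simp only [Metric.mem_ball, dist_zero_right, norm_smul, norm_inv, Real.norm_eq_abs,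
      abs_of_pos hε] at this ⊢
    rwa [inv_mul_lt_iff₀ hε, mul_one] at this
  · simp only [dilate]
    rw [integral_const_mul, Measure.integral_comp_smul, h3]
    simp only [finrank_euclideanSpace, Fintype.card_fin, inv_pow, inv_inv, smul_eq_mul, mul_one]
    rw [abs_of_pos (by positivity)]
    field_simp

lemma smoothing_eq_mollify (ζ η : E d → ℝ) (ε : ℝ) (f : E d → ℝ) :
    smoothing ζ η ε f = mollify (dilate ζ ε) (fun x => η x * f x) := rfl

lemma contDiff_mollify {k F : E d → ℝ} (hk : IsTest univ k) (hF : LocallyIntegrable F) :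
    ContDiff ℝ ∞ (mollify k F) := by
  rw [mollify_eq_convolution]
  exact HasCompactSupport.contDiff_convolution_left (n := (⊤ : ℕ∞)) _ hk.2.1 hk.1 hF

lemma pderiv_mollify {k F : E d → ℝ} (hk : IsTest univ k) (hF : LocallyIntegrable F) (i : Fin d)
    (x : E d) : pderiv i (mollify k F) x = mollify (pderiv i k) F x := by
  have h := HasCompactSupport.hasFDerivAt_convolution_left (ContinuousLinearMap.mul ℝ ℝ) hk.2.1
    (hk.1.of_le (by simp)) hF (μ := volume) x
  rw [pderiv, mollify_eq_convolution, h.fderiv, mollify_eq_convolution]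
  have hcs : HasCompactSupport (fderiv ℝ k) := hk.2.1.fderiv ℝ
  have hcd : Continuous (fderiv ℝ k) := hk.1.continuous_fderiv (by simp)
  have hex := hcs.convolutionExists_left ((ContinuousLinearMap.mul ℝ ℝ).precompL (E d))
    (hcd) hF x
  rw [convolution_def, ContinuousLinearMap.integral_apply hex]
  rfl

/-- Mollification of a weak derivative is the classical derivative of the mollification. -/
lemma mollify_test {k : E d → ℝ} {i : Fin d} {F G : E d → ℝ} (hk : IsTest univ k)
    (h : HasWeakDeriv univ i F G) (x : E d) :
    pderiv i (mollify k F) x = mollify k G x := by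
  rw [pderiv_mollify hk (locallyIntegrableOn_univ.1 h.1), mollify_swap, mollify_swap]
  have hT : IsTest univ (fun y => k (x - y)) := by
    simpa [sub_eq_add_neg, add_comm] using hk.comp_affine (c := -1) (by norm_num) x
  have e := h.integral_eq hT
  have e1 : ∀ y, pderiv i (fun y => k (x - y)) y = - pderiv i k (x - y) := by
    intro y
    have := pderiv_comp_affine hk.differentiable (-1) x i y
    simpa [sub_eq_add_neg, add_comm] using this
  simp only [e1, mul_neg, integral_neg, neg_inj] at e
  simpa [mul_comm] using e

lemma mollify_eq_zero {k F : E d → ℝ} {s : ℝ} (hk : IsTest (Metric.ball 0 s) k) {x : E d}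
    (hF : ∀ y, dist x y < s → F y = 0) : mollify k F x = 0 := by
  rw [mollify]
  refine integral_eq_zero_of_ae (Eventually.of_forall fun y => ?_)
  show k y * F (x - y) = 0
  by_cases hy : y ∈ Metric.ball (0 : E d) s
  · rw [hF (x - y) (by simpa [dist_eq_norm] using hy)]; simp
  · rw [hk.eq_zero hy]; simp

/-- Mollifying at a small scale a function that vanishes off a compact subset of `Ω` gives a test
function on `Ω`. -/
lemma isTest_mollify {Ω K : Set (E d)} {k F : E d → ℝ} {s : ℝ}
    (hk : IsTest (Metric.ball 0 s) k) (hK : IsCompact K) (hF : LocallyIntegrable F)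
    (hFK : ∀ x, x ∉ K → F x = 0) (hKΩ : Metric.cthickening s K ⊆ Ω) :
    IsTest Ω (mollify k F) := by
  have hsub : tsupport (mollify k F) ⊆ Metric.cthickening s K := by
    refine closure_minimal ?_ Metric.isClosed_cthickening
    intro x hx
    by_contra hx'
    apply hx
    refine mollify_eq_zero hk (fun y hy => hFK y fun hyK => hx' ?_)
    exact Metric.mem_cthickening_of_dist_le x y s K hyK hy.le
  exact ⟨contDiff_mollify hk.toUniv hF,
    hK.cthickening.of_isClosed_subset (isClosed_tsupport _) hsub, hsub.trans hKΩ⟩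

lemma IsKernel.lintegral_eq {k : E d → ℝ} {s : ℝ} (hk : IsKernel k s) :
    ∫⁻ x, ENNReal.ofReal (k x) = 1 := by
  rw [← ofReal_integral_eq_lintegral_ofReal hk.test.integrable (Eventually.of_forall hk.nonneg),
    hk.integral_eq, ENNReal.ofReal_one]

/-- Jensen's inequality for the probability density `k (x - ·)`. -/
lemma IsKernel.enorm_mollify_sq_le {k F : E d → ℝ} {s : ℝ} (hk : IsKernel k s)
    (hF : AEStronglyMeasurable F) (x : E d) :
    ‖mollify k F x‖ₑ ^ 2 ≤ ∫⁻ y, ENNReal.ofReal (k (x - y)) * ‖F y‖ₑ ^ 2 := by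
  have hkm : Measurable (fun y => ENNReal.ofReal (k (x - y))) :=
    (hk.test.continuous.comp (continuous_const.sub continuous_id)).measurable.ennreal_ofReal
  have h1 : ∫⁻ y, ENNReal.ofReal (k (x - y)) = 1 := by
    rw [lintegral_sub_left_eq_self (fun y => ENNReal.ofReal (k y)) x, hk.lintegral_eq]
  set ν := (volume : Measure (E d)).withDensity (fun y => ENNReal.ofReal (k (x - y))) with hν
  have hF' : AEMeasurable (fun y => ‖F y‖ₑ) ν :=
    (hF.enorm).mono_ac (withDensity_absolutelyContinuous _ _)
  have hle : ‖mollify k F x‖ₑ ≤ ∫⁻ y, ‖F y‖ₑ ∂ν := by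
    rw [hν, lintegral_withDensity_eq_lintegral_mul₀ hkm.aemeasurable hF.enorm, mollify_swap]
    refine (enorm_integral_le_lintegral_enorm _).trans (le_of_eq ?_)
    congr 1; ext y
    simp [enorm_mul, Real.enorm_of_nonneg (hk.nonneg _)]
  calc ‖mollify k F x‖ₑ ^ 2 ≤ (∫⁻ y, ‖F y‖ₑ ∂ν) ^ 2 := by gcongr
    _ ≤ ν univ * ∫⁻ y, ‖F y‖ₑ ^ 2 ∂ν := lintegral_sq_le hF'
    _ = _ := by
      rw [hν, withDensity_apply _ MeasurableSet.univ, Measure.restrict_univ, h1, one_mul,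
        lintegral_withDensity_eq_lintegral_mul₀ hkm.aemeasurable (hF.enorm.pow_const 2)]
      rfl

/-- A weighted `L²` bound for mollifications: the weight only matters through its averages
against the kernel. -/
lemma IsKernel.lintegral_mul_mollify_sq_le {k F : E d → ℝ} {s : ℝ} (hk : IsKernel k s)
    (hF : AEStronglyMeasurable F) {W : E d → ℝ≥0∞} (hW : AEMeasurable W) {c : ℝ≥0∞}
    (hc : ∀ y, ∫⁻ x, W x * ENNReal.ofReal (k (x - y)) ≤ c) :
    ∫⁻ x, W x * ‖mollify k F x‖ₑ ^ 2 ≤ c * ∫⁻ y, ‖F y‖ₑ ^ 2 := by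
  have hkm : Measurable (fun p : E d × E d => ENNReal.ofReal (k (p.1 - p.2))) :=
    (hk.test.continuous.comp (continuous_fst.sub continuous_snd)).measurable.ennreal_ofReal
  have hm : AEMeasurable (Function.uncurry fun x y : E d =>
      W x * ENNReal.ofReal (k (x - y)) * ‖F y‖ₑ ^ 2) (volume.prod volume) :=
    ((hW.comp_quasiMeasurePreserving Measure.quasiMeasurePreserving_fst).mul
      hkm.aemeasurable).mul
      ((hF.enorm.pow_const 2).comp_quasiMeasurePreserving Measure.quasiMeasurePreserving_snd)
  calc ∫⁻ x, W x * ‖mollify k F x‖ₑ ^ 2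
      ≤ ∫⁻ x, ∫⁻ y, W x * ENNReal.ofReal (k (x - y)) * ‖F y‖ₑ ^ 2 := by
        refine lintegral_mono fun x => ?_
        have hkx : Measurable (fun y => ENNReal.ofReal (k (x - y))) :=
          hkm.comp measurable_prodMk_left
        have hm' : AEMeasurable (fun y => ENNReal.ofReal (k (x - y)) * ‖F y‖ₑ ^ 2) volume :=
          hkx.aemeasurable.mul (hF.enorm.pow_const 2)
        simp only [mul_assoc]
        rw [lintegral_const_mul'' _ hm']
        gcongr
        exact hk.enorm_mollify_sq_le hF x
    _ = ∫⁻ y, ∫⁻ x, W x * ENNReal.ofReal (k (x - y)) * ‖F y‖ₑ ^ 2 := lintegral_lintegral_swap hm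
    _ ≤ ∫⁻ y, c * ‖F y‖ₑ ^ 2 := by
        refine lintegral_mono fun y => ?_
        have hky : Measurable (fun x => ENNReal.ofReal (k (x - y))) :=
          hkm.comp measurable_prodMk_right
        have hm' : AEMeasurable (fun x => W x * ENNReal.ofReal (k (x - y))) volume :=
          hW.mul hky.aemeasurable
        rw [lintegral_mul_const'' _ hm']
        gcongr
        exact hc y
    _ = c * ∫⁻ y, ‖F y‖ₑ ^ 2 := lintegral_const_mul'' _ (hF.enorm.pow_const 2)

lemma IsKernel.lintegral_mollify_sq_le {k F : E d → ℝ} {s : ℝ} (hk : IsKernel k s)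
    (hF : AEStronglyMeasurable F) :
    ∫⁻ x, ‖mollify k F x‖ₑ ^ 2 ≤ ∫⁻ y, ‖F y‖ₑ ^ 2 := by
  have := hk.lintegral_mul_mollify_sq_le hF (W := fun _ => 1) aemeasurable_const (c := 1) (by
    intro y
    simp only [one_mul]
    rw [lintegral_sub_right_eq_self (fun x => ENNReal.ofReal (k x)) y, hk.lintegral_eq])
  simpa using this

lemma IsKernel.eLpNorm_mollify_le {k F : E d → ℝ} {s : ℝ} (hk : IsKernel k s)
    (hF : AEStronglyMeasurable F) : eLpNorm (mollify k F) 2 volume ≤ eLpNorm F 2 volume := by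
  rw [eLpNorm_two_le_iff, eLpNorm_two_sq]
  exact hk.lintegral_mollify_sq_le hF

lemma MemLp.locallyIntegrable_two {F : E d → ℝ} (hF : MemLp F 2 volume) :
    LocallyIntegrable F := hF.locallyIntegrable (by norm_num)

lemma IsKernel.memLp_mollify {k F : E d → ℝ} {s : ℝ} (hk : IsKernel k s)
    (hF : MemLp F 2 volume) : MemLp (mollify k F) 2 volume :=
  ⟨(contDiff_mollify hk.test.toUniv (MemLp.locallyIntegrable_two hF)).continuous.aestronglyMeasurable,
    (hk.eLpNorm_mollify_le hF.1).trans_lt hF.2⟩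

lemma mollify_sub {k F G : E d → ℝ} (hk : IsTest univ k) (hF : LocallyIntegrable F)
    (hG : LocallyIntegrable G) (x : E d) :
    mollify k (fun y => F y - G y) x = mollify k F x - mollify k G x := by
  simp only [mollify_swap]
  have hT : IsTest univ (fun y => k (x - y)) := by
    simpa [sub_eq_add_neg, add_comm] using hk.comp_affine (c := -1) (by norm_num) x
  have h : ∀ {H : E d → ℝ}, LocallyIntegrable H → Integrable (fun y => k (x - y) * H y) :=
    fun hH => by simpa [mul_comm] using integrable_mul_test (hH.locallyIntegrableOn univ) hT
  rw [← integral_sub (h hF) (h hG)]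
  simp only [mul_sub]

/-- Mollifications of a continuous function with compact support converge in `L²`. -/
lemma exists_mollify_sub_le_of_continuous {φ : E d → ℝ} (hφ : Continuous φ)
    (hc : HasCompactSupport φ) {e : ℝ≥0∞} (he : e ≠ 0) :
    ∃ s₀ > 0, ∀ s, 0 < s → s < s₀ → ∀ k : E d → ℝ, IsKernel k s →
      eLpNorm (fun x => mollify k φ x - φ x) 2 volume ≤ e := by
  set K := Metric.cthickening 1 (tsupport φ) with hK
  have hKc : IsCompact K := IsCompact.cthickening hc
  have hKfin : volume K ≠ ⊤ := hKc.measure_lt_top.ne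
  obtain ⟨r, hr0, hr⟩ : ∃ r : ℝ, 0 < r ∧
      ENNReal.ofReal r * volume K ^ (1 / 2 : ℝ) ≤ e := by
    have hV : volume K ^ (1 / 2 : ℝ) ≠ ⊤ := by simp [hKfin]
    rcases eq_or_ne (volume K ^ (1 / 2 : ℝ)) 0 with h0 | h0
    · exact ⟨1, one_pos, by rw [h0]; simp⟩
    · rcases eq_or_ne e ⊤ with rfl | htop
      · exact ⟨1, one_pos, le_top⟩
      refine ⟨(e / volume K ^ (1 / 2 : ℝ)).toReal, ENNReal.toReal_pos ?_ ?_, ?_⟩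
      · exact ENNReal.div_ne_zero.2 ⟨he, hV⟩
      · exact ENNReal.div_ne_top htop h0
      · rw [ENNReal.ofReal_toReal (ENNReal.div_ne_top htop h0)]
        rw [ENNReal.div_mul_cancel h0 hV]
  have huc := hc.uniformContinuous_of_continuous hφ
  obtain ⟨s₀, hs0, hs⟩ := Metric.uniformContinuous_iff.1 huc r hr0
  refine ⟨min s₀ 1, lt_min hs0 one_pos, fun s hspos hsl k hk => ?_⟩
  have hs1 : s < s₀ := hsl.trans_le (min_le_left _ _)
  have hs2 : s < 1 := hsl.trans_le (min_le_right _ _)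
  have hint : ∀ x, Integrable (fun y => k y * φ (x - y)) := fun x => by
    have hφx : LocallyIntegrableOn (fun y => φ (x - y)) univ :=
      (hφ.comp (continuous_const.sub continuous_id)).locallyIntegrable.locallyIntegrableOn _
    simpa [mul_comm] using integrable_mul_test hφx hk.test.toUniv
  have hpt : ∀ x, ‖mollify k φ x - φ x‖ ≤ r := by
    intro x
    have e1 : φ x = ∫ y, k y * φ x := by rw [integral_mul_const, hk.integral_eq, one_mul]
    rw [mollify, e1, ← integral_sub (hint x) (hk.test.integrable.mul_const _)]
    calc ‖∫ y, (k y * φ (x - y) - k y * φ x)‖ ≤ ∫ y, k y * r := by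
          refine norm_integral_le_of_norm_le (hk.test.integrable.mul_const _)
            (Eventually.of_forall fun y => ?_)
          rw [← mul_sub, norm_mul, Real.norm_of_nonneg (hk.nonneg y)]
          by_cases hy : y ∈ Metric.ball (0 : E d) s
          · refine mul_le_mul_of_nonneg_left ?_ (hk.nonneg y)
            have : dist (x - y) x < s₀ := by
              simp only [Metric.mem_ball, dist_zero_right] at hy
              simpa [dist_eq_norm] using hy.trans hs1
            exact (hs this).le
          · simp [hk.test.eq_zero hy]
      _ = r := by rw [integral_mul_const, hk.integral_eq, one_mul]
  have hz : ∀ x, x ∉ K → mollify k φ x - φ x = 0 := by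
    intro x hx
    have h1 : ∀ y, dist x y < s → φ y = 0 := fun y hy => by
      by_contra h0
      exact hx (Metric.mem_cthickening_of_dist_le x y 1 _ (subset_tsupport _ h0)
        (hy.trans hs2).le)
    rw [mollify_eq_zero hk.test h1, h1 x (by simpa using hspos), sub_zero]
  have hres : eLpNorm (fun x => mollify k φ x - φ x) 2 volume
      = eLpNorm (fun x => mollify k φ x - φ x) 2 (volume.restrict K) := by
    rw [← eLpNorm_indicator_eq_eLpNorm_restrict hKc.measurableSet]
    congr 1
    refine (indicator_eq_self.2 ?_).symm
    intro x hx
    by_contra h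
    exact hx (hz x h)
  rw [hres]
  refine (eLpNorm_le_of_ae_bound (Eventually.of_forall hpt)).trans ?_
  simp only [Measure.restrict_apply MeasurableSet.univ, univ_inter]
  rw [mul_comm]
  simpa using hr

/-- Mollifications of an `L²` function converge in `L²`. -/
lemma exists_mollify_sub_le {F : E d → ℝ} (hF : MemLp F 2 volume) {e : ℝ≥0∞} (he : e ≠ 0) :
    ∃ s₀ > 0, ∀ s, 0 < s → s < s₀ → ∀ k : E d → ℝ, IsKernel k s →
      eLpNorm (fun x => mollify k F x - F x) 2 volume ≤ e := by
  have he3 : e / 3 ≠ 0 := by simp [he]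
  obtain ⟨φ, hφc, hφe, hφ, hφL⟩ := hF.exists_hasCompactSupport_eLpNorm_sub_le
    (by norm_num) he3
  obtain ⟨s₀, hs0, hs⟩ := exists_mollify_sub_le_of_continuous hφ hφc he3
  refine ⟨s₀, hs0, fun s h1 h2 k hk => ?_⟩
  have hFl := MemLp.locallyIntegrable_two hF
  have hφl := MemLp.locallyIntegrable_two hφL
  have e1 : (fun x => mollify k F x - F x) = mollify k (fun y => F y - φ y)
      + ((fun x => mollify k φ x - φ x) - (F - φ)) := by
    ext x
    simp only [Pi.add_apply, Pi.sub_apply, mollify_sub hk.test.toUniv hFl hφl]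
    ring
  have hm1 := hk.memLp_mollify (hF.sub hφL)
  have hm2 := (hk.memLp_mollify hφL).sub hφL
  rw [e1]
  calc _ ≤ eLpNorm (mollify k (fun y => F y - φ y)) 2 volume
        + eLpNorm ((fun x => mollify k φ x - φ x) - (F - φ)) 2 volume :=
        eLpNorm_add_le hm1.1 (hm2.sub (hF.sub hφL)).1 (by norm_num)
    _ ≤ eLpNorm (F - φ) 2 volume + (eLpNorm (fun x => mollify k φ x - φ x) 2 volume
        + eLpNorm (F - φ) 2 volume) := by
        gcongr
        · exact hk.eLpNorm_mollify_le (hF.sub hφL).1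
        · exact eLpNorm_sub_le hm2.1 (hF.sub hφL).1 (by norm_num)
    _ ≤ e / 3 + (e / 3 + e / 3) := by
        gcongr
        exact hs s h1 h2 k hk
    _ = e := by rw [← add_assoc, ENNReal.add_thirds]

/-- A function with square integrable weak derivatives that vanishes off a compact subset of `Ω`
is the limit in `H¹` of test functions on `Ω`. -/
lemma exists_test_approx {Ω K : Set (E d)} (hΩ : IsOpen Ω) (hK : IsCompact K) (hKΩ : K ⊆ Ω)
    {F : E d → ℝ} {G : Fin d → E d → ℝ} (hF : MemLp F 2 volume)
    (hG : ∀ i, MemLp (G i) 2 volume) (hw : ∀ i, HasWeakDeriv univ i F (G i))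
    (hFK : ∀ x, x ∉ K → F x = 0) {e : ℝ≥0∞} (he : e ≠ 0) :
    ∃ φ, IsTest Ω φ ∧ eLpNorm (fun x => φ x - F x) 2 volume ≤ e ∧
      ∀ i, eLpNorm (fun x => pderiv i φ x - G i x) 2 volume ≤ e := by
  obtain ⟨r, hr, hrΩ⟩ := hK.exists_cthickening_subset_open hΩ hKΩ
  obtain ⟨s₀, hs0, hs⟩ := exists_mollify_sub_le hF he
  choose t ht0 ht using fun i => exists_mollify_sub_le (hG i) he
  obtain ⟨s, hsp, hsr, hss, hst⟩ : ∃ s > 0, s ≤ r ∧ s < s₀ ∧ ∀ i, s < t i := by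
    have h : ∀ᶠ s in 𝓝[>] (0 : ℝ), s < r ∧ s < s₀ ∧ ∀ i, s < t i := by
      refine ((eventually_lt_nhds hr).and ((eventually_lt_nhds hs0).and
        (eventually_all.2 fun i => eventually_lt_nhds (ht0 i)))).filter_mono nhdsWithin_le_nhds
    obtain ⟨s, ⟨h1, h2, h3⟩, h4⟩ := (h.and self_mem_nhdsWithin).exists
    exact ⟨s, h4, h1.le, h2, h3⟩
  obtain ⟨k, hk⟩ := exists_isKernel (d := d) hsp
  have hFl := MemLp.locallyIntegrable_two hF
  refine ⟨mollify k F, isTest_mollify hk.test hK hFl hFK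
    ((Metric.cthickening_mono hsr K).trans hrΩ), hs s hsp hss k hk, fun i => ?_⟩
  simp only [mollify_test hk.test.toUniv (hw i)]
  exact ht i s hsp (hst i) k hk

/-! ### Estimates along line segments -/

lemma le_of_forall_add_mul {X Y c : ℝ≥0∞} (hc : c ≠ ⊤) (h : ∀ e : ℝ≥0∞, e ≠ 0 → X ≤ Y + c * e) :
    X ≤ Y := by
  have ht : Tendsto (fun e : ℝ≥0∞ => Y + c * e) (𝓝[>] 0) (𝓝 (Y + c * 0)) :=
    (tendsto_const_nhds.add (ENNReal.Tendsto.const_mul tendsto_id (Or.inr hc))).mono_left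
      nhdsWithin_le_nhds
  rw [mul_zero, add_zero] at ht
  refine ge_of_tendsto ht ?_
  filter_upwards [self_mem_nhdsWithin] with e he
  exact h e (ne_of_gt he)

/-- The square of the length of the gradient. -/
def gradSq (φ : E d → ℝ) (x : E d) : ℝ≥0∞ := ∑ i, ‖pderiv i φ x‖ₑ ^ 2

lemma measurable_gradSq {φ : E d → ℝ} (hφ : ContDiff ℝ ∞ φ) : Measurable (gradSq φ) := by
  unfold gradSq
  refine Finset.measurable_sum _ fun i _ => ?_
  exact ((contDiff_pderiv hφ i).continuous.measurable.enorm).pow_const 2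

lemma enorm_sq_eq_ofReal (a : ℝ) : ‖a‖ₑ ^ 2 = ENNReal.ofReal (a ^ 2) := by
  rw [← ofReal_norm, ← ENNReal.ofReal_pow (norm_nonneg _), Real.norm_eq_abs, sq_abs]

lemma enorm_fderiv_sq_le (φ : E d → ℝ) (x v : E d) :
    ‖fderiv ℝ φ x v‖ₑ ^ 2 ≤ ENNReal.ofReal (‖v‖ ^ 2) * gradSq φ x := by
  simp only [gradSq, enorm_sq_eq_ofReal]
  rw [← ENNReal.ofReal_sum_of_nonneg (fun i _ => sq_nonneg _),
    ← ENNReal.ofReal_mul (sq_nonneg _)]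
  refine ENNReal.ofReal_le_ofReal ?_
  rw [fderiv_apply_eq_sum_pderiv, EuclideanSpace.norm_sq_eq]
  simpa using Finset.sum_mul_sq_le_sq_mul_sq Finset.univ (fun i => v i) (fun i => pderiv i φ x)

/-- The fundamental theorem of calculus along a segment, with the Cauchy-Schwarz inequality. -/
lemma enorm_segment_sq_le {φ : E d → ℝ} (hφ : ContDiff ℝ ∞ φ) (x v : E d) {s : ℝ} (hs : 0 ≤ s) :
    ‖φ (x + s • v) - φ x‖ₑ ^ 2 ≤
      ENNReal.ofReal s * ENNReal.ofReal (‖v‖ ^ 2) * ∫⁻ t in Ioc 0 s, gradSq φ (x + t • v) := by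
  have hc : Continuous (fun t : ℝ => fderiv ℝ φ (x + t • v) v) :=
    ((hφ.continuous_fderiv (by simp)).comp (by fun_prop)).clm_apply continuous_const
  have hd : ∀ t : ℝ, HasDerivAt (fun t : ℝ => φ (x + t • v)) (fderiv ℝ φ (x + t • v) v) t := by
    intro t
    have h1 : HasDerivAt (fun t : ℝ => x + t • v) v t := by
      simpa using ((hasDerivAt_id t).smul_const v).const_add x
    exact ((hφ.differentiable (by simp)) (x + t • v)).hasFDerivAt.comp_hasDerivAt t h1
  have e1 : φ (x + s • v) - φ x = ∫ t in Ioc 0 s, fderiv ℝ φ (x + t • v) v := by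
    rw [← intervalIntegral.integral_of_le hs,
      intervalIntegral.integral_eq_sub_of_hasDerivAt (fun t _ => hd t)
        (hc.intervalIntegrable _ _)]
    simp
  rw [e1]
  calc ‖∫ t in Ioc 0 s, fderiv ℝ φ (x + t • v) v‖ₑ ^ 2
      ≤ (∫⁻ t in Ioc 0 s, ‖fderiv ℝ φ (x + t • v) v‖ₑ) ^ 2 := by
        gcongr; exact enorm_integral_le_lintegral_enorm _
    _ ≤ (volume.restrict (Ioc 0 s)) univ * ∫⁻ t in Ioc 0 s, ‖fderiv ℝ φ (x + t • v) v‖ₑ ^ 2 :=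
        lintegral_sq_le hc.measurable.enorm.aemeasurable
    _ ≤ ENNReal.ofReal s * ∫⁻ t in Ioc 0 s, ENNReal.ofReal (‖v‖ ^ 2) * gradSq φ (x + t • v) := by
        gcongr with t
        · simp
        · exact enorm_fderiv_sq_le φ _ v
    _ = _ := by
        rw [lintegral_const_mul, mul_assoc]
        exact (measurable_gradSq hφ).comp (by fun_prop)

lemma lintegral_translate_sub_sq_le {φ : E d → ℝ} (hφ : ContDiff ℝ ∞ φ) (v : E d) :
    ∫⁻ x, ‖φ (x + v) - φ x‖ₑ ^ 2 ≤ ENNReal.ofReal (‖v‖ ^ 2) * ∫⁻ x, gradSq φ x := by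
  have hm : Measurable (Function.uncurry fun (x : E d) (t : ℝ) => gradSq φ (x + t • v)) :=
    (measurable_gradSq hφ).comp (by fun_prop)
  calc ∫⁻ x, ‖φ (x + v) - φ x‖ₑ ^ 2
      ≤ ∫⁻ x, ENNReal.ofReal (‖v‖ ^ 2) * ∫⁻ t in Ioc (0 : ℝ) 1, gradSq φ (x + t • v) := by
        refine lintegral_mono fun x => ?_
        simpa using enorm_segment_sq_le hφ x v zero_le_one
    _ = ENNReal.ofReal (‖v‖ ^ 2) * ∫⁻ t in Ioc (0 : ℝ) 1, ∫⁻ x, gradSq φ (x + t • v) := by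
        have hm' : Measurable fun x : E d => ∫⁻ t in Ioc (0 : ℝ) 1, gradSq φ (x + t • v) :=
          hm.lintegral_prod_right'
        rw [lintegral_const_mul _ hm', lintegral_lintegral_swap hm.aemeasurable]
    _ = _ := by
        simp only [lintegral_add_right_eq_self (gradSq φ)]
        simp

lemma sum_sq_le_sq_sum {ι : Type*} [Fintype ι] (a : ι → ℝ≥0∞) : ∑ i, a i ^ 2 ≤ (∑ i, a i) ^ 2 := by
  rw [sq (∑ i, a i), Finset.sum_mul]
  refine Finset.sum_le_sum fun i _ => ?_
  rw [sq]
  gcongr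
  exact Finset.single_le_sum (f := a) (fun _ _ => zero_le) (Finset.mem_univ i)

lemma lintegral_gradSq_le (φ : E d → ℝ) (hφ : ContDiff ℝ ∞ φ) (μ : Measure (E d)) :
    ∫⁻ x, gradSq φ x ∂μ ≤ (∑ i, eLpNorm (pderiv i φ) 2 μ) ^ 2 := by
  unfold gradSq
  rw [lintegral_finsetSum _ fun i _ =>
    ((contDiff_pderiv hφ i).continuous.measurable.enorm).pow_const 2]
  simp only [← eLpNorm_two_sq]
  exact sum_sq_le_sq_sum _

/-- Mollification moves a smooth function by at most the radius times the norm of its gradient. -/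
lemma IsKernel.eLpNorm_mollify_sub_le_of_smooth {k φ : E d → ℝ} {s : ℝ} (hs : 0 ≤ s)
    (hk : IsKernel k s) (hφ : IsTest univ φ) :
    eLpNorm (fun x => mollify k φ x - φ x) 2 volume ≤
      ENNReal.ofReal s * ∑ i, eLpNorm (pderiv i φ) 2 volume := by
  rw [eLpNorm_two_le_iff, mul_pow]
  have hkm : Measurable (fun y : E d => ENNReal.ofReal (k y)) :=
    hk.test.continuous.measurable.ennreal_ofReal
  have hm : Measurable (Function.uncurry fun x y : E d =>
      ENNReal.ofReal (k y) * ‖φ (x - y) - φ x‖ₑ ^ 2) := by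
    have h1 : Measurable fun p : E d × E d => φ (p.1 - p.2) - φ p.1 :=
      ((hφ.continuous.comp (by fun_prop : Continuous fun p : E d × E d => p.1 - p.2)).sub
        (hφ.continuous.comp continuous_fst)).measurable
    exact (hkm.comp measurable_snd).mul (h1.enorm.pow_const 2)
  have hpt : ∀ x, ‖mollify k φ x - φ x‖ₑ ^ 2 ≤
      ∫⁻ y, ENNReal.ofReal (k y) * ‖φ (x - y) - φ x‖ₑ ^ 2 := by
    intro x
    have h1 : mollify k φ x - φ x = mollify k (fun y => φ y - φ x) x := by
      rw [mollify_sub hk.test.toUniv hφ.continuous.locallyIntegrable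
        (locallyIntegrable_const _)]
      congr 1
      simp [mollify, integral_mul_const, hk.integral_eq]
    rw [h1]
    refine (hk.enorm_mollify_sq_le (hφ.continuous.sub
      continuous_const).aestronglyMeasurable x).trans (le_of_eq ?_)
    rw [← lintegral_sub_left_eq_self (fun y => ENNReal.ofReal (k y) * ‖φ (x - y) - φ x‖ₑ ^ 2) x]
    simp
  calc ∫⁻ x, ‖mollify k φ x - φ x‖ₑ ^ 2
      ≤ ∫⁻ x, ∫⁻ y, ENNReal.ofReal (k y) * ‖φ (x - y) - φ x‖ₑ ^ 2 := lintegral_mono hpt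
    _ = ∫⁻ y, ∫⁻ x, ENNReal.ofReal (k y) * ‖φ (x - y) - φ x‖ₑ ^ 2 :=
        lintegral_lintegral_swap hm.aemeasurable
    _ ≤ ∫⁻ y, ENNReal.ofReal (k y) * (ENNReal.ofReal s ^ 2 * ∫⁻ x, gradSq φ x) := by
        refine lintegral_mono fun y => ?_
        have h2 : Measurable fun x : E d => ‖φ (x - y) - φ x‖ₑ ^ 2 :=
          ((hφ.continuous.comp (continuous_id.sub continuous_const)).sub
            hφ.continuous).measurable.enorm.pow_const 2
        rw [lintegral_const_mul _ h2]
        by_cases hy : y ∈ Metric.ball (0 : E d) s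
        · gcongr
          have := lintegral_translate_sub_sq_le hφ.1 (-y)
          simp only [← sub_eq_add_neg, norm_neg] at this
          refine this.trans ?_
          rw [← ENNReal.ofReal_pow hs]
          gcongr
          simpa using (mem_ball_zero_iff.1 hy).le
        · simp [hk.test.eq_zero hy]
    _ ≤ ENNReal.ofReal s ^ 2 * (∑ i, eLpNorm (pderiv i φ) 2 volume) ^ 2 := by
        rw [lintegral_mul_const _ hkm, hk.lintegral_eq, one_mul]
        gcongr
        exact lintegral_gradSq_le φ hφ.1 _

/-- The mollification error of a compactly supported Sobolev function, by approximation with test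
functions. -/
lemma IsKernel.eLpNorm_mollify_sub_le {k : E d → ℝ} {s : ℝ} (hs : 0 ≤ s) (hk : IsKernel k s)
    {K : Set (E d)} (hK : IsCompact K) {F : E d → ℝ} {G : Fin d → E d → ℝ} (hF : MemLp F 2 volume)
    (hG : ∀ i, MemLp (G i) 2 volume) (hw : ∀ i, HasWeakDeriv univ i F (G i))
    (hFK : ∀ x, x ∉ K → F x = 0) :
    eLpNorm (fun x => mollify k F x - F x) 2 volume ≤
      ENNReal.ofReal s * ∑ i, eLpNorm (G i) 2 volume := by
  refine le_of_forall_add_mul (c := 2 + ENNReal.ofReal s * d)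
    (by finiteness) fun e he => ?_
  obtain ⟨φ, hφ, h1, h2⟩ := exists_test_approx isOpen_univ hK (subset_univ _) hF hG hw hFK he
  have hφL := hφ.memLp 2 volume
  have hFl := MemLp.locallyIntegrable_two hF
  have hφl := MemLp.locallyIntegrable_two hφL
  have e1 : (fun x => mollify k F x - F x) = ((fun x => mollify k φ x - φ x)
      - mollify k (fun y => φ y - F y)) + fun x => φ x - F x := by
    ext x
    simp only [Pi.add_apply, Pi.sub_apply, mollify_sub hk.test.toUniv hφl hFl]
    ring
  have hm1 := hk.memLp_mollify (hφL.sub hF)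
  have hm2 := (hk.memLp_mollify hφL).sub hφL
  rw [e1]
  have h3 : ∀ i, eLpNorm (pderiv i φ) 2 volume ≤ eLpNorm (G i) 2 volume + e := by
    intro i
    have e2 : pderiv i φ = G i + fun x => pderiv i φ x - G i x := by ext x; simp
    rw [e2]
    refine (eLpNorm_add_le (hG i).1 (((hφ.pderiv i).memLp 2 _).sub (hG i)).1 (by norm_num)).trans ?_
    gcongr
    exact h2 i
  calc _ ≤ eLpNorm ((fun x => mollify k φ x - φ x) - mollify k (fun y => φ y - F y)) 2 volume
        + eLpNorm (fun x => φ x - F x) 2 volume :=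
        eLpNorm_add_le (hm2.sub hm1).1 (hφL.sub hF).1 (by norm_num)
    _ ≤ (eLpNorm (fun x => mollify k φ x - φ x) 2 volume
        + eLpNorm (mollify k (fun y => φ y - F y)) 2 volume) + e := by
        gcongr
        exact eLpNorm_sub_le hm2.1 hm1.1 (by norm_num)
    _ ≤ (ENNReal.ofReal s * ∑ i, (eLpNorm (G i) 2 volume + e) + e) + e := by
        gcongr
        · refine (hk.eLpNorm_mollify_sub_le_of_smooth hs hφ).trans ?_
          gcongr with i
          exact h3 i
        · exact (hk.eLpNorm_mollify_le (hφL.sub hF).1).trans h1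
    _ = _ := by
        rw [Finset.sum_add_distrib]
        simp only [Finset.sum_const, Finset.card_univ, Fintype.card_fin, nsmul_eq_mul]
        ring

/-- The Poincaré inequality for test functions on a bounded set. -/
lemma IsTest.eLpNorm_le_of_bounded (hd : 1 ≤ d) {Ω : Set (E d)} {R : ℝ} (hR : 0 ≤ R)
    (hΩ : Ω ⊆ Metric.ball 0 R) {φ : E d → ℝ} (hφ : IsTest Ω φ) :
    eLpNorm φ 2 volume ≤ ENNReal.ofReal (2 * R) * ∑ i, eLpNorm (_root_.pderiv i φ) 2 volume := by
  rw [eLpNorm_two_le_iff, mul_pow]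
  set v : E d := (2 * R) • basisVec ⟨0, hd⟩ with hv
  have hvn : ‖v‖ = 2 * R := by
    rw [hv, norm_smul, Real.norm_of_nonneg (by linarith)]
    simp [basisVec]
  -- a translation by the diameter moves the support off itself
  have hpt : ∀ x, ‖φ x‖ₑ ^ 2 ≤ ‖φ (x + v) - φ x‖ₑ ^ 2 := by
    intro x
    by_cases hx : x ∈ Ω
    · have : x + v ∉ Ω := by
        intro h
        have h1 := mem_ball_zero_iff.1 (hΩ h)
        have h2 := mem_ball_zero_iff.1 (hΩ hx)
        have h3 : ‖v‖ ≤ ‖x + v‖ + ‖x‖ := by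
          simpa using norm_sub_le (x + v) x
        linarith
      rw [hφ.eq_zero this]; simp
    · simp [hφ.eq_zero hx]
  refine (lintegral_mono hpt).trans ((lintegral_translate_sub_sq_le hφ.1 v).trans ?_)
  rw [hvn, ENNReal.ofReal_pow (by linarith)]
  gcongr
  exact lintegral_gradSq_le φ hφ.1 _

/-! ### The boundary layer of a Lipschitz domain -/

/-- Fubini for integrals along segments in a fixed direction: if the segments start in `V` and
stay in `W`, and a line in the direction `e` meets `V` in length at most `τ`, then the double
integral is at most `τ` times the integral over `W`. -/
lemma lintegral_segments_le {H : E d → ℝ≥0∞} (hH : Measurable H) {V W : Set (E d)}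
    (hV : MeasurableSet V) (hW : MeasurableSet W) (e : E d) {s₀ : ℝ} {τ : ℝ≥0∞}
    (hVW : ∀ x ∈ V, ∀ σ ∈ Ioc (0 : ℝ) s₀, x + σ • e ∈ W)
    (hτ : ∀ y : E d, volume {σ : ℝ | y - σ • e ∈ V} ≤ τ) :
    ∫⁻ x in V, ∫⁻ σ in Ioc (0 : ℝ) s₀, H (x + σ • e) ≤ τ * ∫⁻ y in W, H y := by
  have hm1 : Measurable (Function.uncurry fun (x : E d) (σ : ℝ) => H (x + σ • e)) :=
    hH.comp (by fun_prop)
  have hsub : Measurable fun p : E d × ℝ => p.1 - p.2 • e := by fun_prop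
  have hm2 : Measurable (Function.uncurry fun (σ : ℝ) (y : E d) =>
      V.indicator (fun _ => (1 : ℝ≥0∞)) (y - σ • e) * W.indicator H y) :=
    ((measurable_const.indicator hV).comp (hsub.comp measurable_swap)).mul
      ((hH.indicator hW).comp measurable_snd)
  calc ∫⁻ x in V, ∫⁻ σ in Ioc (0 : ℝ) s₀, H (x + σ • e)
      = ∫⁻ σ in Ioc (0 : ℝ) s₀, ∫⁻ x in V, H (x + σ • e) :=
        lintegral_lintegral_swap hm1.aemeasurable
    _ ≤ ∫⁻ σ in Ioc (0 : ℝ) s₀, ∫⁻ y,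
          V.indicator (fun _ => (1 : ℝ≥0∞)) (y - σ • e) * W.indicator H y := by
        refine setLIntegral_mono' measurableSet_Ioc fun σ hσ => ?_
        rw [← lintegral_add_right_eq_self
          (fun y => V.indicator (fun _ => (1 : ℝ≥0∞)) (y - σ • e) * W.indicator H y) (σ • e),
          ← lintegral_indicator hV]
        refine lintegral_mono fun x => ?_
        by_cases hx : x ∈ V
        · simp [hx, hVW x hx σ hσ]
        · simp [hx]
    _ ≤ ∫⁻ σ : ℝ, ∫⁻ y,
          V.indicator (fun _ => (1 : ℝ≥0∞)) (y - σ • e) * W.indicator H y :=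
        setLIntegral_le_lintegral _ _
    _ = ∫⁻ y, ∫⁻ σ : ℝ, V.indicator (fun _ => (1 : ℝ≥0∞)) (y - σ • e) * W.indicator H y :=
        lintegral_lintegral_swap hm2.aemeasurable
    _ ≤ ∫⁻ y, τ * W.indicator H y := by
        refine lintegral_mono fun y => ?_
        have hmy : Measurable fun σ : ℝ => y - σ • e := by fun_prop
        have hmy' : Measurable fun σ : ℝ => V.indicator (fun _ => (1 : ℝ≥0∞)) (y - σ • e) :=
          (measurable_const.indicator hV).comp hmy
        rw [lintegral_mul_const _ hmy']
        gcongr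
        refine le_trans (le_of_eq ?_) (hτ y)
        have : (fun σ : ℝ => V.indicator (fun _ => (1 : ℝ≥0∞)) (y - σ • e))
            = {σ : ℝ | y - σ • e ∈ V}.indicator 1 := by
          ext σ; simp [indicator]
        rw [this]; exact lintegral_indicator_one (hmy hV)
    _ = τ * ∫⁻ y in W, H y := by
        rw [lintegral_const_mul _ (hH.indicator hW), lintegral_indicator hW]

lemma two_mul_ofReal (a : ℝ) : 2 * ENNReal.ofReal a = ENNReal.ofReal (2 * a) := by
  rw [ENNReal.ofReal_mul zero_le_two, ENNReal.ofReal_ofNat]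

/-- The square integral of a smooth function over a set that is thin in the direction `e`:
average the fundamental theorem of calculus over all segments of length at most `s₀`. -/
lemma lintegral_thin_le {φ : E d → ℝ} (hφ : ContDiff ℝ ∞ φ) {V W : Set (E d)}
    (hV : MeasurableSet V) (hW : MeasurableSet W) {e : E d} (he : ‖e‖ = 1) {s₀ : ℝ}
    {τ : ℝ≥0∞} (hVW : ∀ x ∈ V, ∀ σ ∈ Ioc (0 : ℝ) s₀, x + σ • e ∈ W)
    (hτ : ∀ y : E d, volume {σ : ℝ | y - σ • e ∈ V} ≤ τ) :
    ENNReal.ofReal s₀ * ∫⁻ x in V, ‖φ x‖ₑ ^ 2 ≤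
      τ * (2 * (∫⁻ x in W, ‖φ x‖ₑ ^ 2) +
        2 * ENNReal.ofReal s₀ ^ 2 * ∫⁻ x in W, gradSq φ x) := by
  have hφm : Measurable fun x => ‖φ x‖ₑ ^ 2 := hφ.continuous.measurable.enorm.pow_const 2
  have hgm := measurable_gradSq hφ
  have hline : ∀ x : E d, Measurable fun σ : ℝ => x + σ • e := fun x => by fun_prop
  have hpt : ∀ x, ENNReal.ofReal s₀ * ‖φ x‖ₑ ^ 2 ≤
      2 * (∫⁻ σ in Ioc (0 : ℝ) s₀, ‖φ (x + σ • e)‖ₑ ^ 2) +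
      2 * ENNReal.ofReal s₀ ^ 2 * ∫⁻ σ in Ioc (0 : ℝ) s₀, gradSq φ (x + σ • e) := by
    intro x
    set I := ∫⁻ σ in Ioc (0 : ℝ) s₀, gradSq φ (x + σ • e) with hI
    have h1 : ∀ s ∈ Ioc (0 : ℝ) s₀, ‖φ x‖ₑ ^ 2 ≤
        2 * ‖φ (x + s • e)‖ₑ ^ 2 + 2 * (ENNReal.ofReal s₀ * I) := by
      intro s hsm
      have h2 := enorm_segment_sq_le hφ x e hsm.1.le
      rw [he] at h2
      have h3 : ‖φ (x + s • e) - φ x‖ₑ ^ 2 ≤ ENNReal.ofReal s₀ * I := by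
        refine h2.trans ?_
        simp only [one_pow, ENNReal.ofReal_one, mul_one]
        gcongr
        · exact hsm.2
        · rw [hI]; exact lintegral_mono_set (Ioc_subset_Ioc_right hsm.2)
      have h4 : ‖φ x‖ₑ ^ 2 ≤ 2 * ‖φ (x + s • e)‖ₑ ^ 2 + 2 * ‖φ (x + s • e) - φ x‖ₑ ^ 2 := by
        simp only [enorm_sq_eq_ofReal]
        rw [two_mul_ofReal, two_mul_ofReal, ← ENNReal.ofReal_add (by positivity) (by positivity)]
        refine ENNReal.ofReal_le_ofReal ?_
        nlinarith [sq_nonneg (2 * φ (x + s • e) - φ x)]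
      refine h4.trans ?_
      gcongr
    have h5 : ∫⁻ _ in Ioc (0 : ℝ) s₀, ‖φ x‖ₑ ^ 2 ≤ ∫⁻ s in Ioc (0 : ℝ) s₀,
        (2 * ‖φ (x + s • e)‖ₑ ^ 2 + 2 * (ENNReal.ofReal s₀ * I)) :=
      setLIntegral_mono' measurableSet_Ioc h1
    have hm' : Measurable fun s : ℝ => ‖φ (x + s • e)‖ₑ ^ 2 := hφm.comp (hline x)
    rw [lintegral_add_right _ measurable_const, lintegral_const_mul _ hm'] at h5
    simp only [lintegral_const, Measure.restrict_apply MeasurableSet.univ, univ_inter,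
      Real.volume_Ioc, sub_zero] at h5
    rw [mul_comm]
    refine h5.trans (le_of_eq ?_)
    ring
  have hmA : Measurable fun x : E d => ∫⁻ σ in Ioc (0 : ℝ) s₀, ‖φ (x + σ • e)‖ₑ ^ 2 := by
    have : Measurable (Function.uncurry fun (x : E d) (σ : ℝ) => ‖φ (x + σ • e)‖ₑ ^ 2) :=
      hφm.comp (by fun_prop)
    exact this.lintegral_prod_right'
  have hmB : Measurable fun x : E d => ∫⁻ σ in Ioc (0 : ℝ) s₀, gradSq φ (x + σ • e) := by
    have : Measurable (Function.uncurry fun (x : E d) (σ : ℝ) => gradSq φ (x + σ • e)) :=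
      hgm.comp (by fun_prop)
    exact this.lintegral_prod_right'
  rw [← lintegral_const_mul _ hφm]
  refine (lintegral_mono hpt).trans ?_
  rw [lintegral_add_left (hmA.const_mul _), lintegral_const_mul _ hmA, lintegral_const_mul _ hmB]
  have hA := lintegral_segments_le hφm hV hW e hVW hτ
  have hB := lintegral_segments_le hgm hV hW e hVW hτ
  calc _ ≤ 2 * (τ * ∫⁻ x in W, ‖φ x‖ₑ ^ 2) + 2 * ENNReal.ofReal s₀ ^ 2 * (τ * ∫⁻ x in W, gradSq φ x) := by
        gcongr
    _ = _ := by ring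

/-- The sum of the `L²(Ω)` norms of a function and of its weak derivatives. -/
def sumNorm (Ω : Set (E d)) (f : E d → ℝ) (v : Fin d → E d → ℝ) : ℝ≥0∞ :=
  eLpNorm f 2 (volume.restrict Ω) + ∑ i, eLpNorm (v i) 2 (volume.restrict Ω)

/-- A smooth function on a set `V` which is thin in the direction `e` and can be translated by up to
`s₀` in this direction inside `W`: its `L²(V)` norm is small by the square root of the thickness. -/
lemma eLpNorm_thin_le_of_smooth {φ : E d → ℝ} (hφ : ContDiff ℝ ∞ φ) {V W : Set (E d)}
    (hV : MeasurableSet V) (hW : MeasurableSet W) {e : E d} (he : ‖e‖ = 1) {s₀ : ℝ} (hs : 0 < s₀)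
    {τ : ℝ} (hτ0 : 0 ≤ τ) (hVW : ∀ x ∈ V, ∀ σ ∈ Ioc (0 : ℝ) s₀, x + σ • e ∈ W)
    (hτ : ∀ y : E d, volume {σ : ℝ | y - σ • e ∈ V} ≤ ENNReal.ofReal τ) :
    eLpNorm φ 2 (volume.restrict V) ≤
      ENNReal.ofReal (√(2 * s₀⁻¹ + 2 * s₀) * √τ) * sumNorm W φ (fun i => pderiv i φ) := by
  rw [eLpNorm_two_le_iff, mul_pow, ← ENNReal.ofReal_pow (by positivity), mul_pow,
    Real.sq_sqrt (by positivity), Real.sq_sqrt hτ0]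
  have h := lintegral_thin_le hφ hV hW he hVW hτ
  have hs0 : ENNReal.ofReal s₀ ≠ 0 := by simpa using hs
  rw [mul_comm, ← ENNReal.le_div_iff_mul_le (Or.inl hs0) (Or.inl ENNReal.ofReal_ne_top)] at h
  refine h.trans ?_
  rw [ENNReal.div_eq_inv_mul, ← ENNReal.ofReal_inv_of_pos hs]
  have hX : ∫⁻ x in W, ‖φ x‖ₑ ^ 2 ≤ sumNorm W φ (fun i => pderiv i φ) ^ 2 := by
    rw [← eLpNorm_two_sq]; gcongr; exact le_self_add
  have hY : ∫⁻ x in W, gradSq φ x ≤ sumNorm W φ (fun i => pderiv i φ) ^ 2 := by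
    refine (lintegral_gradSq_le φ hφ _).trans ?_
    gcongr; exact le_add_self
  calc _ ≤ ENNReal.ofReal s₀⁻¹ * (ENNReal.ofReal τ * (2 * sumNorm W φ (fun i => pderiv i φ) ^ 2
        + 2 * ENNReal.ofReal s₀ ^ 2 * sumNorm W φ (fun i => pderiv i φ) ^ 2)) := by gcongr
    _ = (ENNReal.ofReal s₀⁻¹ * ENNReal.ofReal τ * (2 * ENNReal.ofReal 1 +
          2 * ENNReal.ofReal s₀ ^ 2)) *
        sumNorm W φ (fun i => pderiv i φ) ^ 2 := by
        rw [ENNReal.ofReal_one]; ring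
    _ ≤ _ := by
        gcongr
        rw [← ENNReal.ofReal_pow hs.le, two_mul_ofReal, two_mul_ofReal,
          ← ENNReal.ofReal_add (by norm_num) (by positivity),
          ← ENNReal.ofReal_mul (by positivity), ← ENNReal.ofReal_mul (by positivity)]
        refine ENNReal.ofReal_le_ofReal (le_of_eq ?_)
        field_simp

/-- There is a test function on `Ω` equal to one near a given compact subset of `Ω`. -/
lemma exists_test_eq_one {Ω K : Set (E d)} (hΩ : IsOpen Ω) (hK : IsCompact K) (hKΩ : K ⊆ Ω) :
    ∃ θ : E d → ℝ, IsTest Ω θ ∧ ∃ U, IsOpen U ∧ K ⊆ U ∧ ∀ x ∈ U, θ x = 1 := by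
  obtain ⟨K₁, hK₁, h1, h2⟩ := exists_compact_between hK hΩ hKΩ
  obtain ⟨K₂, hK₂, h3, h4⟩ := exists_compact_between hK₁ hΩ h2
  obtain ⟨f, hf, -, hfs, hf1⟩ := exists_contMDiff_support_eq_eq_one_iff (modelWithCornersSelf ℝ (E d))
    (n := (⊤ : ℕ∞)) (isOpen_interior (s := K₂)) hK₁.isClosed h3
  have hts : tsupport f ⊆ K₂ := by
    refine closure_minimal ?_ hK₂.isClosed
    rw [hfs]; exact interior_subset
  exact ⟨f, ⟨hf.contDiff, hK₂.of_isClosed_subset (isClosed_tsupport _) hts, hts.trans h4⟩,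
    interior K₁, isOpen_interior, h1, fun x hx => (hf1 x).1 (interior_subset hx)⟩

lemma pderiv_eq_zero_of_eq_one {θ : E d → ℝ} {U : Set (E d)} (hU : IsOpen U)
    (h : ∀ x ∈ U, θ x = 1) {x : E d} (hx : x ∈ U) (i : Fin d) : pderiv i θ x = 0 := by
  have : θ =ᶠ[𝓝 x] fun _ => 1 := by
    filter_upwards [hU.mem_nhds hx] with y hy using h y hy
  rw [pderiv, this.fderiv_eq]; simp

lemma memLp_test_mul {Ω : Set (E d)} (hΩ : MeasurableSet Ω) {θ f : E d → ℝ} (hθ : IsTest Ω θ)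
    (hf : MemLp f 2 (volume.restrict Ω)) : MemLp (fun x => θ x * f x) 2 volume := by
  obtain ⟨M, hM0, hM⟩ := hθ.exists_bound
  have h1 : MemLp (fun x => θ x * f x) 2 (volume.restrict Ω) := by
    refine hf.of_le_mul (c := M) (hθ.continuous.aestronglyMeasurable.mul hf.1)
      (Eventually.of_forall fun x => ?_)
    rw [norm_mul]
    gcongr
    exact hM x
  have h2 : Ω.indicator (fun x => θ x * f x) = fun x => θ x * f x := by
    refine indicator_eq_self.2 fun x hx => ?_
    by_contra h
    exact hx (by simp [hθ.eq_zero h])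
  rw [← h2]
  exact (memLp_indicator_iff_restrict hΩ).2 h1

/-- The interior approximation of `H¹(Ω)` functions by test functions of `Ω` on a compact subset
of `Ω`. -/
lemma exists_test_approx_on {Ω W : Set (E d)} (hΩ : IsOpen Ω) (hW : IsCompact W) (hWΩ : W ⊆ Ω)
    {f : E d → ℝ} {v : Fin d → E d → ℝ} (hf : MemLp f 2 (volume.restrict Ω))
    (hv : ∀ i, MemLp (v i) 2 (volume.restrict Ω)) (hw : ∀ i, HasWeakDeriv Ω i f (v i))
    {e : ℝ≥0∞} (he : e ≠ 0) :
    ∃ φ, IsTest Ω φ ∧ eLpNorm (fun x => φ x - f x) 2 (volume.restrict W) ≤ e ∧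
      ∀ i, eLpNorm (fun x => pderiv i φ x - v i x) 2 (volume.restrict W) ≤ e := by
  obtain ⟨θ, hθ, U, hU, hWU, hU1⟩ := exists_test_eq_one hΩ hW hWΩ
  obtain ⟨φ, hφ, h1, h2⟩ := exists_test_approx hΩ hθ.2.1 hθ.2.2
    (memLp_test_mul hΩ.measurableSet hθ hf)
    (fun i => (memLp_test_mul hΩ.measurableSet (hθ.pderiv i) hf).add
      (memLp_test_mul hΩ.measurableSet hθ (hv i)))
    (fun i => (hw i).mul_test hθ)
    (fun x hx => by simp [image_eq_zero_of_notMem_tsupport hx]) he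
  refine ⟨φ, hφ, ?_, fun i => ?_⟩
  · refine le_trans (le_of_eq ?_) ((eLpNorm_restrict_le _ _ _ W).trans h1)
    refine eLpNorm_congr_ae ?_
    filter_upwards [ae_restrict_mem hW.measurableSet] with x hx
    simp [hU1 x (hWU hx)]
  · refine le_trans (le_of_eq ?_) ((eLpNorm_restrict_le _ _ _ W).trans (h2 i))
    refine eLpNorm_congr_ae ?_
    filter_upwards [ae_restrict_mem hW.measurableSet] with x hx
    simp [hU1 x (hWU hx), pderiv_eq_zero_of_eq_one hU hU1 (hWU hx)]

/-- The estimate on thin sets for functions with weak derivatives in `L²`. -/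
lemma eLpNorm_thin_le {Ω V W : Set (E d)} (hΩ : IsOpen Ω) (hV : MeasurableSet V) (hW : IsCompact W)
    (hWΩ : W ⊆ Ω) (hVW' : V ⊆ W) {e : E d} (he : ‖e‖ = 1) {s₀ : ℝ} (hs : 0 < s₀) {τ : ℝ}
    (hτ0 : 0 ≤ τ) (hVW : ∀ x ∈ V, ∀ σ ∈ Ioc (0 : ℝ) s₀, x + σ • e ∈ W)
    (hτ : ∀ y : E d, volume {σ : ℝ | y - σ • e ∈ V} ≤ ENNReal.ofReal τ)
    {f : E d → ℝ} {v : Fin d → E d → ℝ} (hf : MemLp f 2 (volume.restrict Ω))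
    (hv : ∀ i, MemLp (v i) 2 (volume.restrict Ω)) (hw : ∀ i, HasWeakDeriv Ω i f (v i)) :
    eLpNorm f 2 (volume.restrict V) ≤
      ENNReal.ofReal (√(2 * s₀⁻¹ + 2 * s₀) * √τ) * sumNorm Ω f v := by
  set c := ENNReal.ofReal (√(2 * s₀⁻¹ + 2 * s₀) * √τ) with hc
  refine le_of_forall_add_mul (c := 1 + c * (1 + d)) (by finiteness) fun δ hδ => ?_
  obtain ⟨φ, hφ, h1, h2⟩ := exists_test_approx_on hΩ hW hWΩ hf hv hw hδ
  have hfW : MemLp f 2 (volume.restrict W) := hf.mono_measure (Measure.restrict_mono hWΩ le_rfl)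
  have hvW : ∀ i, MemLp (v i) 2 (volume.restrict W) :=
    fun i => (hv i).mono_measure (Measure.restrict_mono hWΩ le_rfl)
  have hφW := hφ.memLp 2 (volume.restrict W)
  have hφi := fun i => (hφ.pderiv i).memLp 2 (volume.restrict W)
  have h3 : eLpNorm φ 2 (volume.restrict W) ≤ eLpNorm f 2 (volume.restrict Ω) + δ := by
    have e1 : φ = f + fun x => φ x - f x := by ext; simp
    rw [e1]
    refine (eLpNorm_add_le hfW.1 (hφW.sub hfW).1 (by norm_num)).trans ?_
    gcongr
    exact h1
  have h4 : ∀ i, eLpNorm (pderiv i φ) 2 (volume.restrict W)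
      ≤ eLpNorm (v i) 2 (volume.restrict Ω) + δ := by
    intro i
    have e1 : pderiv i φ = v i + fun x => pderiv i φ x - v i x := by ext; simp
    rw [e1]
    refine (eLpNorm_add_le (hvW i).1 ((hφi i).sub (hvW i)).1 (by norm_num)).trans ?_
    gcongr
    exact h2 i
  have hVWm : volume.restrict V ≤ volume.restrict W := Measure.restrict_mono hVW' le_rfl
  have e2 : f = φ - fun x => φ x - f x := by ext; simp
  calc eLpNorm f 2 (volume.restrict V)
      ≤ eLpNorm φ 2 (volume.restrict V) + eLpNorm (fun x => φ x - f x) 2 (volume.restrict V) := by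
        conv_lhs => rw [e2]
        exact eLpNorm_sub_le (hφW.mono_measure hVWm).1 ((hφW.sub hfW).mono_measure hVWm).1
          (by norm_num)
    _ ≤ c * sumNorm W φ (fun i => pderiv i φ) + δ := by
        gcongr
        · exact eLpNorm_thin_le_of_smooth hφ.1 hV hW.measurableSet he hs hτ0 hVW hτ
        · exact (eLpNorm_mono_measure _ hVWm).trans h1
    _ ≤ c * ((eLpNorm f 2 (volume.restrict Ω) + δ)
          + ∑ i, (eLpNorm (v i) 2 (volume.restrict Ω) + δ)) + δ := by
        unfold sumNorm
        gcongr with i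
        exact h4 i
    _ = _ := by
        rw [Finset.sum_add_distrib, sumNorm]
        simp only [Finset.sum_const, Finset.card_univ, Fintype.card_fin, nsmul_eq_mul]
        ring

lemma eLpNorm_iUnion_le_of_directed {μ : Measure (E d)} {f : E d → ℝ} {V : ℕ → Set (E d)}
    (hV : Directed (· ⊆ ·) V) {c : ℝ≥0∞} (h : ∀ n, eLpNorm f 2 (μ.restrict (V n)) ≤ c) :
    eLpNorm f 2 (μ.restrict (⋃ n, V n)) ≤ c := by
  rw [eLpNorm_two_le_iff, setLIntegral_iUnion_of_directed _ hV]
  exact iSup_le fun n => (eLpNorm_two_le_iff _ _ _).1 (h n)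

/-- Near a boundary point, the part of the boundary layer of width `t` is thin in the vertical
direction of the local graph. -/
lemma exists_local_layer {Ω : Set (E d)} (hΩ : IsOpen Ω) (hL : HasLipschitzBoundary Ω) {p : E d}
    (hp : p ∈ frontier Ω) : ∃ r > 0, ∃ C : ℝ, 0 ≤ C ∧ ∀ t, 0 < t → t ≤ r →
      ∀ (f : E d → ℝ) (v : Fin d → E d → ℝ), MemLp f 2 (volume.restrict Ω) →
        (∀ i, MemLp (v i) 2 (volume.restrict Ω)) → (∀ i, HasWeakDeriv Ω i f (v i)) →
        eLpNorm f 2 (volume.restrict (boundaryLayer Ω t ∩ Metric.ball p r)) ≤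
          ENNReal.ofReal (C * √t) * sumNorm Ω f v := by
  obtain ⟨e, γ, K, R, he, hγ, hγe, hR, hg⟩ := hL p hp
  set ρ : E d → ℝ := fun x => inner ℝ e x - γ x with hρ
  have hρc : Continuous ρ := by
    have := hγ.continuous
    fun_prop
  have hρe : ∀ x (σ : ℝ), ρ (x + σ • e) = ρ x + σ := by
    intro x σ
    simp only [hρ, hγe, inner_add_right, inner_smul_right, real_inner_self_eq_norm_sq, he]
    ring
  have hρΩ : ∀ x ∈ Metric.ball p R, (x ∈ Ω ↔ 0 < ρ x) := by
    intro x hx; rw [hg x hx]; simp [hρ]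
  have hρL : ∀ x q, ρ x - ρ q ≤ (1 + K) * dist x q := by
    intro x q
    have h1 : inner ℝ e x - inner ℝ e q ≤ dist x q := by
      rw [← inner_sub_right, dist_eq_norm]
      simpa [he] using real_inner_le_norm e (x - q)
    have h2 : γ q - γ x ≤ K * dist x q := by
      have := (le_abs_self _).trans (hγ.dist_le_mul q x)
      rwa [dist_comm q x] at this
    simp only [hρ]; linarith
  have hr : 0 < R / 4 := by positivity
  refine ⟨R / 4, hr, √(2 * (R / 4)⁻¹ + 2 * (R / 4)) * √(1 + K), by positivity,
    fun t ht htr f v hf hv hw => ?_⟩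
  -- the layer is exhausted by sets whose upward translates stay in compact subsets of `Ω`
  set V : ℕ → Set (E d) := fun n => Metric.ball p (R / 4) ∩
    {x | 1 / ((n : ℝ) + 1) < ρ x ∧ ρ x < (1 + K) * t} with hV
  have hVm : ∀ n, MeasurableSet (V n) := fun n =>
    Metric.isOpen_ball.measurableSet.inter
      (((isOpen_lt continuous_const hρc).inter (isOpen_lt hρc continuous_const)).measurableSet)
  have hVd : Directed (· ⊆ ·) V := by
    refine Monotone.directed_le (f := V) fun n k hnk x hx => ⟨hx.1, ?_, hx.2.2⟩
    exact lt_of_le_of_lt (one_div_le_one_div_of_le (by positivity)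
      (by have : (n : ℝ) ≤ k := by exact_mod_cast hnk
          linarith)) hx.2.1
  have hsub : boundaryLayer Ω t ∩ Metric.ball p (R / 4) ⊆ ⋃ n, V n := by
    rintro x ⟨⟨hxΩ, hxd⟩, hxb⟩
    obtain ⟨q, hq, hxq⟩ := (Metric.infDist_lt_iff ⟨p, hp⟩).1 hxd
    have hqb : q ∈ Metric.ball p R := by
      have h1 := dist_triangle q x p
      rw [dist_comm q x] at h1
      have h2 : dist x p < R / 4 := hxb
      simp only [Metric.mem_ball]; linarith
    have hq0 : ρ q ≤ 0 := by
      by_contra h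
      have : q ∈ Ω := (hρΩ q hqb).2 (not_le.1 h)
      rw [hΩ.frontier_eq] at hq
      exact hq.2 this
    have hx0 : 0 < ρ x := (hρΩ x (Metric.ball_subset_ball (by linarith) hxb)).1 hxΩ
    obtain ⟨n, hn⟩ := exists_nat_one_div_lt hx0
    refine mem_iUnion.2 ⟨n, hxb, hn, ?_⟩
    have h3 := hρL x q
    have h4 : (1 + (K : ℝ)) * dist x q < (1 + K) * t := by
      have : (0 : ℝ) < 1 + K := by positivity
      gcongr
    linarith
  refine (eLpNorm_mono_measure f (Measure.restrict_mono hsub le_rfl)).trans ?_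
  refine eLpNorm_iUnion_le_of_directed hVd fun n => ?_
  set W := Metric.closedBall p (R / 2) ∩ {x | 1 / ((n : ℝ) + 1) ≤ ρ x} with hW
  have hWc : IsCompact W :=
    (isCompact_closedBall p (R / 2)).inter_right (isClosed_le continuous_const hρc)
  have hn0 : (0 : ℝ) < 1 / ((n : ℝ) + 1) := by positivity
  rw [mul_assoc, ← Real.sqrt_mul (by positivity)]
  refine eLpNorm_thin_le hΩ (hVm n) hWc ?_ ?_ he hr (by positivity) ?_ ?_ hf hv hw
  · intro x hx
    exact (hρΩ x (Metric.closedBall_subset_ball (by linarith) hx.1)).2 (hn0.trans_le hx.2)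
  · intro x hx
    exact ⟨Metric.ball_subset_closedBall (Metric.ball_subset_ball (by linarith) hx.1), hx.2.1.le⟩
  · intro x hx σ hσ
    refine ⟨?_, ?_⟩
    · have h1 : dist (x + σ • e) x = σ := by
        simp [dist_eq_norm, norm_smul, he, abs_of_pos hσ.1]
      have h2 := dist_triangle (x + σ • e) x p
      have h3 : dist x p < R / 4 := hx.1
      have h4 := hσ.2
      simp only [Metric.mem_closedBall]; linarith
    · have h5 := hx.2.1
      have h6 := hσ.1
      simp only [mem_ofPred_eq, hρe]; linarith
  · intro y
    -- `ρ` grows with unit speed along `e`, and `0 < ρ < (1 + K) t` on `V n`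
    have : {σ : ℝ | y - σ • e ∈ V n} ⊆ Ioo (ρ y - (1 + K) * t) (ρ y) := by
      intro σ hσ
      have h1 := hσ.2
      have h2 : ρ (y - σ • e) = ρ y - σ := by
        have := hρe y (-σ)
        simpa [sub_eq_add_neg] using this
      simp only [mem_ofPred_eq, h2] at h1
      exact ⟨by linarith, by linarith⟩
    refine (measure_mono this).trans ?_
    rw [Real.volume_Ioo]
    exact ENNReal.ofReal_le_ofReal (by linarith)

/-- The boundary layer estimate `‖f‖_{L²(Ω_t)} ≤ C t^{1/2} ‖f‖_{H¹(Ω)}`. -/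
theorem exists_boundaryLayer_le (hd : 1 ≤ d) {Ω : Set (E d)} (hΩ : IsBoundedLipschitzDomain Ω) :
    ∃ C : ℝ, 0 ≤ C ∧ ∀ t, 0 < t →
      ∀ (f : E d → ℝ) (v : Fin d → E d → ℝ), MemLp f 2 (volume.restrict Ω) →
        (∀ i, MemLp (v i) 2 (volume.restrict Ω)) → (∀ i, HasWeakDeriv Ω i f (v i)) →
        eLpNorm f 2 (volume.restrict (boundaryLayer Ω t)) ≤
          ENNReal.ofReal (C * √t) * sumNorm Ω f v := by
  obtain ⟨hΩo, hΩb, hL⟩ := hΩ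
  have : Nonempty (Fin d) := ⟨⟨0, hd⟩⟩
  rcases Ω.eq_empty_or_nonempty with rfl | hne
  · refine ⟨0, le_rfl, fun t _ f v _ _ _ => ?_⟩
    have : boundaryLayer (∅ : Set (E d)) t = ∅ := by ext; simp [boundaryLayer]
    simp [this]
  have hfr : (frontier Ω).Nonempty := by
    rw [nonempty_iff_ne_empty]
    intro h
    rcases frontier_eq_empty_iff.1 h with h1 | h1
    · exact hne.ne_empty h1
    · rw [h1] at hΩb
      exact NormedSpace.unbounded_univ ℝ (E d) hΩb
  have hcpt : IsCompact (frontier Ω) :=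
    Metric.isCompact_of_isClosed_isBounded isClosed_frontier
      (hΩb.closure.subset frontier_subset_closure)
  choose! r hr C hC h using fun p (hp : p ∈ frontier Ω) => exists_local_layer hΩo hL hp
  obtain ⟨s, hcov⟩ := hcpt.elim_nhds_subcover' (fun p _ => Metric.ball p (r p / 2))
    (fun p hp => Metric.ball_mem_nhds p (by have := hr p hp; positivity))
  have hsne : s.Nonempty := by
    by_contra h0
    obtain ⟨q, hq⟩ := hfr
    have := hcov hq
    simp [Finset.not_nonempty_iff_eq_empty.1 h0] at this
  obtain ⟨t₀, ht0, htr⟩ : ∃ t₀ > 0, ∀ p ∈ s, t₀ ≤ r p / 2 := by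
    refine ⟨s.inf' hsne fun p => r p / 2, ?_, fun p hp => Finset.inf'_le _ hp⟩
    rw [gt_iff_lt, Finset.lt_inf'_iff]
    intro p _
    have := hr p p.2
    positivity
  -- the first summand serves the wide layers `t > t₀`, the second one the local estimates
  refine ⟨(√t₀)⁻¹ + ∑ p ∈ s, C p, add_nonneg (by positivity)
    (Finset.sum_nonneg fun p _ => hC p p.2), fun t ht f v hf hv hw => ?_⟩
  have hX : eLpNorm f 2 (volume.restrict Ω) ≤ sumNorm Ω f v := le_self_add
  rcases le_or_gt t t₀ with htt | htt
  · have hsub : boundaryLayer Ω t ⊆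
        ⋃ p : s, (boundaryLayer Ω t ∩ Metric.ball (p : E d) (r p)) := by
      intro x hx
      obtain ⟨q, hq, hxq⟩ := (Metric.infDist_lt_iff hfr).1 hx.2
      obtain ⟨p, hp, hqp⟩ := mem_iUnion₂.1 (hcov hq)
      refine mem_iUnion.2 ⟨⟨p, hp⟩, hx, ?_⟩
      have h1 := dist_triangle x q p
      have h2 : dist q p < r p / 2 := hqp
      have h3 := htr p hp
      simp only [Metric.mem_ball]; linarith
    have hloc : ∀ p : s, ∫⁻ x in boundaryLayer Ω t ∩ Metric.ball (p : E d) (r p), ‖f x‖ₑ ^ 2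
        ≤ (ENNReal.ofReal (C p * √t) * sumNorm Ω f v) ^ 2 := by
      intro p
      rw [← eLpNorm_two_le_iff]
      have h3 := htr p p.2
      exact h p p.1.2 t ht (by linarith) f v hf hv hw
    rw [eLpNorm_two_le_iff]
    calc ∫⁻ x in boundaryLayer Ω t, ‖f x‖ₑ ^ 2
        ≤ ∫⁻ x in ⋃ p : s, (boundaryLayer Ω t ∩ Metric.ball (p : E d) (r p)), ‖f x‖ₑ ^ 2 :=
          lintegral_mono_set hsub
      _ ≤ ∑' p : s, ∫⁻ x in boundaryLayer Ω t ∩ Metric.ball (p : E d) (r p), ‖f x‖ₑ ^ 2 :=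
          lintegral_iUnion_le _ _
      _ ≤ ∑ p : s, (ENNReal.ofReal (C p * √t) * sumNorm Ω f v) ^ 2 := by
          rw [tsum_fintype]; exact Finset.sum_le_sum fun p _ => hloc p
      _ ≤ (∑ p : s, ENNReal.ofReal (C p * √t) * sumNorm Ω f v) ^ 2 := sum_sq_le_sq_sum _
      _ ≤ _ := by
          rw [Finset.sum_coe_sort s (fun p => ENNReal.ofReal (C p * √t) * sumNorm Ω f v),
            ← Finset.sum_mul, ← ENNReal.ofReal_sum_of_nonneg
            (fun (p : frontier Ω) _ => mul_nonneg (hC p p.2) (Real.sqrt_nonneg t)),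
            ← Finset.sum_mul]
          gcongr
          simp
  · calc eLpNorm f 2 (volume.restrict (boundaryLayer Ω t))
        ≤ eLpNorm f 2 (volume.restrict Ω) :=
          eLpNorm_mono_measure _ (Measure.restrict_mono (fun x hx => hx.1) le_rfl)
      _ ≤ 1 * sumNorm Ω f v := by rw [one_mul]; exact hX
      _ ≤ _ := by
          gcongr
          rw [← ENNReal.ofReal_one]
          refine ENNReal.ofReal_le_ofReal ?_
          have h1 : √t₀ ≤ √t := Real.sqrt_le_sqrt htt.le
          have h2 : 0 < √t₀ := Real.sqrt_pos.2 ht0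
          have h3 : 1 ≤ (√t₀)⁻¹ * √t := by rw [inv_mul_eq_div, le_div_iff₀ h2]; linarith
          have h4 : 0 ≤ (∑ p ∈ s, C p) * √t :=
            mul_nonneg (Finset.sum_nonneg fun p _ => hC p p.2) (Real.sqrt_nonneg t)
          rw [add_mul]; linarith

/-! ### An interior gradient estimate -/

/-- The classical Laplacian. -/
def lap (f : E d → ℝ) (x : E d) : ℝ := ∑ j, pderiv j (pderiv j f) x

/-- A radial kernel `κ` of integral one such that `x κ(x) = -∇Ψ(x)` for a test function `Ψ`. -/
lemma exists_radial_kernel (hd : 1 ≤ d) : ∃ κ Ψ : E d → ℝ, IsTest univ κ ∧ IsTest univ Ψ ∧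
    ∫ x, κ x = 1 ∧ ∀ j x, pderiv j Ψ x = -(x j * κ x) := by
  set p : ℝ → ℝ := fun s => expNegInvGlue (1 - s) with hp
  have hps : ContDiff ℝ ∞ p := expNegInvGlue.contDiff.comp (contDiff_const.sub contDiff_id)
  have hpd : Differentiable ℝ p := hps.differentiable (by simp)
  have hqs : ContDiff ℝ ∞ (deriv p) := (contDiff_infty_iff_deriv.1 hps).2
  have hp0 : ∀ s, 1 ≤ s → p s = 0 := fun s hs => expNegInvGlue.zero_of_nonpos (by linarith)
  have hpa : Antitone p := fun a b hab => expNegInvGlue.monotone (by linarith)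
  have hq0 : ∀ s, 1 < s → deriv p s = 0 := by
    intro s hs
    have : p =ᶠ[𝓝 s] fun _ => 0 := by
      filter_upwards [lt_mem_nhds hs] with t ht using hp0 t ht.le
    rw [this.deriv_eq]; simp
  have hns : ContDiff ℝ ∞ fun x : E d => ‖x‖ ^ 2 := contDiff_norm_sq ℝ
  have hcpt : ∀ f : ℝ → ℝ, ContDiff ℝ ∞ f → (∀ s, 1 < s → f s = 0) →
      IsTest univ fun x : E d => f (‖x‖ ^ 2) := by
    intro f hf h0
    refine ⟨hf.comp hns, HasCompactSupport.intro (isCompact_closedBall (0 : E d) 1) ?_,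
      subset_univ _⟩
    intro x hx
    refine h0 _ ?_
    have : 1 < ‖x‖ := by simpa using hx
    nlinarith
  set κ₀ : E d → ℝ := fun x => -2 * deriv p (‖x‖ ^ 2) with hκ₀
  have hκT : IsTest univ κ₀ := (hcpt _ hqs hq0).const_mul (-2)
  have hΨT : IsTest univ fun x : E d => p (‖x‖ ^ 2) := hcpt p hps fun s hs => hp0 s hs.le
  have hκnn : 0 ≤ κ₀ := fun x => by
    have := hpa.deriv_nonpos (x := ‖x‖ ^ 2)
    simp only [hκ₀, Pi.zero_apply]; linarith
  have hderiv : ∀ j (x : E d), pderiv j (fun x : E d => p (‖x‖ ^ 2)) x = -(x j * κ₀ x) := by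
    intro j x
    have h1 : HasFDerivAt (fun x : E d => ‖x‖ ^ 2) (2 • innerSL ℝ x) x :=
      (hasStrictFDerivAt_norm_sq x).hasFDerivAt
    have h2 := (hpd (‖x‖ ^ 2)).hasDerivAt.comp_hasFDerivAt x h1
    have h3 : HasFDerivAt (fun x : E d => p (‖x‖ ^ 2)) (deriv p (‖x‖ ^ 2) • 2 • innerSL ℝ x) x := h2
    rw [pderiv, h3.fderiv]
    have h4 : inner ℝ x (basisVec j : E d) = x j := by
      simp [basisVec, EuclideanSpace.inner_single_right]
    simp [h4, hκ₀]
    ring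
  obtain ⟨s, hs, hsd⟩ := exists_deriv_eq_slope p (zero_lt_one) hpd.continuous.continuousOn
    hpd.differentiableOn
  have hI : 0 < ∫ x, κ₀ x := by
    refine hκT.continuous.integral_pos_of_hasCompactSupport_nonneg_nonzero hκT.2.1 hκnn
      (x := √s • basisVec ⟨0, hd⟩) ?_
    have hn : ‖(√s • basisVec ⟨0, hd⟩ : E d)‖ ^ 2 = s := by
      rw [norm_smul, mul_pow, Real.norm_eq_abs, sq_abs, Real.sq_sqrt hs.1.le]
      simp [basisVec]
    simp only [hκ₀, hn, hsd, hp0 1 le_rfl]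
    have : 0 < p 0 := expNegInvGlue.pos_of_pos (by norm_num)
    simp; exact this.ne'
  refine ⟨fun x => (∫ x, κ₀ x)⁻¹ * κ₀ x, fun x => (∫ x, κ₀ x)⁻¹ * p (‖x‖ ^ 2),
    hκT.const_mul _, hΨT.const_mul _, ?_, fun j x => ?_⟩
  · rw [integral_const_mul, inv_mul_cancel₀ hI.ne']
  · rw [pderiv_mul (differentiable_const _) hΨT.differentiable, hderiv]
    simp [pderiv]; ring

lemma abs_integral_mul_le_of_bound {f g : E d → ℝ} (hf : IsTest univ f) {B : ℝ}
    (hB : ∀ x, |g x| ≤ B) : |∫ x, f x * g x| ≤ (∫ x, |f x|) * B := by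
  rw [← Real.norm_eq_abs, ← integral_mul_const]
  refine norm_integral_le_of_norm_le ((hf.integrable.abs).mul_const _)
    (Eventually.of_forall fun x => ?_)
  rw [norm_mul, Real.norm_eq_abs, Real.norm_eq_abs]
  exact mul_le_mul_of_nonneg_left (hB x) (abs_nonneg _)

lemma hasDerivAt_comp_smul {w : E d → ℝ} (hw : ContDiff ℝ ∞ w) (y : E d) (r : ℝ) :
    HasDerivAt (fun r : ℝ => w (r • y)) (∑ j, y j * pderiv j w (r • y)) r := by
  rw [← fderiv_apply_eq_sum_pderiv]
  have h1 : HasDerivAt (fun r : ℝ => r • y) y r := by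
    simpa using (hasDerivAt_id r).smul_const y
  exact ((hw.differentiable (by simp)) (r • y)).hasFDerivAt.comp_hasDerivAt r h1

lemma hasDerivAt_integral_comp_smul {κ w : E d → ℝ} (hκ : IsTest univ κ) (hw : ContDiff ℝ ∞ w)
    (r : ℝ) : HasDerivAt (fun r : ℝ => ∫ y, κ y * w (r • y))
      (∫ y, κ y * ∑ j, y j * pderiv j w (r • y)) r := by
  have hc : Continuous fun q : ℝ × E d => ∑ j, q.2 j * pderiv j w (q.1 • q.2) := by
    refine continuous_finsetSum _ fun j _ => ?_
    have := (contDiff_pderiv hw j).continuous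
    fun_prop
  obtain ⟨M, hM⟩ := ((isCompact_closedBall r 1).prod hκ.2.1).exists_bound_of_continuousOn
    hc.continuousOn
  have hcr : ∀ r : ℝ, Continuous fun y : E d => ∑ j, y j * pderiv j w (r • y) := fun r =>
    hc.comp (by fun_prop : Continuous fun y : E d => (r, y))
  have hcw : ∀ r : ℝ, Continuous fun y : E d => w (r • y) := fun r =>
    hw.continuous.comp (by fun_prop)
  refine (hasDerivAt_integral_of_dominated_loc_of_deriv_le (F := fun r y => κ y * w (r • y))
    (F' := fun r y => κ y * ∑ j, y j * pderiv j w (r • y)) (Metric.closedBall_mem_nhds r one_pos)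
    (Eventually.of_forall fun r => (hκ.continuous.mul (hcw r)).aestronglyMeasurable) ?_
    (hκ.continuous.mul (hcr r)).aestronglyMeasurable (bound := fun y => |κ y| * M) ?_
    (hκ.integrable.abs.mul_const _) ?_).2
  · simpa [mul_comm] using
      integrable_mul_test ((hcw r).locallyIntegrable.locallyIntegrableOn univ) hκ
  · refine Eventually.of_forall fun y s hs => ?_
    simp only [norm_mul, Real.norm_eq_abs]
    by_cases hy : y ∈ tsupport κ
    · exact mul_le_mul_of_nonneg_left (hM (s, y) ⟨hs, hy⟩) (abs_nonneg _)
    · simp [image_eq_zero_of_notMem_tsupport hy]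
  · exact Eventually.of_forall fun y s _ => (hasDerivAt_comp_smul hw y s).const_mul _

lemma pderiv_comp_smul {f : E d → ℝ} (hf : Differentiable ℝ f) (c : ℝ) (i : Fin d)
    (x : E d) : pderiv i (fun x => f (c • x)) x = c * pderiv i f (c • x) := by
  simpa using pderiv_comp_affine hf c 0 i x

lemma pderiv_sum {ι : Type*} (s : Finset ι) {f : ι → E d → ℝ} (hf : ∀ k, Differentiable ℝ (f k))
    (i : Fin d) (x : E d) : pderiv i (fun x => ∑ k ∈ s, f k x) x = ∑ k ∈ s, pderiv i (f k) x := by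
  simp only [pderiv]
  rw [fderiv_fun_sum fun k _ => hf k x]; simp

lemma contDiff_lap {f : E d → ℝ} (hf : ContDiff ℝ ∞ f) : ContDiff ℝ ∞ (lap f) :=
  ContDiff.sum fun j _ => contDiff_pderiv (contDiff_pderiv hf j) j

lemma lap_pderiv {f : E d → ℝ} (hf : ContDiff ℝ ∞ f) (i : Fin d) (x : E d) :
    lap (pderiv i f) x = pderiv i (lap f) x := by
  unfold lap
  rw [pderiv_sum _ fun k =>
    (contDiff_pderiv (contDiff_pderiv hf k) k).differentiable (by simp)]
  refine Finset.sum_congr rfl fun j _ => ?_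
  rw [pderiv_comm (contDiff_pderiv hf j) i j]
  congr 1
  ext y
  exact pderiv_comm hf j i y

/-- The gradient of a smooth function at a point is controlled by the suprema of the function and
of its Laplacian. The averages `∫ κ(y) ∂_i u(r y) dy` interpolate between `∂_i u(0)` at `r = 0` and
an average of `u` at `r = 1`, and their derivative in `r` only involves the Laplacian. -/
theorem exists_gradient_bound (hd : 1 ≤ d) : ∃ C : ℝ, 0 ≤ C ∧ ∀ u : E d → ℝ, ContDiff ℝ ∞ u →
    ∀ B₀ B₁ : ℝ, (∀ x, |u x| ≤ B₀) → (∀ x, |lap u x| ≤ B₁) → ∀ i,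
      |pderiv i u 0| ≤ C * (B₀ + B₁) := by
  obtain ⟨κ, Ψ, hκ, hΨ, hκ1, hκΨ⟩ := exists_radial_kernel (d := d) hd
  set c : Fin d → ℝ := fun i => (∫ x, |pderiv i κ x|) + ∫ x, |pderiv i Ψ x| with hc
  have hc0 : ∀ i, 0 ≤ c i := fun i => by positivity
  refine ⟨∑ i, c i, Finset.sum_nonneg fun i _ => hc0 i, fun u hu B₀ B₁ hB₀ hB₁ i => ?_⟩
  have hB₀0 : 0 ≤ B₀ := (abs_nonneg _).trans (hB₀ 0)
  have hB₁0 : 0 ≤ B₁ := (abs_nonneg _).trans (hB₁ 0)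
  set w := pderiv i u with hw
  have hws : ContDiff ℝ ∞ w := contDiff_pderiv hu i
  have hcomp : ∀ {f : E d → ℝ} (r : ℝ), ContDiff ℝ ∞ f → ContDiff ℝ ∞ fun y => f (r • y) :=
    fun r hf => hf.comp (contDiff_const_smul r)
  -- since `κ(y) y = -∇Ψ(y)`, an integration by parts produces the Laplacian of `w = ∂_i u`
  have hder : ∀ r : ℝ, ∫ y, κ y * ∑ j, y j * pderiv j w (r • y)
      = - ∫ y, pderiv i Ψ y * lap u (r • y) := by
    intro r
    have e1 : ∀ y : E d, κ y * ∑ j, y j * pderiv j w (r • y)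
        = ∑ j, -(pderiv j w (r • y) * pderiv j Ψ y) := by
      intro y
      rw [Finset.mul_sum]
      refine Finset.sum_congr rfl fun j _ => ?_
      rw [hκΨ]; ring
    have hwj := fun j => contDiff_pderiv hws j
    have hint : ∀ j, Integrable fun y => -(pderiv j w (r • y) * pderiv j Ψ y) := fun j =>
      (integrable_mul_test ((hcomp r (hwj j)).continuous.locallyIntegrable.locallyIntegrableOn univ)
        (hΨ.pderiv j)).neg
    have hint2 : ∀ j, Integrable fun y => r * pderiv j (pderiv j w) (r • y) * Ψ y := fun j =>
      integrable_mul_test ((contDiff_const.mul (hcomp r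
        (contDiff_pderiv (hwj j) j))).continuous.locallyIntegrable.locallyIntegrableOn univ) hΨ
    have e2 : ∀ j, ∫ y, pderiv j w (r • y) * pderiv j Ψ y
        = - ∫ y, r * pderiv j (pderiv j w) (r • y) * Ψ y := by
      intro j
      rw [integral_mul_pderiv (hcomp r (hwj j)) hΨ]
      simp only [pderiv_comp_smul ((hwj j).differentiable (by simp))]
    simp only [e1]
    rw [integral_finsetSum _ fun j _ => hint j]
    simp only [integral_neg, e2, neg_neg]
    rw [← integral_finsetSum _ fun j _ => hint2 j]
    have e3 : ∀ y, ∑ j, r * pderiv j (pderiv j w) (r • y) * Ψ y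
        = pderiv i (fun y => lap u (r • y)) y * Ψ y := by
      intro y
      rw [pderiv_comp_smul ((contDiff_lap hu).differentiable (by simp)), ← lap_pderiv hu i, lap,
        Finset.mul_sum, Finset.sum_mul]
    simp only [e3]
    rw [integral_pderiv_mul (hcomp r (contDiff_lap hu)) hΨ]
    simp only [mul_comm]
  have hP : ∀ r : ℝ, HasDerivAt (fun r : ℝ => ∫ y, κ y * w (r • y))
      (- ∫ y, pderiv i Ψ y * lap u (r • y)) r := by
    intro r
    rw [← hder r]
    exact hasDerivAt_integral_comp_smul hκ hws r
  have hmv := norm_image_sub_le_of_norm_deriv_le_segment_01' (C := (∫ x, |pderiv i Ψ x|) * B₁)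
    (fun r _ => (hP r).hasDerivWithinAt) (fun r _ => by
      rw [norm_neg, Real.norm_eq_abs]
      exact abs_integral_mul_le_of_bound (hΨ.pderiv i) fun x => hB₁ _)
  simp only [one_smul, zero_smul, integral_mul_const, hκ1, one_mul] at hmv
  have h1 : |∫ y, κ y * w y| ≤ (∫ x, |pderiv i κ x|) * B₀ := by
    have e4 : ∫ y, κ y * w y = - ∫ y, pderiv i κ y * u y := by
      have := integral_pderiv_mul hu hκ i
      simpa [mul_comm] using this
    rw [e4, abs_neg]
    exact abs_integral_mul_le_of_bound (hκ.pderiv i) hB₀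
  have h2 : |w 0| ≤ (∫ x, |pderiv i κ x|) * B₀ + (∫ x, |pderiv i Ψ x|) * B₁ := by
    rw [Real.norm_eq_abs, abs_sub_comm] at hmv
    have := abs_sub_abs_le_abs_sub (w 0) (∫ y, κ y * w y)
    linarith
  have h3 : c i ≤ ∑ i, c i := Finset.single_le_sum (fun j _ => hc0 j) (Finset.mem_univ i)
  have h4 : 0 ≤ ∫ x, |pderiv i κ x| := by positivity
  have h5 : 0 ≤ ∫ x, |pderiv i Ψ x| := by positivity
  calc |w 0| ≤ c i * (B₀ + B₁) := by simp only [hc]; nlinarith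
    _ ≤ _ := by gcongr

/-- The gradient bound in the form used for correctors: if `Δh = f` weakly and the integrals
of all translates of `h` and `f` against `G` are bounded, then so is the integral of `h ∂_i G`. -/
theorem exists_abs_integral_mul_pderiv_le (hd : 1 ≤ d) : ∃ C : ℝ, 0 ≤ C ∧ ∀ h f : E d → ℝ,
    LocallyIntegrable h → (∀ g, IsTest univ g → ∫ x, h x * lap g x = ∫ x, f x * g x) →
    ∀ (G : E d → ℝ) (B₀ B₁ : ℝ), IsTest univ G → (∀ z, |∫ x, h (x + z) * G x| ≤ B₀) →
      (∀ z, |∫ x, f (x + z) * G x| ≤ B₁) → ∀ i,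
      |∫ x, h x * pderiv i G x| ≤ C * (B₀ + B₁) := by
  obtain ⟨C, hC, hCb⟩ := exists_gradient_bound (d := d) hd
  refine ⟨C, hC, fun h f hh heq G B₀ B₁ hG hB₀ hB₁ i => ?_⟩
  have hrefl : ∀ {g : E d → ℝ}, IsTest univ g → IsTest univ fun y => g (-y) := fun hg => by
    simpa using hg.comp_affine (c := -1) (by norm_num) 0
  have hpr : ∀ {g : E d → ℝ}, IsTest univ g → ∀ j y,
      pderiv j (fun y => g (-y)) y = -pderiv j g (-y) := fun hg j y => by
    simpa using pderiv_comp_smul hg.differentiable (-1) j y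
  have hshift : ∀ z, IsTest univ fun x => G (x - z) := fun z => by
    simpa [sub_eq_add_neg] using hG.comp_affine (c := 1) (by norm_num) (-z)
  -- the function `z ↦ ∫ h (x + z) G x dx` as a convolution
  set k : E d → ℝ := fun y => G (-y) with hk
  have hkT : IsTest univ k := hrefl hG
  set u := mollify k h with hu
  have hus : ContDiff ℝ ∞ u := contDiff_mollify hkT hh
  have hval : ∀ g : E d → ℝ, ∀ z, mollify (fun y => g (-y)) h z = ∫ x, h x * g (x - z) := by
    intro g z
    rw [mollify_swap]
    simp [mul_comm]
  have htr : ∀ (a g : E d → ℝ) z, ∫ x, a x * g (x - z) = ∫ x, a (x + z) * g x := by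
    intro a g z
    rw [← integral_add_right_eq_self (fun x => a x * g (x - z)) z]
    simp
  have e1 : ∀ j, pderiv j u = mollify (pderiv j k) h := fun j => by
    ext x; exact pderiv_mollify hkT hh j x
  have hkj : ∀ j, pderiv j k = fun y => (fun x => - pderiv j G x) (-y) := fun j => by
    ext y; exact hpr hG j y
  have hlap : ∀ z, lap u z = ∫ x, f (x + z) * G x := by
    intro z
    have h1 : lap u z = ∫ x, h x * lap (fun x => G (x - z)) x := by
      have h2 : ∀ j, pderiv j (pderiv j u) z = ∫ x, h x * pderiv j (pderiv j G) (x - z) := by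
        intro j
        rw [e1, pderiv_mollify (hkT.pderiv j) hh, ← hval]
        congr 1
        ext y
        rw [hkj, hpr (hG.pderiv j).neg j y]
        have : ∀ x, pderiv j (fun x => - pderiv j G x) x = - pderiv j (pderiv j G) x := fun x => by
          rw [pderiv, fderiv_fun_neg]; rfl
        rw [this]; simp
      have h3 : ∀ x, lap (fun x => G (x - z)) x = ∑ j, pderiv j (pderiv j G) (x - z) := by
        intro x
        have h4 : ∀ {g : E d → ℝ}, Differentiable ℝ g → ∀ j x,
            pderiv j (fun x => g (x - z)) x = pderiv j g (x - z) := fun hg j x => by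
          simpa [sub_eq_add_neg] using pderiv_comp_affine hg 1 (-z) j x
        refine Finset.sum_congr rfl fun j _ => ?_
        rw [show pderiv j (fun x => G (x - z)) = fun x => pderiv j G (x - z) from
          funext fun y => h4 hG.differentiable j y, h4 (hG.pderiv j).differentiable]
      have hint : ∀ j, Integrable fun x => h x * pderiv j (pderiv j G) (x - z) := fun j => by
        have hT : IsTest univ fun x => pderiv j (pderiv j G) (x - z) := by
          simpa [sub_eq_add_neg] using
            ((hG.pderiv j).pderiv j).comp_affine (c := 1) (by norm_num) (-z)
        exact integrable_mul_test (hh.locallyIntegrableOn univ) hT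
      simp only [h3, Finset.mul_sum]
      rw [integral_finsetSum _ fun j _ => hint j, lap]
      exact Finset.sum_congr rfl fun j _ => h2 j
    rw [h1, heq _ (hshift z), htr]
  have hfin := hCb u hus B₀ B₁ (fun z => by rw [hu, hval G, htr]; exact hB₀ z)
    (fun z => by rw [hlap]; exact hB₁ z) i
  have e2 : pderiv i u 0 = - ∫ x, h x * pderiv i G x := by
    rw [e1, hkj, hval (fun x => - pderiv i G x)]
    simp [integral_neg]
  rwa [e2, abs_neg] at hfin

/-! ### The flux corrector estimate -/

/-- The `L²(ℝ^d)` norm as a real number. -/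
def nrm (F : E d → ℝ) : ℝ := (eLpNorm F 2 volume).toReal

lemma nrm_nonneg (F : E d → ℝ) : 0 ≤ nrm F := ENNReal.toReal_nonneg

/-- All translates of `Q` are multipliers from mollified `L²` functions to `L²`, with norm at
most `S`; the estimate is stated in the bilinear form in which it is used. -/
structure IsMultiplier (k Q : E d → ℝ) (S : ℝ) : Prop where
  loc : LocallyIntegrable Q
  integrable : ∀ (z : E d) (F V : E d → ℝ), MemLp F 2 volume → MemLp V 2 volume →
    Integrable fun x => Q (x + z) * (mollify k F x * V x)
  bound : ∀ (z : E d) (F V : E d → ℝ), MemLp F 2 volume → MemLp V 2 volume →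
    |∫ x, Q (x + z) * (mollify k F x * V x)| ≤ S * (nrm F * nrm V)

lemma IsMultiplier.sum {ι : Type*} [Fintype ι] {k : E d → ℝ} {Q : ι → E d → ℝ} {S : ℝ}
    (h : ∀ i, IsMultiplier k (Q i) S) :
    IsMultiplier k (fun x => ∑ i, Q i x) (Fintype.card ι * S) := by
  refine ⟨locallyIntegrable_finsetSum _ fun i _ => (h i).loc, fun z F V hF hV => ?_,
    fun z F V hF hV => ?_⟩
  · simp only [Finset.sum_mul]
    exact integrable_finsetSum _ fun i _ => (h i).integrable z F V hF hV
  · simp only [Finset.sum_mul]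
    rw [integral_finsetSum _ fun i _ => (h i).integrable z F V hF hV]
    refine (Finset.abs_sum_le_sum_abs _ _).trans ?_
    refine (Finset.sum_le_sum fun i _ => (h i).bound z F V hF hV).trans (le_of_eq ?_)
    simp [mul_assoc]

lemma IsMultiplier.sub {k Q Q' : E d → ℝ} {S S' : ℝ} (h : IsMultiplier k Q S)
    (h' : IsMultiplier k Q' S') : IsMultiplier k (fun x => Q x - Q' x) (S + S') := by
  refine ⟨h.loc.sub h'.loc, fun z F V hF hV => ?_, fun z F V hF hV => ?_⟩
  · simp only [sub_mul]
    exact (h.integrable z F V hF hV).sub (h'.integrable z F V hF hV)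
  · simp only [sub_mul]
    rw [integral_sub (h.integrable z F V hF hV) (h'.integrable z F V hF hV)]
    have h1 := h.bound z F V hF hV
    have h2 := h'.bound z F V hF hV
    refine (abs_sub _ _).trans ?_
    rw [add_mul]
    exact add_le_add h1 h2

lemma IsMultiplier.bound_zero {k Q : E d → ℝ} {S : ℝ} (h : IsMultiplier k Q S) {F V : E d → ℝ}
    (hF : MemLp F 2 volume) (hV : MemLp V 2 volume) :
    |∫ x, Q x * (mollify k F x * V x)| ≤ S * (nrm F * nrm V) := by
  simpa using h.bound 0 F V hF hV

section flux

variable {ε : ℝ} {B P : Fin d → E d → ℝ} {dP : Fin d → Fin d → E d → ℝ} {X : E d → ℝ}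
  {c : Fin d → ℝ}

/-- The divergence `h` of the dual corrector `P` solves `Δh = h - X`, where `-ε X` is the divergence
of the flux `B`. -/
lemma integral_divergence_mul_lap (hε : 0 < ε)
    (hdP : ∀ k i, LocallyIntegrable (dP k i))
    (hX : LocallyIntegrable X)
    (hB : ∀ i G, IsTest univ G → ∫ x, B i x * G x =
      c i * (∫ x, G x) + ε ^ 2 * (∫ x, P i x * G x) + ε * ∑ k, ∫ x, dP k i x * pderiv k G x)
    (hdiv : ∀ G, IsTest univ G → ∑ i, ∫ x, B i x * pderiv i G x = -(ε * ∫ x, X x * G x))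
    (hPd : ∀ i k G, IsTest univ G → ε * ∫ x, P i x * pderiv k G x = -∫ x, dP k i x * G x)
    {G : E d → ℝ} (hG : IsTest univ G) :
    ∫ x, (∑ k, dP k k x) * lap G x = ∫ x, ((∑ k, dP k k x) - X x) * G x := by
  have hi : ∀ {Q g : E d → ℝ}, LocallyIntegrable Q → IsTest univ g →
      Integrable fun x => Q x * g x := fun hQ hg =>
    integrable_mul_test (hQ.locallyIntegrableOn univ) hg
  -- both sides are `-ε ∫ P_i ∂_i ∂_k ∂_k G`
  have e1 : ∀ i k, ∫ x, dP k i x * pderiv k (pderiv i G) x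
      = ∫ x, dP i i x * pderiv k (pderiv k G) x := by
    intro i k
    have h1 := hPd i k _ ((hG.pderiv i).pderiv k)
    have h2 := hPd i i _ ((hG.pderiv k).pderiv k)
    have h3 : pderiv k (pderiv k (pderiv i G)) = pderiv i (pderiv k (pderiv k G)) := by
      ext x
      rw [pderiv_comm (contDiff_pderiv hG.1 k) i k]
      congr 1
      ext y
      exact pderiv_comm hG.1 k i y
    rw [h3] at h1
    linarith
  have h1 := hdiv G hG
  have e2 : ∀ i, ∫ x, B i x * pderiv i G x = -(ε * ∫ x, dP i i x * G x)
      + ε * ∑ k, ∫ x, dP i i x * pderiv k (pderiv k G) x := by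
    intro i
    rw [hB i _ (hG.pderiv i), integral_pderiv_eq_zero hG]
    simp only [e1]
    have := hPd i i G hG
    rw [sq, mul_assoc, this]
    ring
  simp only [e2] at h1
  rw [Finset.sum_add_distrib, Finset.sum_neg_distrib, ← Finset.mul_sum, ← Finset.mul_sum] at h1
  have h2 : ∑ i, ∑ k, ∫ x, dP i i x * pderiv k (pderiv k G) x
      = (∑ i, ∫ x, dP i i x * G x) - ∫ x, X x * G x := by
    have : ε * (∑ i, ∑ k, ∫ x, dP i i x * pderiv k (pderiv k G) x)
        = ε * ((∑ i, ∫ x, dP i i x * G x) - ∫ x, X x * G x) := by linarith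
    exact mul_left_cancel₀ hε.ne' this
  have h3 : ∫ x, (∑ k, dP k k x) * lap G x
      = ∑ i, ∑ k, ∫ x, dP i i x * pderiv k (pderiv k G) x := by
    simp only [lap, Finset.sum_mul, Finset.mul_sum]
    rw [integral_finsetSum _ fun k _ => integrable_finsetSum _ fun i _ =>
      hi (hdP i i) ((hG.pderiv k).pderiv k), Finset.sum_comm]
    refine Finset.sum_congr rfl fun k _ => ?_
    rw [integral_finsetSum _ fun i _ => hi (hdP i i) ((hG.pderiv k).pderiv k)]
  have h4 : ∫ x, ((∑ k, dP k k x) - X x) * G x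
      = (∑ i, ∫ x, dP i i x * G x) - ∫ x, X x * G x := by
    simp only [sub_mul, Finset.sum_mul]
    rw [integral_sub (integrable_finsetSum _ fun i _ => hi (hdP i i) hG) (hi hX hG),
      integral_finsetSum _ fun i _ => hi (hdP i i) hG]
  rw [h3, h4, h2]

/-- The flux against a mollified gradient. In
`B = c + ε² P - ε ∂_k (dP_k)` the last term is antisymmetric up to the gradient of the divergence
`h` of `P`, so that no second derivative of the test function survives, and `∇h` is controlled by
`h` and `Δh = h - X`. -/
theorem exists_abs_sum_flux_le (hd : 1 ≤ d) : ∃ C : ℝ, 0 ≤ C ∧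
    ∀ (ε : ℝ) (B P : Fin d → E d → ℝ) (dP : Fin d → Fin d → E d → ℝ) (X : E d → ℝ) (c : Fin d → ℝ)
      (κ F : E d → ℝ) (DF : Fin d → E d → ℝ) (v : E d → ℝ) (s SP SD SX : ℝ),
      0 < ε → IsKernel κ s → (∀ i, IsMultiplier κ (P i) SP) → (∀ k i, IsMultiplier κ (dP k i) SD) →
      IsMultiplier κ X SX → 0 ≤ SP → 0 ≤ SD → 0 ≤ SX →
      (∀ i G, IsTest univ G → ∫ x, B i x * G x =
        c i * (∫ x, G x) + ε ^ 2 * (∫ x, P i x * G x) + ε * ∑ k, ∫ x, dP k i x * pderiv k G x) →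
      (∀ G, IsTest univ G → ∑ i, ∫ x, B i x * pderiv i G x = -(ε * ∫ x, X x * G x)) →
      (∀ i k G, IsTest univ G → ε * ∫ x, P i x * pderiv k G x = -∫ x, dP k i x * G x) →
      MemLp F 2 volume → (∀ k, MemLp (DF k) 2 volume) → (∀ k, HasWeakDeriv univ k F (DF k)) →
      IsTest univ v →
      |∑ i, ∫ x, B i x * (mollify κ F x * pderiv i v x)| ≤
        C * ((∑ i, |c i|) + ε ^ 2 * SP + ε * SD + ε * SX) * (nrm F + ∑ k, nrm (DF k)) *
          ∑ i, nrm (pderiv i v) := by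
  obtain ⟨C, hC, hCb⟩ := exists_abs_integral_mul_pderiv_le (d := d) hd
  refine ⟨1 + d + 2 * d ^ 2 + C * (2 * d ^ 2 + d), by positivity, ?_⟩
  intro ε B P dP X c κ F DF v s SP SD SX hε hκ hP hdP hX hSP hSD hSX hB hdiv hPd hF hDF hw hv
  set NF := nrm F + ∑ k, nrm (DF k) with hNF
  set Nv := ∑ i, nrm (pderiv i v) with hNv
  have hNF0 : 0 ≤ NF := add_nonneg (nrm_nonneg _) (Finset.sum_nonneg fun _ _ => nrm_nonneg _)
  have hNv0 : 0 ≤ Nv := Finset.sum_nonneg fun _ _ => nrm_nonneg _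
  have hFN : nrm F ≤ NF := le_add_of_nonneg_right (Finset.sum_nonneg fun _ _ => nrm_nonneg _)
  have hDN : ∀ k, nrm (DF k) ≤ NF := fun k =>
    (Finset.single_le_sum (f := fun k => nrm (DF k)) (fun _ _ => nrm_nonneg _)
      (Finset.mem_univ k)).trans (le_add_of_nonneg_left (nrm_nonneg _))
  have hvN : ∀ i, nrm (pderiv i v) ≤ Nv := fun i =>
    Finset.single_le_sum (f := fun i => nrm (pderiv i v)) (fun _ _ => nrm_nonneg _)
      (Finset.mem_univ i)
  set g := mollify κ F with hg
  have hgs : ContDiff ℝ ∞ g := contDiff_mollify hκ.test.toUniv (MemLp.locallyIntegrable_two hF)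
  have hgd : Differentiable ℝ g := hgs.differentiable (by simp)
  have hgp : ∀ k, pderiv k g = mollify κ (DF k) := fun k => by
    ext x; exact mollify_test hκ.test.toUniv (hw k) x
  have hv2 : ∀ i, MemLp (pderiv i v) 2 volume := fun i => (hv.pderiv i).memLp 2 _
  have hG : ∀ i, IsTest univ fun x => g x * pderiv i v x := fun i => (hv.pderiv i).mul_left hgs
  -- bounds for the two kinds of products that occur
  have hb0 : ∀ {Q : E d → ℝ} {S : ℝ}, IsMultiplier κ Q S → 0 ≤ S → ∀ z i,
      |∫ x, Q (x + z) * (g x * pderiv i v x)| ≤ S * (NF * Nv) := by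
    intro Q S hQ hS z i
    refine (hQ.bound z F _ hF (hv2 i)).trans ?_
    gcongr
    · exact nrm_nonneg _
    · exact hvN i
  have hb1 : ∀ {Q : E d → ℝ} {S : ℝ}, IsMultiplier κ Q S → 0 ≤ S → ∀ k i,
      |∫ x, Q x * (pderiv k g x * pderiv i v x)| ≤ S * (NF * Nv) := by
    intro Q S hQ hS k i
    rw [hgp]
    refine (hQ.bound_zero (hDF k) (hv2 i)).trans ?_
    gcongr
    · exact nrm_nonneg _
    · exact hDN k
    · exact hvN i
  have hbc : ∀ i, |∫ x, g x * pderiv i v x| ≤ NF * Nv := by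
    intro i
    refine (abs_integral_mul_le (hκ.memLp_mollify hF) (hv2 i)).trans ?_
    refine mul_le_mul ?_ (hvN i) ENNReal.toReal_nonneg hNF0
    exact (ENNReal.toReal_mono hF.eLpNorm_ne_top (hκ.eLpNorm_mollify_le hF.1)).trans hFN
  set h : E d → ℝ := fun x => ∑ k, dP k k x with hh
  have hhM : IsMultiplier κ h (d * SD) := by
    simpa using IsMultiplier.sum (fun k => hdP k k)
  have hlap : ∀ g, IsTest univ g → ∫ x, h x * lap g x = ∫ x, (h x - X x) * g x := fun g hg =>
    integral_divergence_mul_lap hε (fun k i => (hdP k i).loc) hX.loc hB hdiv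
      hPd hg
  have hhb : ∀ k, |∫ x, h x * pderiv k (fun x => g x * pderiv k v x) x| ≤
      C * (d * SD * (NF * Nv) + (d * SD + SX) * (NF * Nv)) := fun k =>
    hCb h (fun x => h x - X x) hhM.loc hlap _ _ _ (hG k) (fun z => hb0 hhM (by positivity) z k)
      (fun z => hb0 (hhM.sub hX) (by positivity) z k) k
  have hi : ∀ k i {g : E d → ℝ}, IsTest univ g → Integrable fun x => dP k i x * g x :=
    fun k i _ hg => integrable_mul_test ((hdP k i).loc.locallyIntegrableOn univ) hg
  have hT1 : ∀ k i, IsTest univ fun x => pderiv k g x * pderiv i v x := fun k i =>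
    (hv.pderiv i).mul_left (contDiff_pderiv hgs k)
  have hT2 : ∀ k i, IsTest univ fun x => g x * pderiv k (pderiv i v) x := fun k i =>
    ((hv.pderiv i).pderiv k).mul_left hgs
  have hsplit : ∀ k i x, pderiv k (fun x => g x * pderiv i v x) x
      = pderiv k g x * pderiv i v x + g x * pderiv k (pderiv i v) x := fun k i x =>
    pderiv_mul hgd (hv.pderiv i).differentiable k x
  -- the derivative can be interchanged between the two indices
  have hswap : ∀ k i, ∫ x, dP k i x * pderiv k (fun x => g x * pderiv i v x) x
      = (∫ x, dP k i x * (pderiv k g x * pderiv i v x))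
        + ((∫ x, dP i i x * pderiv k (fun x => g x * pderiv k v x) x)
          - ∫ x, dP k i x * (pderiv i g x * pderiv k v x)) := by
    intro k i
    have e1 := hPd i k _ ((hG k).pderiv i)
    have e2 := hPd i i _ ((hG k).pderiv k)
    have e3 : pderiv k (pderiv i fun x => g x * pderiv k v x)
        = pderiv i (pderiv k fun x => g x * pderiv k v x) := by
      ext x; exact pderiv_comm (hG k).1 k i x
    rw [e3, e2, neg_inj] at e1
    rw [e1]
    simp only [hsplit, mul_add]
    rw [integral_add (hi k i (hT1 k i)) (hi k i (hT2 k i)),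
      integral_add (hi k i (hT1 i k)) (hi k i (hT2 i k))]
    have e4 : ∀ x, pderiv k (pderiv i v) x = pderiv i (pderiv k v) x := fun x =>
      pderiv_comm hv.1 k i x
    simp only [e4]
    ring
  have hhsum : ∀ k, ∑ i, ∫ x, dP i i x * pderiv k (fun x => g x * pderiv k v x) x
      = ∫ x, h x * pderiv k (fun x => g x * pderiv k v x) x := by
    intro k
    simp only [hh, Finset.sum_mul]
    rw [integral_finsetSum _ fun i _ => hi i i ((hG k).pderiv k)]
  -- the second derivatives of `v` have dropped out, except in the term with `h`
  have hmain : ∑ i, ∫ x, B i x * (g x * pderiv i v x)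
      = (∑ i, c i * ∫ x, g x * pderiv i v x)
        + ε ^ 2 * (∑ i, ∫ x, P i x * (g x * pderiv i v x))
        + ε * ((∑ i, ∑ k, ∫ x, dP k i x * (pderiv k g x * pderiv i v x))
          + (∑ k, ∫ x, h x * pderiv k (fun x => g x * pderiv k v x) x)
          - ∑ i, ∑ k, ∫ x, dP k i x * (pderiv i g x * pderiv k v x)) := by
    simp only [hB _ _ (hG _), hswap, ← hhsum]
    rw [Finset.sum_comm (f := fun k i => ∫ x, dP i i x * pderiv k (fun x => g x * pderiv k v x) x)]
    simp only [Finset.sum_add_distrib, Finset.sum_sub_distrib, ← Finset.mul_sum]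
    ring
  rw [hmain]
  set N := NF * Nv with hN
  have hN0 : 0 ≤ N := mul_nonneg hNF0 hNv0
  have b1 : |∑ i, c i * ∫ x, g x * pderiv i v x| ≤ (∑ i, |c i|) * N := by
    refine (Finset.abs_sum_le_sum_abs _ _).trans ?_
    rw [Finset.sum_mul]
    refine Finset.sum_le_sum fun i _ => ?_
    rw [abs_mul]
    exact mul_le_mul_of_nonneg_left (hbc i) (abs_nonneg _)
  have b2 : |∑ i, ∫ x, P i x * (g x * pderiv i v x)| ≤ d * (SP * N) := by
    refine (Finset.abs_sum_le_sum_abs _ _).trans ?_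
    refine (Finset.sum_le_sum fun i _ => by simpa using hb0 (hP i) hSP 0 i).trans ?_
    simp
  have b3 : |∑ i, ∑ k, ∫ x, dP k i x * (pderiv k g x * pderiv i v x)| ≤ d * (d * (SD * N)) := by
    refine (Finset.abs_sum_le_sum_abs _ _).trans ?_
    refine (Finset.sum_le_sum fun i _ => (Finset.abs_sum_le_sum_abs _ _).trans
      (Finset.sum_le_sum fun k _ => hb1 (hdP k i) hSD k i)).trans ?_
    simp
  have b4 : |∑ i, ∑ k, ∫ x, dP k i x * (pderiv i g x * pderiv k v x)| ≤ d * (d * (SD * N)) := by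
    refine (Finset.abs_sum_le_sum_abs _ _).trans ?_
    refine (Finset.sum_le_sum fun i _ => (Finset.abs_sum_le_sum_abs _ _).trans
      (Finset.sum_le_sum fun k _ => hb1 (hdP k i) hSD i k)).trans ?_
    simp
  have b5 : |∑ k, ∫ x, h x * pderiv k (fun x => g x * pderiv k v x) x| ≤
      d * (C * (d * SD * N + (d * SD + SX) * N)) := by
    refine (Finset.abs_sum_le_sum_abs _ _).trans ?_
    refine (Finset.sum_le_sum fun k _ => hhb k).trans ?_
    simp
  have hcs : 0 ≤ ∑ i, |c i| := Finset.sum_nonneg fun _ _ => abs_nonneg _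
  set a1 := ∑ i, c i * ∫ x, g x * pderiv i v x
  set a2 := ∑ i, ∫ x, P i x * (g x * pderiv i v x)
  set a3 := ∑ i, ∑ k, ∫ x, dP k i x * (pderiv k g x * pderiv i v x)
  set a4 := ∑ i, ∑ k, ∫ x, dP k i x * (pderiv i g x * pderiv k v x)
  set a5 := ∑ k, ∫ x, h x * pderiv k (fun x => g x * pderiv k v x) x
  set cs := ∑ i, |c i|
  have t1 : |a1 + ε ^ 2 * a2 + ε * (a3 + a5 - a4)| ≤
      |a1| + ε ^ 2 * |a2| + ε * (|a3| + |a5| + |a4|) := by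
    have q1 : |ε ^ 2 * a2| = ε ^ 2 * |a2| := by rw [abs_mul, abs_of_pos (by positivity)]
    have q2 : |ε * (a3 + a5 - a4)| ≤ ε * (|a3| + |a5| + |a4|) := by
      rw [abs_mul, abs_of_pos hε]
      gcongr
      exact (abs_sub _ _).trans (add_le_add_left (abs_add_le _ _) _)
    rw [← q1]
    exact (abs_add_le _ _).trans (add_le_add (abs_add_le _ _) q2)
  have z1 : (0 : ℝ) ≤ d := by positivity
  have z2 : (0 : ℝ) ≤ 2 * d ^ 2 := by positivity
  have z3 : 0 ≤ C * (2 * d ^ 2) := by positivity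
  have z4 : 0 ≤ C * d := by positivity
  obtain ⟨K, hK⟩ : ∃ K, K = 1 + d + 2 * d ^ 2 + C * (2 * d ^ 2 + d) := ⟨_, rfl⟩
  rw [mul_add] at hK
  have hK1 : 1 ≤ K := by linarith
  have hK2 : (d : ℝ) ≤ K := by linarith
  have hK3 : 2 * d ^ 2 + C * (2 * d ^ 2) ≤ K := by linarith
  have hK4 : C * d ≤ K := by linarith
  rw [← mul_add] at hK
  rw [← hK]
  refine t1.trans ?_
  calc |a1| + ε ^ 2 * |a2| + ε * (|a3| + |a5| + |a4|)
      ≤ cs * N + ε ^ 2 * (d * (SP * N)) + ε * (d * (d * (SD * N))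
        + d * (C * (d * SD * N + (d * SD + SX) * N)) + d * (d * (SD * N))) := by gcongr
    _ = (cs + d * (ε ^ 2 * SP) + (2 * d ^ 2 + C * (2 * d ^ 2)) * (ε * SD) + C * d * (ε * SX)) * N := by
        ring
    _ ≤ (K * cs + K * (ε ^ 2 * SP) + K * (ε * SD) + K * (ε * SX)) * N := by
        gcongr
        exact le_mul_of_one_le_left hcs hK1
    _ = K * (cs + ε ^ 2 * SP + ε * SD + ε * SX) * N := by ring
    _ = _ := by rw [hN, ← mul_assoc]

end flux

/-! ### Oscillating functions -/

lemma lintegral_comp_inv_smul (f : E d → ℝ≥0∞) {ε : ℝ} (hε : 0 < ε) :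
    ∫⁻ x, f (ε⁻¹ • x) = ENNReal.ofReal (ε ^ d) * ∫⁻ x, f x := by
  have h0 : ε⁻¹ ≠ 0 := inv_ne_zero hε.ne'
  calc ∫⁻ x, f (ε⁻¹ • x) = ∫⁻ y, f y ∂Measure.map (fun x => ε⁻¹ • x) volume :=
        (lintegral_map_equiv f
          (Homeomorph.smul (isUnit_iff_ne_zero.2 h0).unit).toMeasurableEquiv).symm
    _ = _ := by
        rw [Measure.map_addHaar_smul _ h0, lintegral_smul_measure]
        simp [abs_of_pos hε]

lemma setLIntegral_comp_inv_smul (f : E d → ℝ≥0∞) {ε : ℝ} (hε : 0 < ε) (y : E d) (r : ℝ) :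
    ∫⁻ x in Metric.ball y (ε * r), f (ε⁻¹ • x) =
      ENNReal.ofReal (ε ^ d) * ∫⁻ x in Metric.ball (ε⁻¹ • y) r, f x := by
  rw [← lintegral_indicator measurableSet_ball, ← lintegral_indicator measurableSet_ball,
    ← lintegral_comp_inv_smul _ hε]
  congr 1
  ext x
  have : x ∈ Metric.ball y (ε * r) ↔ ε⁻¹ • x ∈ Metric.ball (ε⁻¹ • y) r := by
    simp only [Metric.mem_ball, dist_eq_norm, ← smul_sub, norm_smul, norm_inv, Real.norm_eq_abs,
      abs_of_pos hε, inv_mul_lt_iff₀ hε]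
  by_cases hx : x ∈ Metric.ball y (ε * r)
  · rw [indicator_of_mem hx, indicator_of_mem (this.1 hx)]
  · rw [indicator_of_notMem hx, indicator_of_notMem fun h => hx (this.2 h)]

lemma integral_comp_inv_smul_mul (f G : E d → ℝ) {ε : ℝ} (hε : 0 < ε) :
    ∫ x, f (ε⁻¹ • x) * G x = ε ^ d * ∫ y, f y * G (ε • y) := by
  have := Measure.integral_comp_inv_smul_of_nonneg (volume : Measure (E d))
    (fun y => f y * G (ε • y)) hε.le
  simpa [smul_smul, hε.ne'] using this

lemma iUnion_ball_eq_univ : (⋃ n : ℕ, Metric.ball (0 : E d) n) = univ := Metric.iUnion_ball_nat 0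

lemma MemL2Loc.aestronglyMeasurable {f : E d → ℝ} (hf : MemL2Loc f) :
    AEStronglyMeasurable f volume := by
  rw [← Measure.restrict_univ (μ := (volume : Measure (E d))), ← iUnion_ball_eq_univ]
  exact aestronglyMeasurable_iUnion_iff.2 fun n => (hf n).1

lemma MemL2Loc.memLp_restrict {f : E d → ℝ} (hf : MemL2Loc f) {K : Set (E d)}
    (hK : Bornology.IsBounded K) : MemLp f 2 (volume.restrict K) := by
  obtain ⟨R, hR⟩ := hK.subset_ball 0
  exact (hf R).mono_measure (Measure.restrict_mono hR le_rfl)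

lemma MemL2Loc.locallyIntegrable {f : E d → ℝ} (hf : MemL2Loc f) : LocallyIntegrable f := by
  intro x
  refine ⟨Metric.ball x 1, Metric.ball_mem_nhds x one_pos, ?_⟩
  have : IsFiniteMeasure (volume.restrict (Metric.ball x 1)) :=
    ⟨by simpa using measure_ball_lt_top⟩
  exact (hf.memLp_restrict Metric.isBounded_ball).integrable one_le_two

lemma aestronglyMeasurable_comp_smul {f : E d → ℝ} (hf : AEStronglyMeasurable f volume) {c : ℝ}
    (hc : c ≠ 0) : AEStronglyMeasurable (fun x => f (c • x)) volume :=
  hf.comp_quasiMeasurePreserving (Measure.quasiMeasurePreserving_smul _ hc)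

/-- Rescaling preserves local square integrability. -/
lemma MemL2Loc.comp_inv_smul {f : E d → ℝ} (hf : MemL2Loc f) {ε : ℝ} (hε : 0 < ε) :
    MemL2Loc fun x => f (ε⁻¹ • x) := by
  intro R
  refine ⟨(aestronglyMeasurable_comp_smul hf.aestronglyMeasurable
    (inv_ne_zero hε.ne')).restrict, ?_⟩
  have h := setLIntegral_comp_inv_smul (fun x => ‖f x‖ₑ ^ 2) hε 0 (ε⁻¹ * R)
  rw [mul_inv_cancel_left₀ hε.ne', smul_zero, ← eLpNorm_two_sq, ← eLpNorm_two_sq] at h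
  have h2 : eLpNorm (fun x => f (ε⁻¹ • x)) 2 (volume.restrict (Metric.ball 0 R)) ^ 2 < ⊤ := by
    rw [h]
    exact ENNReal.mul_lt_top ENNReal.ofReal_lt_top
      (ENNReal.pow_lt_top (hf _).2)
  by_contra h3
  rw [not_lt, top_le_iff] at h3
  simp [h3] at h2

lemma ae_comp_smul {p : E d → Prop} (h : ∀ᵐ x, p x) {c : ℝ} (hc : c ≠ 0) :
    ∀ᵐ x : E d, p (c • x) :=
  (Measure.quasiMeasurePreserving_smul (volume : Measure (E d)) hc).ae h

/-! ### Stepanov norms and multipliers -/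

/-- The volume of the unit ball. -/
def ballVol (d : ℕ) : ℝ := (volume (Metric.ball (0 : E d) 1)).toReal

lemma ballVol_pos (d : ℕ) : 0 < ballVol d :=
  ENNReal.toReal_pos (Metric.measure_ball_pos _ _ one_pos).ne' measure_ball_lt_top.ne

lemma l2Avg_sq {ι : Type} [Fintype ι] (f : ι → E d → ℝ) (x : E d) (R : ℝ) :
    l2Avg f x R ^ 2 = (∫⁻ y in Metric.ball x R, ∑ i, ‖f i y‖ₑ ^ 2) / volume (Metric.ball x R) := by
  rw [l2Avg, ← ENNReal.rpow_natCast, ← ENNReal.rpow_mul, setLAverage_eq]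
  norm_num

lemma lintegral_le_l2Avg {ι : Type} [Fintype ι] (f : ι → E d → ℝ) (x : E d) {R : ℝ} (hR : 0 < R)
    (i : ι) :
    ∫⁻ y in Metric.ball x R, ‖f i y‖ₑ ^ 2 ≤ volume (Metric.ball x R) * l2Avg f x R ^ 2 := by
  rw [l2Avg_sq, ENNReal.mul_div_cancel (Metric.measure_ball_pos _ _ hR).ne' measure_ball_lt_top.ne]
  refine lintegral_mono fun y => ?_
  exact Finset.single_le_sum (f := fun i => ‖f i y‖ₑ ^ 2) (fun _ _ => zero_le) (Finset.mem_univ i)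

lemma stepanovNorm_lt_top {ι : Type} [Fintype ι] {f : ι → E d → ℝ}
    (hf : ∀ i, MemL2LocUnif (f i)) : stepanovNorm f 1 < ⊤ := by
  set S := ∑ i, ⨆ x : E d, ∫⁻ y in Metric.ball x 1, ‖f i y‖ₑ ^ 2 with hS
  have hSt : S < ⊤ := by
    rw [hS, ENNReal.sum_lt_top]; exact fun i _ => (hf i).2
  set V := volume (Metric.ball (0 : E d) 1) with hV
  have hV0 : V ≠ 0 := (Metric.measure_ball_pos _ _ one_pos).ne'
  have h : ∀ x, l2Avg f x 1 ≤ (S / V) ^ (1 / 2 : ℝ) := by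
    intro x
    rw [l2Avg, setLAverage_eq, Measure.addHaar_ball_center]
    gcongr
    rw [lintegral_finsetSum' _ fun i _ =>
      ((hf i).1.aestronglyMeasurable.enorm.pow_const 2).restrict]
    exact Finset.sum_le_sum fun i _ => le_iSup (fun x => ∫⁻ y in Metric.ball x 1, ‖f i y‖ₑ ^ 2) x
  refine (iSup_le h).trans_lt ?_
  exact ENNReal.rpow_lt_top_of_nonneg (by norm_num) (ENNReal.div_lt_top hSt.ne hV0).ne

/-- Square integrals over unit balls in terms of the Stepanov norm, whose finiteness makes its real
value meaningful. -/
lemma lintegral_le_stepanovNorm {ι : Type} [Fintype ι] {f : ι → E d → ℝ}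
    (hf : ∀ i, MemL2LocUnif (f i)) (i : ι) (x : E d) :
    ∫⁻ y in Metric.ball x 1, ‖f i y‖ₑ ^ 2 ≤
      ENNReal.ofReal (√(ballVol d) * (stepanovNorm f 1).toReal) ^ 2 := by
  refine (lintegral_le_l2Avg f x one_pos i).trans ?_
  rw [Measure.addHaar_ball_center, ← ENNReal.ofReal_pow (by positivity), mul_pow,
    Real.sq_sqrt (ballVol_pos d).le, ENNReal.ofReal_mul (ballVol_pos d).le, ballVol,
    ENNReal.ofReal_toReal measure_ball_lt_top.ne, ENNReal.ofReal_pow ENNReal.toReal_nonneg,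
    ENNReal.ofReal_toReal (stepanovNorm_lt_top hf).ne]
  gcongr
  exact le_iSup (fun x => l2Avg f x 1) x

/-- The product of an oscillating function and a mollified one is square integrable: the kernel
has the scale of the oscillation. -/
lemma memLp_rescale_mul_mollify {ζ : E d → ℝ} (hζ : IsMollifier ζ) {M : ℝ} (hM0 : 0 ≤ M)
    (hM : ∀ x, ζ x ≤ M) {ε : ℝ} (hε : 0 < ε) {Q : E d → ℝ} (hQ : MemL2Loc Q) {S : ℝ} (hS : 0 ≤ S)
    (hQS : ∀ x, ∫⁻ y in Metric.ball x 1, ‖Q y‖ₑ ^ 2 ≤ ENNReal.ofReal S ^ 2) (z : E d)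
    {F : E d → ℝ} (hF : MemLp F 2 volume) :
    MemLp (fun x => Q (ε⁻¹ • (x + z)) * mollify (dilate ζ ε) F x) 2 volume ∧
      nrm (fun x => Q (ε⁻¹ • (x + z)) * mollify (dilate ζ ε) F x) ≤ √M * S * nrm F := by
  have hk := hζ.isKernel_dilate hε
  have hQm : AEStronglyMeasurable (fun x => Q (ε⁻¹ • (x + z))) volume :=
    (aestronglyMeasurable_comp_smul hQ.aestronglyMeasurable
      (inv_ne_zero hε.ne')).comp_measurePreserving (measurePreserving_add_right volume z)
  have hW : AEMeasurable (fun x => ‖Q (ε⁻¹ • (x + z))‖ₑ ^ 2) volume := hQm.enorm.pow_const 2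
  have hc : ∀ y, ∫⁻ x, ‖Q (ε⁻¹ • (x + z))‖ₑ ^ 2 * ENNReal.ofReal (dilate ζ ε (x - y)) ≤
      ENNReal.ofReal M * ENNReal.ofReal S ^ 2 := by
    intro y
    set H : E d → ℝ≥0∞ := fun u => ‖Q (u + ε⁻¹ • z)‖ₑ ^ 2 with hH
    have hHm : AEMeasurable H volume :=
      (hQ.aestronglyMeasurable.comp_measurePreserving
        (measurePreserving_add_right volume (ε⁻¹ • z))).enorm.pow_const 2
    calc ∫⁻ x, ‖Q (ε⁻¹ • (x + z))‖ₑ ^ 2 * ENNReal.ofReal (dilate ζ ε (x - y))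
        ≤ ∫⁻ x, ENNReal.ofReal ((ε ^ d)⁻¹ * M) *
            (Metric.ball y ε).indicator (fun x => H (ε⁻¹ • x)) x := by
          refine lintegral_mono fun x => ?_
          by_cases hx : x ∈ Metric.ball y ε
          · rw [indicator_of_mem hx, mul_comm]
            simp only [hH, smul_add]
            gcongr
            rw [dilate]
            gcongr
            exact hM _
          · have : x - y ∉ Metric.ball (0 : E d) ε := by
              simpa [dist_eq_norm] using hx
            simp [hk.test.eq_zero this]
      _ = ENNReal.ofReal ((ε ^ d)⁻¹ * M) * ∫⁻ x in Metric.ball y ε, H (ε⁻¹ • x) := by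
          rw [lintegral_const_mul' _ _ ENNReal.ofReal_ne_top, lintegral_indicator measurableSet_ball]
      _ = ENNReal.ofReal ((ε ^ d)⁻¹ * M) * (ENNReal.ofReal (ε ^ d) *
            ∫⁻ x in Metric.ball (ε⁻¹ • y) 1, H x) := by
          have := setLIntegral_comp_inv_smul H hε y 1
          rw [mul_one] at this
          rw [this]
      _ = ENNReal.ofReal M * ∫⁻ x in Metric.ball (ε⁻¹ • y) 1, H x := by
          rw [← mul_assoc, ← ENNReal.ofReal_mul (by positivity)]
          congr 2
          field_simp
      _ ≤ _ := by
          gcongr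
          refine le_trans (le_of_eq ?_) (hQS (ε⁻¹ • y + ε⁻¹ • z))
          rw [← lintegral_indicator measurableSet_ball, ← lintegral_indicator measurableSet_ball,
            ← lintegral_add_right_eq_self (fun x => (Metric.ball (ε⁻¹ • y + ε⁻¹ • z) 1).indicator
              (fun y => ‖Q y‖ₑ ^ 2) x) (ε⁻¹ • z)]
          congr 1; ext x
          simp [indicator, hH]
  have hle : eLpNorm (fun x => Q (ε⁻¹ • (x + z)) * mollify (dilate ζ ε) F x) 2 volume ≤
      ENNReal.ofReal (√M * S) * eLpNorm F 2 volume := by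
    rw [eLpNorm_two_le_iff, mul_pow, eLpNorm_two_sq, ← ENNReal.ofReal_pow (by positivity), mul_pow,
      Real.sq_sqrt hM0, ENNReal.ofReal_mul hM0, ENNReal.ofReal_pow hS]
    simp only [enorm_mul, mul_pow]
    exact hk.lintegral_mul_mollify_sq_le hF.1 hW hc
  have htop : ENNReal.ofReal (√M * S) * eLpNorm F 2 volume ≠ ⊤ :=
    ENNReal.mul_ne_top ENNReal.ofReal_ne_top hF.eLpNorm_ne_top
  refine ⟨⟨hQm.mul (hk.memLp_mollify hF).1, hle.trans_lt htop.lt_top⟩, ?_⟩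
  refine (ENNReal.toReal_mono htop hle).trans (le_of_eq ?_)
  rw [ENNReal.toReal_mul, ENNReal.toReal_ofReal (by positivity)]
  rfl

/-- An oscillating function whose square integrals over unit balls are bounded is a multiplier,
with a norm independent of the scale `ε`. -/
lemma isMultiplier_rescale {ζ : E d → ℝ} (hζ : IsMollifier ζ) {M : ℝ} (hM0 : 0 ≤ M)
    (hM : ∀ x, ζ x ≤ M) {ε : ℝ} (hε : 0 < ε) {Q : E d → ℝ} (hQ : MemL2Loc Q) {S : ℝ} (hS : 0 ≤ S)
    (hQS : ∀ x, ∫⁻ y in Metric.ball x 1, ‖Q y‖ₑ ^ 2 ≤ ENNReal.ofReal S ^ 2) :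
    IsMultiplier (dilate ζ ε) (fun x => Q (ε⁻¹ • x)) (√M * S) := by
  refine ⟨(hQ.comp_inv_smul hε).locallyIntegrable, fun z F V hF hV => ?_, fun z F V hF hV => ?_⟩
  · obtain ⟨h1, -⟩ := memLp_rescale_mul_mollify hζ hM0 hM hε hQ hS hQS z hF
    exact (h1.integrable_mul hV).congr (Eventually.of_forall fun x => mul_assoc _ _ _)
  · obtain ⟨h1, h2⟩ := memLp_rescale_mul_mollify hζ hM0 hM hε hQ hS hQS z hF
    have := abs_integral_mul_le h1 hV
    simp only [mul_assoc] at this ⊢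
    refine this.trans ?_
    have h3 := mul_le_mul_of_nonneg_right h2 (nrm_nonneg V)
    simpa [nrm, mul_assoc] using h3

/-! ### Rescaled equations -/

/-- The rescaled test function `G(ε ·)` and its derivatives. -/
lemma IsTest.comp_smul {G : E d → ℝ} (hG : IsTest univ G) {ε : ℝ} (hε : 0 < ε) :
    IsTest univ fun y => G (ε • y) := by
  simpa using hG.comp_affine hε.ne' 0

lemma HasWeakDeriv.rescale_integral {i : Fin d} {u v : E d → ℝ} (h : HasWeakDeriv univ i u v)
    {ε : ℝ} (hε : 0 < ε) {G : E d → ℝ} (hG : IsTest univ G) :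
    ε * ∫ x, u (ε⁻¹ • x) * pderiv i G x = -∫ x, v (ε⁻¹ • x) * G x := by
  have e := h.integral_eq (hG.comp_smul hε)
  simp only [pderiv_comp_smul hG.differentiable] at e
  rw [integral_comp_inv_smul_mul _ _ hε, integral_comp_inv_smul_mul _ _ hε, ← mul_neg, ← e,
    ← integral_const_mul, ← integral_const_mul, ← integral_const_mul]
  congr 1; ext x; ring

lemma HasWeakDeriv.rescale {i : Fin d} {u v : E d → ℝ} (h : HasWeakDeriv univ i u v)
    (hu : MemL2Loc u) (hv : MemL2Loc v) {ε : ℝ} (hε : 0 < ε) :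
    HasWeakDeriv univ i (fun x => ε * u (ε⁻¹ • x)) (fun x => v (ε⁻¹ • x)) := by
  refine hasWeakDeriv_of_integral_eq ?_ ?_ fun φ hφ => ?_
  · exact ((hu.comp_inv_smul hε).locallyIntegrable.smul ε).locallyIntegrableOn _
  · exact (hv.comp_inv_smul hε).locallyIntegrable.locallyIntegrableOn _
  · simp only [mul_assoc]
    rw [integral_const_mul]
    exact h.rescale_integral hε hφ

/-! ### Mean values and the Besicovitch seminorm -/

lemma integrable_rescale_mul_test {f θ : E d → ℝ} (hf : LocallyIntegrable f)
    (hθ : IsTest univ θ) {ε : ℝ} (hε : 0 < ε) : Integrable fun x => f (ε⁻¹ • x) * θ x := by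
  have h := (integrable_mul_test (hf.locallyIntegrableOn univ) (hθ.comp_smul hε)).comp_smul
    (inv_ne_zero hε.ne')
  simpa [smul_smul, hε.ne'] using h

lemma MemL2Loc.locallyIntegrable_sq {f : E d → ℝ} (hf : MemL2Loc f) :
    LocallyIntegrable fun x => f x ^ 2 := fun x =>
  ⟨Metric.ball x 1, Metric.ball_mem_nhds x one_pos,
    (hf.memLp_restrict Metric.isBounded_ball).integrable_sq⟩

lemma exists_bump (d : ℕ) : ∃ θ : E d → ℝ, IsTest univ θ ∧ (∀ x, 0 ≤ θ x) ∧
    ∀ x ∈ Metric.ball (0 : E d) 1, θ x = 1 := by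
  let f : ContDiffBump (0 : E d) := ⟨1, 2, one_pos, one_lt_two⟩
  exact ⟨f, ⟨f.contDiff, f.hasCompactSupport, subset_univ _⟩, fun x => f.nonneg,
    fun x hx => f.one_of_mem_closedBall (Metric.ball_subset_closedBall hx)⟩

lemma integral_test_pos {θ : E d → ℝ} (hθ : IsTest univ θ) (h0 : ∀ x, 0 ≤ θ x)
    (h1 : ∀ x ∈ Metric.ball (0 : E d) 1, θ x = 1) : 0 < ∫ x, θ x :=
  hθ.continuous.integral_pos_of_hasCompactSupport_nonneg_nonzero hθ.2.1 h0 (x := 0)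
    (by rw [h1 0 (Metric.mem_ball_self one_pos)]; exact one_ne_zero)

/-- The energy bound for the corrector, from testing its equation with the corrector itself. -/
lemma exists_energy_bound {μ M : ℝ} (hμ : 0 < μ) {A : Coeff d m} (hell : IsElliptic μ A)
    (hM : ∀ i j α β, ∀ᵐ y, |A i j α β y| ≤ M) {θ : E d → ℝ} (hθ : IsTest univ θ)
    (hθ0 : ∀ x, 0 ≤ θ x) : ∃ C : ℝ, 0 ≤ C ∧ ∀ ψ : Coeff d m, IsPotentialCorrector A ψ → ∀ j β,
      ∀ᶠ ε in 𝓝[>] (0 : ℝ), ∫ x, (∑ i, ∑ α, ψ i j α β (ε⁻¹ • x) ^ 2) * θ x ≤ C := by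
  set D : ℝ := d * (m * (M ^ 2 / (2 * μ))) with hD
  have hI0 : 0 ≤ ∫ x, θ x := integral_nonneg hθ0
  refine ⟨2 / μ * (1 + D * ∫ x, θ x), by positivity, fun ψ hψ j β => ?_⟩
  obtain ⟨hpot, hmean⟩ := hψ j β
  obtain ⟨hloc, hlim⟩ := hmean _ hpot
  have hlim' := hlim θ hθ
  rw [zero_mul] at hlim'
  set f : E d → ℝ := fun y => ∑ i, ∑ α,
    (A i j α β y + ∑ k, ∑ γ, A i k α γ y * ψ k j γ β y) * ψ i j α β y with hf
  -- ellipticity, with `A ψ` absorbed by Young's inequality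
  have hpt : ∀ᵐ y, μ / 2 * (∑ i, ∑ α, ψ i j α β y ^ 2) - D ≤ f y := by
    have hMall : ∀ᵐ y, ∀ i α, |A i j α β y| ≤ M :=
      ae_all_iff.2 fun i => ae_all_iff.2 fun α => hM i j α β
    filter_upwards [hell, hMall] with y hy hMy
    have h1 := (hy fun i α => ψ i j α β y).1
    have e1 : f y = (∑ i, ∑ α, A i j α β y * ψ i j α β y)
        + ∑ i, ∑ k, ∑ α, ∑ γ, A i k α γ y * ψ i j α β y * ψ k j γ β y := by
      simp only [hf]
      rw [← Finset.sum_add_distrib]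
      refine Finset.sum_congr rfl fun i _ => ?_
      rw [Finset.sum_comm, ← Finset.sum_add_distrib]
      refine Finset.sum_congr rfl fun α _ => ?_
      rw [add_mul, Finset.sum_mul]
      congr 1
      refine Finset.sum_congr rfl fun k _ => ?_
      rw [Finset.sum_mul]
      exact Finset.sum_congr rfl fun γ _ => by ring
    have h2 : ∀ i α, -(μ / 2 * ψ i j α β y ^ 2 + M ^ 2 / (2 * μ)) ≤
        A i j α β y * ψ i j α β y := by
      intro i α
      have h3 : A i j α β y ^ 2 ≤ M ^ 2 := sq_le_sq' (abs_le.1 (hMy i α)).1 (abs_le.1 (hMy i α)).2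
      have h4 : A i j α β y ^ 2 / (2 * μ) ≤ M ^ 2 / (2 * μ) := by gcongr
      have h5 : 0 ≤ (μ * ψ i j α β y + A i j α β y) ^ 2 / (2 * μ) := by positivity
      have h6 : (μ * ψ i j α β y + A i j α β y) ^ 2 / (2 * μ)
          = μ / 2 * ψ i j α β y ^ 2 + A i j α β y * ψ i j α β y + A i j α β y ^ 2 / (2 * μ) := by
        field_simp; ring
      linarith
    have h7 : -(μ / 2 * (∑ i, ∑ α, ψ i j α β y ^ 2) + D) ≤
        ∑ i, ∑ α, A i j α β y * ψ i j α β y := by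
      calc _ = ∑ i, ∑ α, -(μ / 2 * ψ i j α β y ^ 2 + M ^ 2 / (2 * μ)) := by
            simp only [Finset.sum_neg_distrib, Finset.sum_add_distrib, Finset.sum_const,
              Finset.card_univ, Fintype.card_fin, nsmul_eq_mul, ← Finset.mul_sum, hD]
        _ ≤ _ := Finset.sum_le_sum fun i _ => Finset.sum_le_sum fun α _ => h2 i α
    rw [e1]; linarith
  have hev : ∀ᶠ ε in 𝓝[>] (0 : ℝ), ∫ x, f (ε⁻¹ • x) * θ x < 1 :=
    hlim'.eventually (gt_mem_nhds one_pos)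
  filter_upwards [hev, self_mem_nhdsWithin] with ε h1 hε
  have hε' : (0 : ℝ) < ε := hε
  have hsq : LocallyIntegrable fun y => ∑ i, ∑ α, ψ i j α β y ^ 2 :=
    locallyIntegrable_finsetSum _ fun i _ => locallyIntegrable_finsetSum _ fun α _ =>
      (hpot.1 i α).locallyIntegrable_sq
  have i1 := integrable_rescale_mul_test hsq hθ hε'
  have i2 := integrable_rescale_mul_test hloc hθ hε'
  have h2 : ∫ x, (μ / 2 * ((∑ i, ∑ α, ψ i j α β (ε⁻¹ • x) ^ 2) * θ x) - D * θ x) ≤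
      ∫ x, f (ε⁻¹ • x) * θ x := by
    refine integral_mono_ae ((i1.const_mul _).sub (hθ.integrable.const_mul _)) i2 ?_
    filter_upwards [ae_comp_smul hpt (inv_ne_zero hε'.ne')] with x hx
    have := mul_le_mul_of_nonneg_right hx (hθ0 x)
    refine le_trans (le_of_eq ?_) this
    ring
  rw [integral_sub (i1.const_mul _) (hθ.integrable.const_mul _), integral_const_mul,
    integral_const_mul] at h2
  rw [div_mul_eq_mul_div, le_div_iff₀ hμ]
  linarith

/-- The homogenized coefficients are bounded in terms of the coefficients. -/
lemma exists_homogenized_bound {μ : ℝ} (hμ : 0 < μ) {A : Coeff d m} (hell : IsElliptic μ A)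
    {M : ℝ} (hM : ∀ i j α β, ∀ᵐ y, |A i j α β y| ≤ M) (hM0 : 0 ≤ M) :
    ∃ C : ℝ, 0 ≤ C ∧ ∀ (ψ : Coeff d m) (Ahat : Fin d → Fin d → Fin m → Fin m → ℝ),
      IsPotentialCorrector A ψ → IsHomogenized A ψ Ahat → ∀ i j α β, |Ahat i j α β| ≤ C := by
  obtain ⟨θ, hθ, hθ0, hθ1⟩ := exists_bump d
  have hI := integral_test_pos hθ hθ0 hθ1
  obtain ⟨C₀, hC₀, hC⟩ := exists_energy_bound hμ hell hM hθ hθ0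
  refine ⟨((M + d * (m * M)) * (∫ x, θ x) + M * C₀) / ∫ x, θ x, by positivity,
    fun ψ Ahat hψ hh i j α β => ?_⟩
  obtain ⟨hloc, hlim⟩ := hh i j α β
  have hpot := (hψ j β).1
  rw [le_div_iff₀ hI]
  have hl := (hlim θ hθ).abs
  rw [abs_mul, abs_of_pos hI] at hl
  refine le_of_tendsto hl ?_
  filter_upwards [hC ψ hψ j β, self_mem_nhdsWithin] with ε h1 hε
  have hε' : (0 : ℝ) < ε := hε
  have hsq : LocallyIntegrable fun y => ∑ i, ∑ α, ψ i j α β y ^ 2 :=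
    locallyIntegrable_finsetSum _ fun i _ => locallyIntegrable_finsetSum _ fun α _ =>
      (hpot.1 i α).locallyIntegrable_sq
  have i1 := integrable_rescale_mul_test hsq hθ hε'
  have hpt : ∀ᵐ y, |A i j α β y + ∑ k, ∑ γ, A i k α γ y * ψ k j γ β y| ≤
      (M + d * (m * M)) + M * ∑ i, ∑ α, ψ i j α β y ^ 2 := by
    have hMall : ∀ᵐ y, ∀ k γ, |A i k α γ y| ≤ M :=
      ae_all_iff.2 fun k => ae_all_iff.2 fun γ => hM i k α γ
    filter_upwards [hMall] with y hy
    have h2 : ∀ k γ, |A i k α γ y * ψ k j γ β y| ≤ M + M * ψ k j γ β y ^ 2 := by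
      intro k γ
      rw [abs_mul]
      have h3 : |ψ k j γ β y| ≤ 1 + ψ k j γ β y ^ 2 := by
        rw [← sq_abs]; nlinarith [sq_nonneg (|ψ k j γ β y| - 1), abs_nonneg (ψ k j γ β y)]
      calc _ ≤ M * (1 + ψ k j γ β y ^ 2) := mul_le_mul (hy k γ) h3 (abs_nonneg _) hM0
        _ = _ := by ring
    refine (abs_add_le _ _).trans ?_
    rw [add_assoc]
    refine add_le_add (hy j β) ?_
    refine (Finset.abs_sum_le_sum_abs _ _).trans ((Finset.sum_le_sum fun k _ =>
      (Finset.abs_sum_le_sum_abs _ _).trans (Finset.sum_le_sum fun γ _ => h2 k γ)).trans ?_)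
    simp [Finset.sum_add_distrib, Finset.mul_sum]
  calc _ ≤ ∫ x, ((M + d * (m * M)) * θ x
          + M * ((∑ i, ∑ α, ψ i j α β (ε⁻¹ • x) ^ 2) * θ x)) := by
        rw [← Real.norm_eq_abs]
        refine norm_integral_le_of_norm_le ((hθ.integrable.const_mul _).add (i1.const_mul _)) ?_
        filter_upwards [ae_comp_smul hpt (inv_ne_zero hε'.ne')] with x hx
        rw [norm_mul, Real.norm_eq_abs, Real.norm_of_nonneg (hθ0 x)]
        refine (mul_le_mul_of_nonneg_right hx (hθ0 x)).trans (le_of_eq ?_)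
        ring
    _ = (M + d * (m * M)) * (∫ x, θ x)
          + M * ∫ x, (∑ i, ∑ α, ψ i j α β (ε⁻¹ • x) ^ 2) * θ x := by
        rw [integral_add (hθ.integrable.const_mul _) (i1.const_mul _), integral_const_mul,
          integral_const_mul]
    _ ≤ _ := by gcongr

/-- The average over the ball of radius `1/ε` as an average of the rescaled functions over the unit
ball. -/
lemma l2Avg_inv_sq {ι : Type} [Fintype ι] (f : ι → E d → ℝ) {ε : ℝ} (hε : 0 < ε) :
    l2Avg f 0 ε⁻¹ ^ 2 = (∫⁻ x in Metric.ball (0 : E d) 1, ∑ i, ‖f i (ε⁻¹ • x)‖ₑ ^ 2) /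
      volume (Metric.ball (0 : E d) 1) := by
  have h1 := setLIntegral_comp_inv_smul (fun x => ∑ i, ‖f i x‖ₑ ^ 2) hε (0 : E d) ε⁻¹
  have h2 := setLIntegral_comp_inv_smul (fun _ => 1) hε (0 : E d) ε⁻¹
  rw [mul_inv_cancel₀ hε.ne', smul_zero] at h1 h2
  simp only [setLIntegral_one] at h2
  rw [l2Avg_sq, h1, h2]
  have h0 : ENNReal.ofReal (ε ^ d) ≠ 0 := by
    simpa using pow_pos hε d
  rw [ENNReal.mul_div_mul_left _ _ h0 ENNReal.ofReal_ne_top]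

/-- Finiteness of the Besicovitch seminorm from bounds on the unit ball for the functions rescaled
by small `ε`: large balls correspond to small `ε = 1/R`. -/
lemma besicovitchSeminorm_lt_top_of_bound {ι : Type} [Fintype ι] {f : ι → E d → ℝ} {c : ℝ≥0∞}
    (hc : c ≠ ⊤) (hf : ∀ i, MemL2Loc (f i))
    (h : ∀ i, ∀ᶠ ε in 𝓝[>] (0 : ℝ), ∫⁻ x in Metric.ball (0 : E d) 1, ‖f i (ε⁻¹ • x)‖ₑ ^ 2 ≤ c) :
    besicovitchSeminorm f < ⊤ := by
  set V := volume (Metric.ball (0 : E d) 1) with hV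
  have hV0 : V ≠ 0 := (Metric.measure_ball_pos _ _ one_pos).ne'
  set B := Fintype.card ι * c / V with hB
  have hBt : B ≠ ⊤ := ENNReal.div_ne_top (by finiteness) hV0
  have h1 : ∀ᶠ ε in 𝓝[>] (0 : ℝ), l2Avg f 0 ε⁻¹ ^ 2 ≤ B := by
    filter_upwards [eventually_all.2 h, self_mem_nhdsWithin] with ε h2 hε
    have hε' : (0 : ℝ) < ε := hε
    rw [l2Avg_inv_sq f hε', hB]
    gcongr
    rw [lintegral_finsetSum' _ fun i _ =>
      ((hf i).comp_inv_smul hε').aestronglyMeasurable.enorm.pow_const 2 |>.restrict]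
    refine (Finset.sum_le_sum fun i _ => h2 i).trans ?_
    simp
  have h3 := tendsto_inv_atTop_nhdsGT_zero.eventually h1
  have h4 : ∀ᶠ R : ℝ in atTop, l2Avg f 0 R ≤ B ^ (1 / 2 : ℝ) := by
    filter_upwards [h3] with R hR
    rw [inv_inv] at hR
    calc l2Avg f 0 R = (l2Avg f 0 R ^ 2) ^ (1 / 2 : ℝ) := by
          rw [← ENNReal.rpow_natCast, ← ENNReal.rpow_mul]; norm_num
      _ ≤ _ := by gcongr
  exact (limsup_le_of_le (by isBoundedDefault) h4).trans_lt
    (ENNReal.rpow_lt_top_of_nonneg (by norm_num) hBt)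

lemma exists_isMollifier (d : ℕ) : ∃ k : E d → ℝ, IsMollifier k := by
  obtain ⟨k, hk⟩ := exists_isKernel (d := d) one_pos
  exact ⟨k, hk.test, hk.nonneg, hk.integral_eq⟩

/-- A rescaled function from `L²_{loc,unif}` stays bounded in `L²` of the unit ball. -/
lemma exists_rescale_bound {Q : E d → ℝ} (hQ : MemL2LocUnif Q) : ∃ c : ℝ≥0∞, c ≠ ⊤ ∧
    ∀ᶠ ε in 𝓝[>] (0 : ℝ), ∫⁻ x in Metric.ball (0 : E d) 1, ‖Q (ε⁻¹ • x)‖ₑ ^ 2 ≤ c := by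
  obtain ⟨ζ, hζ⟩ := exists_isMollifier d
  obtain ⟨M, hM0, hM⟩ := hζ.1.exists_bound
  have hQS := lintegral_le_stepanovNorm (f := fun _ : Unit => Q) (fun _ => hQ) ()
  set S := √(ballVol d) * (stepanovNorm (fun _ : Unit => Q) 1).toReal with hS
  have hS0 : 0 ≤ S := by positivity
  obtain ⟨θ, hθ, hθ0, hθ1⟩ := exists_bump d
  set F : E d → ℝ := (Metric.ball (0 : E d) 2).indicator fun _ => 1 with hF
  have hFL : MemLp F 2 volume :=
    memLp_indicator_const 2 measurableSet_ball 1 (Or.inr measure_ball_lt_top.ne)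
  refine ⟨ENNReal.ofReal (√M * S * nrm F) ^ 2, by finiteness, ?_⟩
  have h1 : ∀ᶠ ε in 𝓝[>] (0 : ℝ), ε < 1 :=
    (eventually_lt_nhds one_pos).filter_mono nhdsWithin_le_nhds
  filter_upwards [h1, self_mem_nhdsWithin] with ε hε1 hε
  have hε' : (0 : ℝ) < ε := hε
  have hk := hζ.isKernel_dilate hε'
  obtain ⟨h2, h3⟩ := memLp_rescale_mul_mollify hζ hM0 (fun x => (le_abs_self _).trans (hM x)) hε'
    hQ.1 hS0 hQS 0 hFL
  have h4 : eLpNorm (fun x => Q (ε⁻¹ • (x + 0)) * mollify (dilate ζ ε) F x) 2 volume ≤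
      ENNReal.ofReal (√M * S * nrm F) := by
    rw [← ENNReal.ofReal_toReal h2.eLpNorm_ne_top]
    exact ENNReal.ofReal_le_ofReal h3
  rw [eLpNorm_two_le_iff] at h4
  refine le_trans ?_ h4
  rw [← lintegral_indicator measurableSet_ball]
  refine lintegral_mono fun x => ?_
  by_cases hx : x ∈ Metric.ball (0 : E d) 1
  · have e1 : mollify (dilate ζ ε) F x = 1 := by
      rw [← hk.integral_eq, mollify]
      refine integral_congr_ae (Eventually.of_forall fun y => ?_)
      show dilate ζ ε y * F (x - y) = dilate ζ ε y
      by_cases hy : y ∈ Metric.ball (0 : E d) ε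
      · have : x - y ∈ Metric.ball (0 : E d) 2 := by
          rw [mem_ball_zero_iff] at *
          linarith [norm_sub_le x y]
        rw [hF, indicator_of_mem this, mul_one]
      · rw [hk.test.eq_zero hy, zero_mul]
    simp [indicator_of_mem hx, e1]
  · simp [indicator_of_notMem hx]

/-- A mean value is controlled by the Besicovitch seminorm. -/
lemma exists_mean_bound (d : ℕ) : ∃ K : ℝ, 0 ≤ K ∧ ∀ (ι : Type) [Fintype ι] (D : ι → E d → ℝ),
    (∀ q, MemL2Loc (D q)) → besicovitchSeminorm D < ⊤ → ∀ (f : E d → ℝ) (c M : ℝ),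
      HasMeanValue f c → 0 ≤ M → (∀ᵐ y, |f y| ≤ M * ∑ q, |D q y|) →
      |c| ≤ K * (Fintype.card ι * M) * (besicovitchSeminorm D).toReal := by
  obtain ⟨θ, hθ⟩ := exists_isKernel (d := d) one_pos
  refine ⟨nrm θ * √(ballVol d), mul_nonneg (nrm_nonneg _) (Real.sqrt_nonneg _),
    fun ι _ D hD hbes f c M hf hM hfD => ?_⟩
  set b := besicovitchSeminorm D with hb
  have hθL := hθ.test.memLp 2 volume
  have hl := (hf.2 θ hθ.test.toUniv).abs
  rw [hθ.integral_eq, mul_one] at hl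
  refine le_of_forall_pos_le_add fun η hη => ?_
  obtain ⟨η', hη', hηη⟩ : ∃ η' > 0,
      nrm θ * √(ballVol d) * (Fintype.card ι * M) * η' ≤ η := by
    have h0 : 0 ≤ nrm θ * √(ballVol d) * (Fintype.card ι * M) :=
      mul_nonneg (mul_nonneg (nrm_nonneg _) (Real.sqrt_nonneg _)) (by positivity)
    refine ⟨η / (nrm θ * √(ballVol d) * (Fintype.card ι * M) + 1), by positivity, ?_⟩
    rw [mul_div_assoc', div_le_iff₀ (by positivity)]
    nlinarith
  have hlt : b < b + ENNReal.ofReal η' :=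
    ENNReal.lt_add_right hbes.ne (by simpa using hη')
  have h1 : ∀ᶠ R in atTop, l2Avg D 0 R < b + ENNReal.ofReal η' :=
    eventually_lt_of_limsup_lt hlt (by isBoundedDefault)
  have h2 := tendsto_inv_nhdsGT_zero.eventually h1
  refine le_of_tendsto hl ?_
  filter_upwards [h2, self_mem_nhdsWithin] with ε h3 hε
  have hε' : (0 : ℝ) < ε := hε
  have hL : ∀ q, MemLp (fun x => |D q (ε⁻¹ • x)|) 2 (volume.restrict (Metric.ball 0 1)) :=
    fun q => ((hD q).comp_inv_smul hε' 1).norm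
  have hθr : MemLp θ 2 (volume.restrict (Metric.ball 0 1)) := hθ.test.memLp 2 _
  have h4 : ∀ q, (eLpNorm (fun x => |D q (ε⁻¹ • x)|) 2 (volume.restrict (Metric.ball 0 1))).toReal
      ≤ √(ballVol d) * (b.toReal + η') := by
    intro q
    refine ENNReal.toReal_le_of_le_ofReal (by positivity) ?_
    rw [eLpNorm_two_le_iff, ← ENNReal.ofReal_pow (by positivity), mul_pow,
      Real.sq_sqrt (ballVol_pos d).le, ENNReal.ofReal_mul (ballVol_pos d).le, ballVol,
      ENNReal.ofReal_toReal measure_ball_lt_top.ne, ENNReal.ofReal_pow (by positivity),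
      ENNReal.ofReal_add ENNReal.toReal_nonneg hη'.le, ENNReal.ofReal_toReal hbes.ne]
    have h5 := l2Avg_inv_sq D hε'
    rw [ENNReal.eq_div_iff (Metric.measure_ball_pos _ _ one_pos).ne' measure_ball_lt_top.ne] at h5
    calc ∫⁻ x in Metric.ball (0 : E d) 1, ‖|D q (ε⁻¹ • x)|‖ₑ ^ 2
        ≤ ∫⁻ x in Metric.ball (0 : E d) 1, ∑ i, ‖D i (ε⁻¹ • x)‖ₑ ^ 2 := by
          refine lintegral_mono fun x => ?_
          have : ‖|D q (ε⁻¹ • x)|‖ₑ = ‖D q (ε⁻¹ • x)‖ₑ := by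
            rw [← Real.norm_eq_abs, enorm_norm]
          rw [this]
          exact Finset.single_le_sum (f := fun i => ‖D i (ε⁻¹ • x)‖ₑ ^ 2) (fun _ _ => zero_le)
            (Finset.mem_univ q)
      _ ≤ _ := by
          rw [← h5]
          gcongr
  have hint : ∀ q, Integrable (fun x => |D q (ε⁻¹ • x)| * θ x)
      (volume.restrict (Metric.ball 0 1)) := fun q => (hL q).integrable_mul hθr
  have h6 : ∫ x, f (ε⁻¹ • x) * θ x = ∫ x in Metric.ball 0 1, f (ε⁻¹ • x) * θ x :=
    (setIntegral_mul_test (fun x => f (ε⁻¹ • x)) hθ.test).symm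
  rw [h6]
  calc |∫ x in Metric.ball 0 1, f (ε⁻¹ • x) * θ x|
      ≤ ∫ x in Metric.ball 0 1, M * ∑ q, |D q (ε⁻¹ • x)| * θ x := by
        rw [← Real.norm_eq_abs]
        refine norm_integral_le_of_norm_le
          ((integrable_finsetSum _ fun q _ => hint q).const_mul M) ?_
        refine ae_restrict_of_ae ?_
        filter_upwards [ae_comp_smul hfD (inv_ne_zero hε'.ne')] with x hx
        rw [norm_mul, Real.norm_eq_abs, Real.norm_of_nonneg (hθ.nonneg x), ← Finset.sum_mul,
          ← mul_assoc]
        exact mul_le_mul_of_nonneg_right hx (hθ.nonneg x)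
    _ = M * ∑ q, ∫ x in Metric.ball 0 1, |D q (ε⁻¹ • x)| * θ x := by
        rw [integral_const_mul, integral_finsetSum _ fun q _ => hint q]
    _ ≤ M * ∑ q : ι, (√(ballVol d) * (b.toReal + η')) * nrm θ := by
        gcongr with q
        refine (le_abs_self _).trans ((abs_integral_mul_le (hL q) hθr).trans ?_)
        refine mul_le_mul (h4 q) ?_ ENNReal.toReal_nonneg (by positivity)
        exact ENNReal.toReal_mono hθL.eLpNorm_ne_top (eLpNorm_restrict_le _ _ _ _)
    _ = nrm θ * √(ballVol d) * (Fintype.card ι * M) * b.toReal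
          + nrm θ * √(ballVol d) * (Fintype.card ι * M) * η' := by
        simp only [Finset.sum_const, Finset.card_univ, nsmul_eq_mul]; ring
    _ ≤ _ := by gcongr

/-- The family of the components of `∇χ - ψ`. -/
def gradDefect (ψ : Coeff d m) (χ : Fin d → Fin m → Fin m → E d → ℝ) :
    Fin d × Fin d × Fin m × Fin m → E d → ℝ :=
  fun q y => weakDeriv univ q.1 (χ q.2.1 q.2.2.1 q.2.2.2) y - ψ q.1 q.2.1 q.2.2.1 q.2.2.2 y

lemma memL2Loc_gradDefect {A ψ : Coeff d m} {χ : Fin d → Fin m → Fin m → E d → ℝ}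
    (hψ : IsPotentialCorrector A ψ) (hχ : ∀ j α β, MemH1LocUnif (χ j α β))
    (q : Fin d × Fin d × Fin m × Fin m) : MemL2Loc (gradDefect ψ χ q) := fun R =>
  (((hχ q.2.1 q.2.2.1 q.2.2.2).2 q.1).2.1 R).sub ((hψ q.2.1 q.2.2.2).1.1 q.1 q.2.2.1 R)

lemma lintegral_corrector_le {ψ : Coeff d m} {θ : E d → ℝ} (hθ : IsTest univ θ)
    (hθ0 : ∀ x, 0 ≤ θ x) (hθ1 : ∀ x ∈ Metric.ball (0 : E d) 1, θ x = 1) {j : Fin d} {β : Fin m}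
    (hψ : ∀ i α, MemL2Loc (ψ i j α β)) {ε C : ℝ} (hε : 0 < ε)
    (h : ∫ x, (∑ i, ∑ α, ψ i j α β (ε⁻¹ • x) ^ 2) * θ x ≤ C) (i : Fin d) (α : Fin m) :
    ∫⁻ x in Metric.ball (0 : E d) 1, ‖ψ i j α β (ε⁻¹ • x)‖ₑ ^ 2 ≤ ENNReal.ofReal C := by
  have hsq : LocallyIntegrable fun y => ∑ i, ∑ α, ψ i j α β y ^ 2 :=
    locallyIntegrable_finsetSum _ fun i _ => locallyIntegrable_finsetSum _ fun α _ =>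
      (hψ i α).locallyIntegrable_sq
  have h0 : ∀ x, 0 ≤ (∑ i, ∑ α, ψ i j α β (ε⁻¹ • x) ^ 2) * θ x := fun x =>
    mul_nonneg (Finset.sum_nonneg fun _ _ => Finset.sum_nonneg fun _ _ => sq_nonneg _) (hθ0 x)
  refine le_trans ?_ (ENNReal.ofReal_le_ofReal h)
  rw [ofReal_integral_eq_lintegral_ofReal (integrable_rescale_mul_test hsq hθ hε)
    (Eventually.of_forall h0), ← lintegral_indicator measurableSet_ball]
  refine lintegral_mono fun x => ?_
  by_cases hx : x ∈ Metric.ball (0 : E d) 1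
  · rw [indicator_of_mem hx, hθ1 x hx, mul_one, enorm_sq_eq_ofReal]
    refine ENNReal.ofReal_le_ofReal ?_
    exact (Finset.single_le_sum (f := fun α => ψ i j α β (ε⁻¹ • x) ^ 2)
      (fun _ _ => sq_nonneg _) (Finset.mem_univ α)).trans
      (Finset.single_le_sum (f := fun i => ∑ α, ψ i j α β (ε⁻¹ • x) ^ 2)
        (fun _ _ => Finset.sum_nonneg fun _ _ => sq_nonneg _) (Finset.mem_univ i))
  · simp [indicator_of_notMem hx]

/-- The Besicovitch seminorm in the error parameter is finite, so that its real value is not a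
junk value. -/
lemma besicovitchSeminorm_gradDefect_lt_top {μ : ℝ} (hμ : 0 < μ) {A ψ : Coeff d m}
    (hell : IsElliptic μ A) {M : ℝ} (hM : ∀ i j α β, ∀ᵐ y, |A i j α β y| ≤ M)
    {χ : Fin d → Fin m → Fin m → E d → ℝ} (hψ : IsPotentialCorrector A ψ)
    (hχ : ∀ j α β, MemH1LocUnif (χ j α β)) : besicovitchSeminorm (gradDefect ψ χ) < ⊤ := by
  obtain ⟨θ, hθ, hθ0, hθ1⟩ := exists_bump d
  obtain ⟨C, hC, hCb⟩ := exists_energy_bound hμ hell hM hθ hθ0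
  choose c hc hcb using fun q : Fin d × Fin d × Fin m × Fin m =>
    exists_rescale_bound ((hχ q.2.1 q.2.2.1 q.2.2.2).2 q.1).2
  have hsum : (∑ q, c q) ≠ ⊤ := by
    simpa [ENNReal.sum_eq_top] using fun a b e f => hc (a, b, e, f)
  refine besicovitchSeminorm_lt_top_of_bound (c := 2 * (∑ q, c q) + 2 * ENNReal.ofReal C)
    (by finiteness) (memL2Loc_gradDefect hψ hχ) fun q => ?_
  filter_upwards [hcb q, hCb ψ hψ q.2.1 q.2.2.2, self_mem_nhdsWithin] with ε h1 h2 hε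
  have hε' : (0 : ℝ) < ε := hε
  have h3 := lintegral_corrector_le hθ hθ0 hθ1 (fun i α => (hψ q.2.1 q.2.2.2).1.1 i α) hε' h2
    q.1 q.2.2.1
  set a := fun x => weakDeriv univ q.1 (χ q.2.1 q.2.2.1 q.2.2.2) (ε⁻¹ • x) with ha
  set b := fun x => ψ q.1 q.2.1 q.2.2.1 q.2.2.2 (ε⁻¹ • x) with hb
  have hbm : AEMeasurable (fun x => 2 * ‖a x‖ₑ ^ 2) (volume.restrict (Metric.ball 0 1)) :=
    ((((hχ q.2.1 q.2.2.1 q.2.2.2).2 q.1).2.1.comp_inv_smul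
      hε').aestronglyMeasurable.enorm.pow_const 2).const_mul 2 |>.restrict
  calc ∫⁻ x in Metric.ball (0 : E d) 1, ‖gradDefect ψ χ q (ε⁻¹ • x)‖ₑ ^ 2
      ≤ ∫⁻ x in Metric.ball (0 : E d) 1, (2 * ‖a x‖ₑ ^ 2 + 2 * ‖b x‖ₑ ^ 2) := by
        refine lintegral_mono fun x => ?_
        have e1 : gradDefect ψ χ q (ε⁻¹ • x) = a x - b x := rfl
        rw [e1, enorm_sq_eq_ofReal, enorm_sq_eq_ofReal, enorm_sq_eq_ofReal, two_mul_ofReal,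
          two_mul_ofReal, ← ENNReal.ofReal_add (by positivity) (by positivity)]
        exact ENNReal.ofReal_le_ofReal (by nlinarith [sq_nonneg (a x + b x)])
    _ = 2 * (∫⁻ x in Metric.ball (0 : E d) 1, ‖a x‖ₑ ^ 2)
        + 2 * (∫⁻ x in Metric.ball (0 : E d) 1, ‖b x‖ₑ ^ 2) := by
        rw [lintegral_add_left' hbm, lintegral_const_mul' _ _ (by finiteness),
          lintegral_const_mul' _ _ (by finiteness)]
    _ ≤ _ := by
        gcongr
        exact h1.trans (Finset.single_le_sum (f := c) (fun _ _ => zero_le) (Finset.mem_univ q))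

/-- The mean value of `b_T` is controlled by `∇χ_T - ψ`, because `A + Aψ - Â` has mean value
zero. -/
lemma exists_bT_mean_bound {μ : ℝ} (hμ : 0 < μ) {A : Coeff d m} (hell : IsElliptic μ A) {M : ℝ}
    (hM : ∀ i j α β, ∀ᵐ y, |A i j α β y| ≤ M) (hM0 : 0 ≤ M) :
    ∃ C : ℝ, 0 ≤ C ∧ ∀ (ψ : Coeff d m) (Ahat : Fin d → Fin d → Fin m → Fin m → ℝ)
      (χ : Fin d → Fin m → Fin m → E d → ℝ), IsPotentialCorrector A ψ → IsHomogenized A ψ Ahat →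
      (∀ j α β, MemH1LocUnif (χ j α β)) → ∀ i j α β c, HasMeanValue (bT A Ahat χ i j α β) c →
        |c| ≤ C * (besicovitchSeminorm (gradDefect ψ χ)).toReal := by
  obtain ⟨K, hK, hKb⟩ := exists_mean_bound d
  refine ⟨K * (Fintype.card (Fin d × Fin d × Fin m × Fin m) * M), by positivity,
    fun ψ Ahat χ hψ hh hχ i j α β c hc => ?_⟩
  have hg := hh i j α β
  set f : E d → ℝ := fun y => bT A Ahat χ i j α β y -
    (A i j α β y + ∑ k, ∑ γ, A i k α γ y * ψ k j γ β y) + Ahat i j α β with hf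
  have hfe : ∀ y, f y = ∑ k, ∑ γ, A i k α γ y * gradDefect ψ χ (k, j, γ, β) y := by
    intro y
    simp only [hf, bT, gradDefect, mul_sub, Finset.sum_sub_distrib]
    ring
  have hfm : HasMeanValue f c := by
    have hloc : LocallyIntegrable fun y => bT A Ahat χ i j α β y -
      (A i j α β y + ∑ k, ∑ γ, A i k α γ y * ψ k j γ β y) := hc.1.sub hg.1
    refine ⟨hloc.add (locallyIntegrable_const _), fun θ hθ => ?_⟩
    have h1 := ((hc.2 θ hθ).sub (hg.2 θ hθ)).add_const (Ahat i j α β * ∫ x, θ x)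
    rw [sub_add_cancel] at h1
    refine h1.congr' ?_
    filter_upwards [self_mem_nhdsWithin] with ε hε
    have i1 := integrable_rescale_mul_test hc.1 hθ hε
    have i2 := integrable_rescale_mul_test hg.1 hθ hε
    rw [← integral_sub i1 i2, ← integral_const_mul]
    refine (integral_add (i1.sub i2) (hθ.integrable.const_mul _)).symm.trans ?_
    congr 1; ext x; simp only [hf, Pi.sub_apply]; ring
  refine hKb _ (gradDefect ψ χ) (memL2Loc_gradDefect hψ hχ)
    (besicovitchSeminorm_gradDefect_lt_top hμ hell hM hψ hχ) f c M hfm hM0 ?_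
  have hMall : ∀ᵐ y, ∀ k γ, |A i k α γ y| ≤ M :=
    ae_all_iff.2 fun k => ae_all_iff.2 fun γ => hM i k α γ
  filter_upwards [hMall] with y hy
  rw [hfe, Finset.mul_sum, ← Fintype.sum_prod_type' (f := fun k γ =>
    A i k α γ y * gradDefect ψ χ (k, j, γ, β) y)]
  refine (Finset.abs_sum_le_sum_abs _ _).trans ?_
  have hinj : Function.Injective fun p : Fin d × Fin m => (p.1, j, p.2, β) := by
    rintro ⟨a, b⟩ ⟨a', b'⟩ h
    simp only [Prod.mk.injEq] at h
    exact Prod.ext h.1 h.2.2.1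
  calc ∑ p : Fin d × Fin m, |A i p.1 α p.2 y * gradDefect ψ χ (p.1, j, p.2, β) y|
      ≤ ∑ p : Fin d × Fin m, M * |gradDefect ψ χ (p.1, j, p.2, β) y| := by
        refine Finset.sum_le_sum fun p _ => ?_
        rw [abs_mul]
        exact mul_le_mul_of_nonneg_right (hy _ _) (abs_nonneg _)
    _ = ∑ q ∈ Finset.univ.map ⟨_, hinj⟩, M * |gradDefect ψ χ q y| := by
        rw [Finset.sum_map]; rfl
    _ ≤ _ := Finset.sum_le_sum_of_subset_of_nonneg (Finset.subset_univ _)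
        fun _ _ _ => by positivity

/-! ### Cut-off near the boundary -/

lemma measurableSet_boundaryLayer {Ω : Set (E d)} (hΩ : IsOpen Ω) (t : ℝ) :
    MeasurableSet (boundaryLayer Ω t) :=
  (hΩ.inter ((isOpen_Iio (a := t)).preimage (Metric.continuous_infDist_pt _))).measurableSet

lemma eLpNorm_mul_le_of_support {a f : E d → ℝ} {S : Set (E d)} (hS : MeasurableSet S) {B : ℝ}
    (hB : ∀ x ∈ S, |a x| ≤ B) (h0 : ∀ x ∉ S, a x = 0) :
    eLpNorm (fun x => a x * f x) 2 volume ≤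
      ENNReal.ofReal B * eLpNorm f 2 (volume.restrict S) := by
  have h2 : S.indicator (fun x => a x * f x) = fun x => a x * f x := by
    refine indicator_eq_self.2 fun x hx => ?_
    by_contra h
    exact hx (by simp [h0 x h])
  rw [← h2, eLpNorm_indicator_eq_eLpNorm_restrict hS]
  refine eLpNorm_le_mul_eLpNorm_of_ae_le_mul (ae_restrict_of_forall_mem hS fun x hx => ?_) 2
  rw [norm_mul]
  exact mul_le_mul_of_nonneg_right (hB x hx) (norm_nonneg _)

lemma IsCutoff.abs_pderiv_le {Ω : Set (E d)} {Cη δ : ℝ} {η : E d → ℝ} (h : IsCutoff Ω Cη δ η)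
    (i : Fin d) (x : E d) : |pderiv i η x| ≤ Cη / δ := by
  refine ((fderiv ℝ η x).le_opNorm (basisVec i)).trans ?_
  simpa [basisVec] using h.2.2.2 x

lemma IsCutoff.nonneg_const {Ω : Set (E d)} {Cη δ : ℝ} {η : E d → ℝ} (h : IsCutoff Ω Cη δ η)
    (hδ : 0 < δ) : 0 ≤ Cη := by
  have := (norm_nonneg _).trans (h.2.2.2 0)
  by_contra hc
  exact absurd this (not_le.2 (div_neg_of_neg_of_pos (not_le.1 hc) hδ))

lemma IsCutoff.eq_zero_of_frontier_empty {Ω : Set (E d)} {Cη δ : ℝ} {η : E d → ℝ}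
    (h : IsCutoff Ω Cη δ η) (hδ : 0 < δ) (hf : frontier Ω = ∅) (x : E d) : η x = 0 := by
  by_cases hx : x ∈ Ω
  · exact h.2.1 x ⟨hx, by simpa [hf] using hδ⟩
  · exact h.1.eq_zero hx

/-- In the layer where the cut-off is neither `0` nor `1` it is bounded because it vanishes on the
boundary and has gradient at most `Cη / δ`. -/
lemma IsCutoff.abs_le {Ω : Set (E d)} (hΩ : IsOpen Ω) {Cη δ : ℝ} {η : E d → ℝ}
    (h : IsCutoff Ω Cη δ η) (hδ : 0 < δ) (x : E d) : |η x| ≤ 1 + 2 * Cη := by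
  have hC := h.nonneg_const hδ
  rcases (frontier Ω).eq_empty_or_nonempty with hf | hf
  · rw [h.eq_zero_of_frontier_empty hδ hf, abs_zero]; positivity
  by_cases hx : x ∈ Ω
  swap
  · rw [h.1.eq_zero hx, abs_zero]; positivity
  by_cases hx2 : x ∈ boundaryLayer Ω (2 * δ)
  swap
  · rw [h.2.2.1 x ⟨hx, hx2⟩, abs_one]; linarith
  obtain ⟨q, hq, hqx⟩ := (Metric.infDist_lt_iff hf).1 hx2.2
  have hq0 : η q = 0 := h.1.eq_zero fun hqΩ => by
    rw [hΩ.frontier_eq] at hq; exact hq.2 hqΩ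
  have h1 := convex_univ.norm_image_sub_le_of_norm_fderiv_le (𝕜 := ℝ) (f := η) (C := Cη / δ)
    (fun y _ => h.1.differentiable y) (fun y _ => h.2.2.2 y) (mem_univ q) (mem_univ x)
  rw [hq0, sub_zero, Real.norm_eq_abs] at h1
  rw [dist_eq_norm] at hqx
  calc |η x| ≤ Cη / δ * ‖x - q‖ := h1
    _ ≤ Cη / δ * (2 * δ) := by gcongr
    _ = 2 * Cη := by field_simp
    _ ≤ _ := by linarith

/-- The gradient of the cut-off is supported in the closed layer of width `2δ`, which lies in the
open layer of width `3δ`. -/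
lemma IsCutoff.pderiv_eq_zero {Ω : Set (E d)} (hΩ : IsOpen Ω) {Cη δ : ℝ} {η : E d → ℝ}
    (h : IsCutoff Ω Cη δ η) (hδ : 0 < δ) (i : Fin d) {x : E d}
    (hx : x ∉ boundaryLayer Ω (3 * δ)) : _root_.pderiv i η x = 0 := by
  by_cases hxΩ : x ∈ Ω
  swap
  · exact (h.1.pderiv i).eq_zero hxΩ
  have hx3 : 3 * δ ≤ Metric.infDist x (frontier Ω) := not_lt.1 fun hlt => hx ⟨hxΩ, hlt⟩
  refine pderiv_eq_zero_of_eq_one (U := Ω ∩ {y | 2 * δ < Metric.infDist y (frontier Ω)})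
    (hΩ.inter ((isOpen_Ioi (a := 2 * δ)).preimage (Metric.continuous_infDist_pt _)))
    (fun y hy => h.2.2.1 y ⟨hy.1, fun hyl => ?_⟩) ⟨hxΩ, ?_⟩ i
  · exact absurd hyl.2 (not_lt.2 (le_of_lt hy.2))
  · show 2 * δ < Metric.infDist x (frontier Ω)
    linarith

/-- A nonzero cut-off needs `δ` not larger than the diameter of a ball that contains the domain. -/
lemma IsCutoff.eq_zero_or_le {Ω : Set (E d)} {Cη δ : ℝ} {η : E d → ℝ}
    (h : IsCutoff Ω Cη δ η) (hδ : 0 < δ) {R : ℝ} (hR : Ω ⊆ Metric.ball 0 R) :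
    (∀ x, η x = 0) ∨ δ ≤ 2 * R := by
  rw [or_iff_not_imp_left]
  intro hne
  push Not at hne
  obtain ⟨x, hx⟩ := hne
  have hxΩ : x ∈ Ω := by
    by_contra hx'; exact hx (h.1.eq_zero hx')
  have hxd : δ ≤ Metric.infDist x (frontier Ω) := by
    by_contra hlt; exact hx (h.2.1 x ⟨hxΩ, not_le.1 hlt⟩)
  rcases (frontier Ω).eq_empty_or_nonempty with hf | ⟨q, hq⟩
  · exact absurd (h.eq_zero_of_frontier_empty hδ hf x) hx
  have hqR : q ∈ Metric.closedBall (0 : E d) R :=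
    closure_minimal (hR.trans Metric.ball_subset_closedBall) Metric.isClosed_closedBall hq.1
  have hxR := Metric.ball_subset_closedBall (hR hxΩ)
  rw [mem_closedBall_zero_iff] at hqR hxR
  calc δ ≤ dist x q := hxd.trans (Metric.infDist_le_dist_of_mem hq)
    _ ≤ ‖x‖ + ‖q‖ := by rw [dist_eq_norm]; exact norm_sub_le _ _
    _ ≤ 2 * R := by linarith

/-- The cut-off of an `H¹(Ω)` function: its `H¹(ℝ^d)` norm is at most `C δ^{-1/2}`, its distance
to the function in `L²(Ω)` at most `C δ^{1/2}`, times the `H¹(Ω)` norm. -/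
lemma exists_cutoff_bounds (hd : 1 ≤ d) {Ω : Set (E d)} (hΩ : IsBoundedLipschitzDomain Ω)
    (Cη : ℝ) : ∃ C : ℝ, 0 ≤ C ∧ ∀ (δ : ℝ) (η : E d → ℝ), 0 < δ → IsCutoff Ω Cη δ η →
      ∀ (f : E d → ℝ) (v : Fin d → E d → ℝ), MemLp f 2 (volume.restrict Ω) →
        (∀ i, MemLp (v i) 2 (volume.restrict Ω)) → (∀ i, HasWeakDeriv Ω i f (v i)) →
        √δ * (nrm (fun x => η x * f x) + ∑ k, nrm (fun x => pderiv k η x * f x + η x * v k x)) ≤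
          C * (sumNorm Ω f v).toReal ∧
        (eLpNorm (fun x => f x - η x * f x) 2 (volume.restrict Ω)).toReal ≤
          C * √δ * (sumNorm Ω f v).toReal := by
  obtain ⟨CL, hCL, hL⟩ := exists_boundaryLayer_le hd hΩ
  obtain ⟨R, hR0, hR⟩ := hΩ.2.1.subset_ball_lt 0 0
  set a : ℝ := 1 + 2 * |Cη| with ha
  have ha0 : 0 ≤ a := by positivity
  refine ⟨max (√(2 * R) * a + d * (|Cη| * (CL * √3) + √(2 * R) * a)) ((1 + a) * (CL * √2)),
    by positivity, fun δ η hδ hη f v hf hv hw => ?_⟩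
  set N := (sumNorm Ω f v).toReal with hN
  have hNt : sumNorm Ω f v ≠ ⊤ := by
    rw [sumNorm]
    exact ENNReal.add_ne_top.2 ⟨hf.eLpNorm_ne_top,
      ENNReal.sum_ne_top.2 fun i _ => (hv i).eLpNorm_ne_top⟩
  have hN0 : 0 ≤ N := ENNReal.toReal_nonneg
  have hCη := hη.nonneg_const hδ
  have hηa : ∀ x, |η x| ≤ a := fun x => by
    rw [ha, abs_of_nonneg hCη]; exact hη.abs_le hΩ.1 hδ x
  have hfN : eLpNorm f 2 (volume.restrict Ω) ≤ ENNReal.ofReal N := by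
    rw [hN, ENNReal.ofReal_toReal hNt]; exact le_self_add
  have hvN : ∀ i, eLpNorm (v i) 2 (volume.restrict Ω) ≤ ENNReal.ofReal N := fun i => by
    rw [hN, ENNReal.ofReal_toReal hNt]
    exact (Finset.single_le_sum (f := fun i => eLpNorm (v i) 2 (volume.restrict Ω))
      (fun _ _ => zero_le) (Finset.mem_univ i)).trans le_add_self
  have hlay : ∀ t, 0 < t → eLpNorm f 2 (volume.restrict (boundaryLayer Ω t)) ≤
      ENNReal.ofReal (CL * √t * N) := fun t ht => by
    rw [ENNReal.ofReal_mul (by positivity), hN, ENNReal.ofReal_toReal hNt]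
    exact hL t ht f v hf hv hw
  have hmul : ∀ w : E d → ℝ, eLpNorm w 2 (volume.restrict Ω) ≤ ENNReal.ofReal N →
      eLpNorm (fun x => η x * w x) 2 volume ≤ ENNReal.ofReal (a * N) := fun w hwN => by
    rw [ENNReal.ofReal_mul ha0]
    refine (eLpNorm_mul_le_of_support hΩ.1.measurableSet (fun x _ => hηa x)
      fun x hx => hη.1.eq_zero hx).trans ?_
    gcongr
  constructor
  · refine le_trans ?_ (mul_le_mul_of_nonneg_right (le_max_left _ _) hN0)
    -- for `δ > 2R` the cut-off is zero, otherwise `√δ` is bounded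
    rcases hη.eq_zero_or_le hδ hR with h0 | hδR
    · have h1 : η = fun _ => 0 := funext h0
      have h2 : ∀ k x, pderiv k η x = 0 := fun k x => by rw [h1]; simp [pderiv]
      simp only [h0, h2, zero_mul, add_zero]
      have h3 : nrm (fun _ : E d => (0 : ℝ)) = 0 := by simp [nrm]
      rw [h3]
      simp only [Finset.sum_const_zero, add_zero, mul_zero]
      positivity
    have hs : √δ ≤ √(2 * R) := Real.sqrt_le_sqrt hδR
    have h1 : nrm (fun x => η x * f x) ≤ a * N :=
      ENNReal.toReal_le_of_le_ofReal (by positivity) (hmul f hfN)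
    have h2 : ∀ k, √δ * nrm (fun x => pderiv k η x * f x + η x * v k x) ≤
        (|Cη| * (CL * √3) + √(2 * R) * a) * N := by
      intro k
      -- `∇η` is of size `1 / δ` on a layer of width `3δ`, hence a bound of order `δ^{-1/2}`
      have e1 : eLpNorm (fun x => pderiv k η x * f x) 2 volume ≤
          ENNReal.ofReal (|Cη| / δ * (CL * √(3 * δ) * N)) := by
        rw [ENNReal.ofReal_mul (by positivity)]
        refine (eLpNorm_mul_le_of_support (measurableSet_boundaryLayer hΩ.1 (3 * δ)) (B := |Cη| / δ)
          (fun x _ => ?_) fun x hx => hη.pderiv_eq_zero hΩ.1 hδ k hx).trans ?_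
        · rw [abs_of_nonneg hCη]; exact hη.abs_pderiv_le k x
        · gcongr; exact hlay _ (by positivity)
      have e2 : nrm (fun x => pderiv k η x * f x + η x * v k x) ≤
          |Cη| / δ * (CL * √(3 * δ) * N) + a * N := by
        refine ENNReal.toReal_le_of_le_ofReal (by positivity) ?_
        rw [ENNReal.ofReal_add (by positivity) (by positivity)]
        refine (eLpNorm_add_le (memLp_test_mul hΩ.1.measurableSet (hη.1.pderiv k) hf).1
          (memLp_test_mul hΩ.1.measurableSet hη.1 (hv k)).1 (by norm_num)).trans ?_
        exact add_le_add e1 (hmul _ (hvN k))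
      calc _ ≤ √δ * (|Cη| / δ * (CL * √(3 * δ) * N) + a * N) := by gcongr
        _ = (|Cη| * (CL * √3)) * N * (√δ * √δ / δ) + √δ * a * N := by
            rw [Real.sqrt_mul (by norm_num)]; ring
        _ ≤ (|Cη| * (CL * √3)) * N * 1 + √(2 * R) * a * N := by
            rw [Real.mul_self_sqrt hδ.le, div_self hδ.ne']
            gcongr
        _ = _ := by ring
    calc _ = √δ * nrm (fun x => η x * f x)
          + ∑ k, √δ * nrm (fun x => pderiv k η x * f x + η x * v k x) := by
          rw [mul_add, Finset.mul_sum]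
      _ ≤ √(2 * R) * (a * N) + ∑ _k : Fin d, (|Cη| * (CL * √3) + √(2 * R) * a) * N := by
          exact add_le_add (mul_le_mul hs h1 (nrm_nonneg _) (Real.sqrt_nonneg _))
            (Finset.sum_le_sum fun k _ => h2 k)
      _ = _ := by
          simp only [Finset.sum_const, Finset.card_univ, Fintype.card_fin, nsmul_eq_mul]; ring
  · refine le_trans (ENNReal.toReal_le_of_le_ofReal (b := (1 + a) * (CL * √2) * √δ * N)
      (by positivity) ?_) ?_
    · rw [← eLpNorm_indicator_eq_eLpNorm_restrict hΩ.1.measurableSet]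
      have e : Ω.indicator (fun x => f x - η x * f x) =
          fun x => Ω.indicator (fun x => 1 - η x) x * f x := by
        ext x
        by_cases hx : x ∈ Ω
        · simp only [indicator_of_mem hx]; ring
        · simp [indicator_of_notMem hx]
      rw [e]
      have e3 : (1 + a) * (CL * √2) * √δ * N = (1 + a) * (CL * √(2 * δ) * N) := by
        rw [Real.sqrt_mul (by norm_num)]; ring
      rw [e3, ENNReal.ofReal_mul (by positivity)]
      refine (eLpNorm_mul_le_of_support (measurableSet_boundaryLayer hΩ.1 (2 * δ)) (B := 1 + a)
        (fun x hx => ?_) fun x hx => ?_).trans ?_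
      · rw [indicator_of_mem hx.1]
        refine (abs_sub _ _).trans ?_
        rw [abs_one]; gcongr; exact hηa x
      · by_cases hxΩ : x ∈ Ω
        · rw [indicator_of_mem hxΩ, hη.2.2.1 x ⟨hxΩ, hx⟩, sub_self]
        · rw [indicator_of_notMem hxΩ]
      · gcongr; exact hlay _ (by positivity)
    · gcongr
      exact le_max_right _ _

/-- A segment that leaves `Ω` meets the boundary, so a compact set at distance `δ` from the boundary
stays in `Ω` when it is thickened by less than `δ`. -/
lemma cthickening_subset_of_infDist {Ω K : Set (E d)} (hΩ : IsOpen Ω)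
    (hK : IsCompact K) (hKΩ : K ⊆ Ω) {s δ : ℝ} (hs : 0 ≤ s) (hsδ : s < δ)
    (h : ∀ x ∈ K, δ ≤ Metric.infDist x (frontier Ω)) : Metric.cthickening s K ⊆ Ω := by
  intro y hy
  rw [hK.cthickening_eq_biUnion_closedBall hs] at hy
  obtain ⟨x, hx, hyx⟩ := mem_iUnion₂.1 hy
  have hxΩ := hKΩ hx
  by_contra hyΩ
  -- the segment from `x` to `y` meets the boundary
  have hconn : IsPreconnected (segment ℝ x y) := (convex_segment x y).isPreconnected
  obtain ⟨z, hz, hzf⟩ : (segment ℝ x y ∩ frontier Ω).Nonempty := by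
    by_contra hne
    have h0 : ∀ z ∈ segment ℝ x y, z ∉ frontier Ω := fun z hz hzf => hne ⟨z, hz, hzf⟩
    rw [hΩ.frontier_eq] at h0
    have hy' := right_mem_segment ℝ x y
    obtain ⟨z, -, hz1, hz2⟩ := hconn Ω (closure Ω)ᶜ hΩ isClosed_closure.isOpen_compl
      (fun z hz => by
        by_cases hzΩ : z ∈ Ω
        · exact Or.inl hzΩ
        · exact Or.inr fun hzc => h0 z hz ⟨hzc, hzΩ⟩)
      ⟨x, left_mem_segment ℝ x y, hxΩ⟩ ⟨y, hy', fun hyc => h0 y hy' ⟨hyc, hyΩ⟩⟩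
    exact hz2 (subset_closure hz1)
  have h1 := h x hx
  have h2 : dist x z ≤ dist x y := by
    obtain ⟨t, ht, rfl⟩ := segment_eq_image_lineMap ℝ x y ▸ hz
    rw [dist_left_lineMap, Real.norm_of_nonneg ht.1]
    exact mul_le_of_le_one_left dist_nonneg ht.2
  have h3 := Metric.infDist_le_dist_of_mem (x := x) hzf
  rw [Metric.mem_closedBall, dist_comm] at hyx
  linarith

/-- The smoothed cut-off of an `H¹(Ω)` function is a test function on `Ω`, as the cut-off stays
away from the boundary by more than the smoothing radius. -/
lemma IsCutoff.isTest_mollify {Ω : Set (E d)} (hΩ : IsOpen Ω) {Cη δ : ℝ} {η : E d → ℝ}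
    (h : IsCutoff Ω Cη δ η) {κ : E d → ℝ} {s : ℝ} (hs : 0 ≤ s) (hsδ : s < δ) (hκ : IsKernel κ s)
    {f : E d → ℝ} (hf : MemLp f 2 (volume.restrict Ω)) :
    IsTest Ω (mollify κ fun x => η x * f x) := by
  refine _root_.isTest_mollify hκ.test h.1.2.1
    (MemLp.locallyIntegrable_two (memLp_test_mul hΩ.measurableSet h.1 hf)) (fun x hx => ?_) ?_
  · rw [image_eq_zero_of_notMem_tsupport hx, zero_mul]
  · refine cthickening_subset_of_infDist hΩ h.1.2.1 h.1.2.2 hs hsδ fun x hx => ?_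
    have hcl : IsClosed {y : E d | δ ≤ Metric.infDist y (frontier Ω)} :=
      isClosed_Ici.preimage (Metric.continuous_infDist_pt _)
    refine closure_minimal (fun y hy => ?_) hcl hx
    by_contra hlt
    by_cases hyΩ : y ∈ Ω
    · exact hy (h.2.1 y ⟨hyΩ, not_le.1 hlt⟩)
    · exact hy (h.1.eq_zero hyΩ)

lemma sumNorm_ne_top {Ω : Set (E d)} {f : E d → ℝ} {v : Fin d → E d → ℝ}
    (hf : MemLp f 2 (volume.restrict Ω)) (hv : ∀ i, MemLp (v i) 2 (volume.restrict Ω)) :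
    sumNorm Ω f v ≠ ⊤ :=
  ENNReal.add_ne_top.2 ⟨hf.eLpNorm_ne_top,
    ENNReal.sum_ne_top.2 fun i _ => (hv i).eLpNorm_ne_top⟩

/-- The properties of the smoothed cut-off of an `H¹(Ω)` function at scale `ε ≤ δ / 2`. -/
lemma exists_smoothing_bounds (hd : 1 ≤ d) {Ω : Set (E d)} (hΩ : IsBoundedLipschitzDomain Ω)
    (Cη : ℝ) : ∃ C : ℝ, 0 ≤ C ∧ ∀ (ε δ : ℝ) (η κ : E d → ℝ), 0 < ε → 2 * ε ≤ δ →
      IsCutoff Ω Cη δ η → IsKernel κ ε →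
      ∀ (f : E d → ℝ) (v : Fin d → E d → ℝ), MemLp f 2 (volume.restrict Ω) →
        (∀ i, MemLp (v i) 2 (volume.restrict Ω)) → (∀ i, HasWeakDeriv Ω i f (v i)) →
        √δ * (nrm (fun x => η x * f x) + ∑ k, nrm (fun x => pderiv k η x * f x + η x * v k x)) ≤
          C * (sumNorm Ω f v).toReal ∧
        (eLpNorm (fun x => f x - mollify κ (fun x => η x * f x) x) 2
          (volume.restrict Ω)).toReal ≤ C * √δ * (sumNorm Ω f v).toReal := by
  obtain ⟨C, hC, hCb⟩ := exists_cutoff_bounds hd hΩ Cη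
  refine ⟨2 * C, by positivity, fun ε δ η κ hε hεδ hη hκ f v hf hv hw => ?_⟩
  have hδ : 0 < δ := by linarith
  obtain ⟨h1, h2⟩ := hCb δ η hδ hη f v hf hv hw
  set N := (sumNorm Ω f v).toReal with hN
  have hN0 : 0 ≤ N := ENNReal.toReal_nonneg
  set F := fun x => η x * f x with hF
  set DF := fun k x => pderiv k η x * f x + η x * v k x with hDF
  refine ⟨h1.trans (by nlinarith), ?_⟩
  have hFL : MemLp F 2 volume := memLp_test_mul hΩ.1.measurableSet hη.1 hf
  have hDL : ∀ k, MemLp (DF k) 2 volume := fun k =>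
    (memLp_test_mul hΩ.1.measurableSet (hη.1.pderiv k) hf).add
      (memLp_test_mul hΩ.1.measurableSet hη.1 (hv k))
  have hFw : ∀ k, HasWeakDeriv univ k F (DF k) := fun k => (hw k).mul_test hη.1
  have h3 := hκ.eLpNorm_mollify_sub_le hε.le hη.1.2.1 hFL hDL hFw
    (fun x hx => by rw [hF]; simp only [image_eq_zero_of_notMem_tsupport hx, zero_mul])
  have h4 : ENNReal.ofReal ε * ∑ i, eLpNorm (DF i) 2 volume =
      ENNReal.ofReal (ε * ∑ i, nrm (DF i)) := by
    rw [ENNReal.ofReal_mul hε.le, ENNReal.ofReal_sum_of_nonneg fun _ _ => nrm_nonneg _]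
    congr 1
    exact Finset.sum_congr rfl fun i _ => (ENNReal.ofReal_toReal (hDL i).eLpNorm_ne_top).symm
  rw [h4] at h3
  have hS0 : 0 ≤ ∑ i, nrm (DF i) := Finset.sum_nonneg fun _ _ => nrm_nonneg _
  have h5 : ε * ∑ i, nrm (DF i) ≤ C * √δ * N := by
    have e1 : √δ * ∑ i, nrm (DF i) ≤ C * N :=
      (mul_le_mul_of_nonneg_left (le_add_of_nonneg_left (nrm_nonneg _)) (Real.sqrt_nonneg _)).trans h1
    calc ε * ∑ i, nrm (DF i) ≤ δ * ∑ i, nrm (DF i) := by gcongr; linarith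
      _ = √δ * (√δ * ∑ i, nrm (DF i)) := by rw [← mul_assoc, Real.mul_self_sqrt hδ.le]
      _ ≤ √δ * (C * N) := by gcongr
      _ = _ := by ring
  have hmL := hκ.memLp_mollify hFL
  have hfF : MemLp (fun x => f x - F x) 2 (volume.restrict Ω) :=
    hf.sub (hFL.mono_measure Measure.restrict_le_self)
  have hFm : MemLp (fun x => mollify κ F x - F x) 2 (volume.restrict Ω) :=
    (hmL.sub hFL).mono_measure Measure.restrict_le_self
  refine ENNReal.toReal_le_of_le_ofReal (by positivity) ?_
  have e : (fun x => f x - mollify κ F x) =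
      (fun x => f x - F x) - (fun x => mollify κ F x - F x) := by
    ext x; simp only [Pi.sub_apply]; ring
  rw [e]
  refine (eLpNorm_sub_le hfF.1 hFm.1 (by norm_num)).trans ?_
  have e2 : 2 * C * √δ * N = C * √δ * N + C * √δ * N := by ring
  rw [e2, ENNReal.ofReal_add (by positivity) (by positivity)]
  refine add_le_add ?_ ?_
  · rw [← ENNReal.ofReal_toReal hfF.eLpNorm_ne_top]
    exact ENNReal.ofReal_le_ofReal h2
  · exact (eLpNorm_restrict_le _ _ _ _).trans (h3.trans (ENNReal.ofReal_le_ofReal h5))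

/-! ### The rescaled corrector equations -/

/-- The equation of the dual approximate corrector in the variable `x = εy`. -/
lemma dual_equation_rescale {b φ : E d → ℝ} (hφ : MemH1LocUnif φ) (hb : LocallyIntegrable b)
    {c ε : ℝ} (hε : 0 < ε)
    (h : ∀ v : E d → ℝ, IsTest univ v →
      (∫ y, ∑ k, weakDeriv univ k φ y * pderiv k v y) + ε ^ 2 * (∫ y, φ y * v y) =
        ∫ y, (b y - c) * v y) {G : E d → ℝ} (hG : IsTest univ G) :
    ∫ x, b (ε⁻¹ • x) * G x = c * (∫ x, G x) + ε ^ 2 * (∫ x, φ (ε⁻¹ • x) * G x) +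
      ε * ∑ k, ∫ x, weakDeriv univ k φ (ε⁻¹ • x) * pderiv k G x := by
  have hv := hG.comp_smul hε
  have h1 := h _ hv
  have hdφ : ∀ k, LocallyIntegrable (weakDeriv univ k φ) := fun k =>
    (hφ.2 k).2.1.locallyIntegrable
  rw [integral_finsetSum _ fun k _ =>
    integrable_mul_test ((hdφ k).locallyIntegrableOn univ) (hv.pderiv k)] at h1
  simp only [pderiv_comp_smul hG.differentiable] at h1
  have e1 : ∀ k, ∫ x, weakDeriv univ k φ (ε⁻¹ • x) * pderiv k G x =
      ε ^ d * (ε⁻¹ * ∫ y, weakDeriv univ k φ y * (ε * pderiv k G (ε • y))) := by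
    intro k
    rw [integral_comp_inv_smul_mul _ _ hε, ← integral_const_mul ε⁻¹]
    congr 2; ext y; field_simp
  have e2 : ∫ y, (b y - c) * G (ε • y) = (∫ y, b y * G (ε • y)) - c * ∫ y, G (ε • y) := by
    rw [← integral_const_mul, ← integral_sub
      (integrable_mul_test (hb.locallyIntegrableOn univ) hv) (hv.integrable.const_mul c)]
    congr 1; ext y; ring
  have e3 : ∫ x, G x = ε ^ d * ∫ y, G (ε • y) := by
    simpa using integral_comp_inv_smul_mul (fun _ => 1) G hε
  rw [e2] at h1
  rw [integral_comp_inv_smul_mul _ _ hε, integral_comp_inv_smul_mul _ _ hε, e3]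
  simp only [e1, ← Finset.mul_sum]
  have hε0 := hε.ne'
  rw [eq_sub_iff_add_eq] at h1
  rw [← h1]
  generalize (∑ k, ∫ y, weakDeriv univ k φ y * (ε * pderiv k G (ε • y))) = S
  field_simp
  ring

/-- The equation of the approximate corrector in the variable `x = εy`: the rescaled `b_T` has
divergence `ε χ_T`. -/
lemma div_bT_rescale {A : Coeff d m} {Ahat : Fin d → Fin d → Fin m → Fin m → ℝ} {ε : ℝ}
    (hε : 0 < ε) {χ : Fin d → Fin m → Fin m → E d → ℝ} (hχ : IsApproxCorrector A ε⁻¹ χ)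
    {j : Fin d} {α β : Fin m} (hA : ∀ i, LocallyIntegrable (A i j α β))
    (hb : ∀ i, LocallyIntegrable (bT A Ahat χ i j α β)) {G : E d → ℝ} (hG : IsTest univ G) :
    ∑ i, ∫ x, bT A Ahat χ i j α β (ε⁻¹ • x) * pderiv i G x =
      -(ε * ∫ x, χ j α β (ε⁻¹ • x) * G x) := by
  have hv := hG.comp_smul hε
  have h := hχ.2 j β (fun α' => if α' = α then fun y => G (ε • y) else fun _ => 0) (fun α' => by
    split_ifs
    · exact hv
    · exact IsTest.zero)
  have hp : ∀ (i : Fin d) (α' : Fin m) y,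
      pderiv i (if α' = α then fun y => G (ε • y) else fun _ => 0) y =
        if α' = α then ε * pderiv i G (ε • y) else 0 := by
    intro i α' y
    split_ifs
    · rw [pderiv_comp_smul hG.differentiable]
    · simp [pderiv]
  have h0 : ∀ (α' : Fin m) y,
      (if α' = α then fun y => G (ε • y) else fun _ => (0 : ℝ)) y =
        if α' = α then G (ε • y) else 0 := by
    intro α' y
    split_ifs <;> rfl
  simp only [hp, h0, mul_ite, mul_zero, Finset.sum_ite_eq', Finset.mem_univ, if_true] at h
  have e0 : ∀ i (y : E d), (∑ k, ∑ α', ∑ γ, if α' = α then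
      A i k α' γ y * weakDeriv univ k (χ j γ β) y * (ε * pderiv i G (ε • y)) else 0) =
      (bT A Ahat χ i j α β y - A i j α β y + Ahat i j α β) * (ε * pderiv i G (ε • y)) := by
    intro i y
    have : ∀ k, (∑ α', ∑ γ, if α' = α then
      A i k α' γ y * weakDeriv univ k (χ j γ β) y * (ε * pderiv i G (ε • y)) else 0) =
      ∑ γ, A i k α γ y * weakDeriv univ k (χ j γ β) y * (ε * pderiv i G (ε • y)) := by
      intro k
      rw [Finset.sum_comm]
      simp
    simp only [this, ← Finset.sum_mul, bT]
    ring
  simp only [e0] at h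
  have hGp : ∀ i, IsTest univ fun y => ε * pderiv i G (ε • y) := fun i =>
    ((hG.pderiv i).comp_smul hε).const_mul ε
  have i1 : ∀ i, Integrable fun y => bT A Ahat χ i j α β y * (ε * pderiv i G (ε • y)) := fun i =>
    integrable_mul_test ((hb i).locallyIntegrableOn univ) (hGp i)
  have i2 : ∀ i, Integrable fun y => A i j α β y * (ε * pderiv i G (ε • y)) := fun i =>
    integrable_mul_test ((hA i).locallyIntegrableOn univ) (hGp i)
  have i3 : ∀ i, Integrable fun y => Ahat i j α β * (ε * pderiv i G (ε • y)) := fun i =>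
    (hGp i).integrable.const_mul _
  have z : ∀ i, ∫ y, Ahat i j α β * (ε * pderiv i G (ε • y)) = 0 := by
    intro i
    have := integral_pderiv_eq_zero hv i
    simp only [pderiv_comp_smul hG.differentiable] at this
    rw [integral_const_mul, this, mul_zero]
  have e1 : ∫ y, ∑ i, (bT A Ahat χ i j α β y - A i j α β y + Ahat i j α β) *
      (ε * pderiv i G (ε • y)) =
      (∑ i, ∫ y, bT A Ahat χ i j α β y * (ε * pderiv i G (ε • y))) -
        ∫ y, ∑ i, A i j α β y * (ε * pderiv i G (ε • y)) := by
    rw [integral_finsetSum _ fun i _ => i2 i, ← Finset.sum_sub_distrib, integral_finsetSum]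
    · refine Finset.sum_congr rfl fun i _ => ?_
      rw [← integral_sub (i1 i) (i2 i)]
      rw [← add_zero (∫ y, (bT A Ahat χ i j α β y * (ε * pderiv i G (ε • y)) -
        A i j α β y * (ε * pderiv i G (ε • y)))), ← z i]
      refine Eq.trans ?_ (integral_add ((i1 i).sub (i2 i)) (i3 i))
      congr 1; ext y; ring
    · intro i _
      refine (((i1 i).sub (i2 i)).add (i3 i)).congr (Eventually.of_forall fun y => ?_)
      simp only [Pi.sub_apply, Pi.add_apply]; ring
  rw [e1, inv_pow, inv_inv] at h
  have e2 : ∀ i, ∫ x, bT A Ahat χ i j α β (ε⁻¹ • x) * pderiv i G x =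
      ε ^ d * (ε⁻¹ * ∫ y, bT A Ahat χ i j α β y * (ε * pderiv i G (ε • y))) := by
    intro i
    rw [integral_comp_inv_smul_mul _ _ hε, ← integral_const_mul ε⁻¹]
    congr 2; ext y; field_simp
  simp only [e2, ← Finset.mul_sum]
  rw [integral_comp_inv_smul_mul _ _ hε]
  have e3 : (∑ i, ∫ y, bT A Ahat χ i j α β y * (ε * pderiv i G (ε • y))) =
      -(ε ^ 2 * ∫ y, χ j α β y * G (ε • y)) := by linarith
  rw [e3]
  have hε0 := hε.ne'
  field_simp

lemma locallyIntegrable_of_ae_bounded {f : E d → ℝ} (hf : AEMeasurable f volume) {M : ℝ}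
    (hM : ∀ᵐ y, |f y| ≤ M) : LocallyIntegrable f := by
  refine (locallyIntegrable_const M).mono hf.aestronglyMeasurable ?_
  filter_upwards [hM] with y hy
  exact hy.trans (le_abs_self M)

/-- The flux estimate for `b_T` in terms of the error parameter. -/
lemma exists_abs_bT_le (hd : 1 ≤ d) {μ : ℝ} (hμ : 0 < μ) {A : Coeff d m} (hell : IsElliptic μ A)
    (hAm : ∀ i j α β, AEMeasurable (A i j α β) volume) {M : ℝ}
    (hM : ∀ i j α β, ∀ᵐ y, |A i j α β y| ≤ M) (hM0 : 0 ≤ M) {ζ : E d → ℝ} (hζ : IsMollifier ζ) :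
    ∃ C : ℝ, 0 ≤ C ∧ ∀ (ψ : Coeff d m) (Ahat : Fin d → Fin d → Fin m → Fin m → ℝ),
      IsPotentialCorrector A ψ → IsHomogenized A ψ Ahat → ∀ (ε : ℝ), 0 < ε →
      ∀ (χ : Fin d → Fin m → Fin m → E d → ℝ) (φ : Coeff d m), IsApproxCorrector A ε⁻¹ χ →
      IsDualApproxCorrector A Ahat ε⁻¹ χ φ → ∀ (j : Fin d) (α β : Fin m) (F : E d → ℝ)
      (DF : Fin d → E d → ℝ) (v : E d → ℝ), MemLp F 2 volume → (∀ k, MemLp (DF k) 2 volume) →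
      (∀ k, HasWeakDeriv univ k F (DF k)) → IsTest univ v →
      |∑ i, ∫ x, bT A Ahat χ i j α β (ε⁻¹ • x) * (mollify (dilate ζ ε) F x * pderiv i v x)| ≤
        C * errorParam ε⁻¹ ψ χ φ * (nrm F + ∑ k, nrm (DF k)) * ∑ i, nrm (pderiv i v) := by
  obtain ⟨C₁, hC₁, hflux⟩ := exists_abs_sum_flux_le (d := d) hd
  obtain ⟨C₂, hC₂, hmean⟩ := exists_bT_mean_bound hμ hell hM hM0
  obtain ⟨Mζ, hMζ0, hMζ⟩ := hζ.1.exists_bound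
  have hMζ' : ∀ x, ζ x ≤ Mζ := fun x => (le_abs_self _).trans (hMζ x)
  set s := √Mζ * √(ballVol d) with hs
  have hs0 : 0 ≤ s := by positivity
  refine ⟨C₁ * (d * C₂ + s), by positivity,
    fun ψ Ahat hψ hh ε hε χ φ hχ hφ j α β F DF v hF hDF hw hv => ?_⟩
  choose hφ1 c hc hceq using fun i => hφ i j α β
  have hSχ := fun q : Fin d × Fin m × Fin m => lintegral_le_stepanovNorm
    (f := fun q : Fin d × Fin m × Fin m => χ q.1 q.2.1 q.2.2) (fun q => (hχ.1 _ _ _).1) q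
  have hSφ := fun q : Fin d × Fin d × Fin m × Fin m => lintegral_le_stepanovNorm
    (f := fun q : Fin d × Fin d × Fin m × Fin m => φ q.1 q.2.1 q.2.2.1 q.2.2.2)
    (fun q => (hφ _ _ _ _).1.1) q
  have hSD := fun q : Fin d × Fin d × Fin d × Fin m × Fin m => lintegral_le_stepanovNorm
    (f := fun q : Fin d × Fin d × Fin d × Fin m × Fin m =>
      weakDeriv univ q.1 (φ q.2.1 q.2.2.1 q.2.2.2.1 q.2.2.2.2))
    (fun q => ((hφ _ _ _ _).1.2 _).2) q
  have hT : ((ε⁻¹) ^ 2)⁻¹ = ε ^ 2 := by rw [inv_pow, inv_inv]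
  simp only [errorParam, hT, inv_inv]
  set Sχ := (stepanovNorm (fun q : Fin d × Fin m × Fin m => χ q.1 q.2.1 q.2.2) 1).toReal
  set Sφ := (stepanovNorm (fun q : Fin d × Fin d × Fin m × Fin m =>
    φ q.1 q.2.1 q.2.2.1 q.2.2.2) 1).toReal
  set SD := (stepanovNorm (fun q : Fin d × Fin d × Fin d × Fin m × Fin m =>
    weakDeriv univ q.1 (φ q.2.1 q.2.2.1 q.2.2.2.1 q.2.2.2.2)) 1).toReal
  have hSχ0 : 0 ≤ Sχ := ENNReal.toReal_nonneg
  have hSφ0 : 0 ≤ Sφ := ENNReal.toReal_nonneg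
  have hSD0 : 0 ≤ SD := ENNReal.toReal_nonneg
  have hcb := fun i => hmean ψ Ahat χ hψ hh hχ.1 i j α β (c i) (hc i)
  change ∀ i, |c i| ≤ C₂ * (besicovitchSeminorm (fun q : Fin d × Fin d × Fin m × Fin m => fun y =>
    weakDeriv univ q.1 (χ q.2.1 q.2.2.1 q.2.2.2) y - ψ q.1 q.2.1 q.2.2.1 q.2.2.2 y)).toReal at hcb
  set b := (besicovitchSeminorm (fun q : Fin d × Fin d × Fin m × Fin m => fun y =>
    weakDeriv univ q.1 (χ q.2.1 q.2.2.1 q.2.2.2) y - ψ q.1 q.2.1 q.2.2.1 q.2.2.2 y)).toReal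
  have hb0 : 0 ≤ b := ENNReal.toReal_nonneg
  have hr0 : 0 ≤ √(ballVol d) := Real.sqrt_nonneg _
  have main := hflux ε (fun i x => bT A Ahat χ i j α β (ε⁻¹ • x))
    (fun i x => φ i j α β (ε⁻¹ • x)) (fun k i x => weakDeriv univ k (φ i j α β) (ε⁻¹ • x))
    (fun x => χ j α β (ε⁻¹ • x)) c (dilate ζ ε) F DF v ε (√Mζ * (√(ballVol d) * Sφ))
    (√Mζ * (√(ballVol d) * SD)) (√Mζ * (√(ballVol d) * Sχ)) hε (hζ.isKernel_dilate hε)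
    (fun i => isMultiplier_rescale hζ hMζ0 hMζ' hε (hφ1 i).1.1 (by positivity)
      (hSφ (i, j, α, β)))
    (fun k i => isMultiplier_rescale hζ hMζ0 hMζ' hε ((hφ1 i).2 k).2.1 (by positivity)
      (hSD (k, i, j, α, β)))
    (isMultiplier_rescale hζ hMζ0 hMζ' hε (hχ.1 j α β).1.1 (by positivity) (hSχ (j, α, β)))
    (by positivity) (by positivity) (by positivity)
    (fun i G hG => dual_equation_rescale (hφ1 i) (hc i).1 hε
      (fun v hv => by have := hceq i v hv; rwa [hT] at this) hG)
    (fun G hG => div_bT_rescale hε hχ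
      (fun i => locallyIntegrable_of_ae_bounded (hAm i j α β) (hM i j α β))
      (fun i => (hc i).1) hG)
    (fun i k G hG => ((hφ1 i).2 k).1.rescale_integral hε hG) hF hDF hw hv
  refine main.trans ?_
  have hNv : 0 ≤ ∑ i, nrm (pderiv i v) := Finset.sum_nonneg fun _ _ => nrm_nonneg _
  have hNF : 0 ≤ nrm F + ∑ k, nrm (DF k) :=
    add_nonneg (nrm_nonneg _) (Finset.sum_nonneg fun _ _ => nrm_nonneg _)
  refine mul_le_mul_of_nonneg_right (mul_le_mul_of_nonneg_right ?_ hNF) hNv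
  rw [mul_assoc]
  refine mul_le_mul_of_nonneg_left ?_ hC₁
  have hcs : ∑ i, |c i| ≤ d * (C₂ * b) := by
    refine (Finset.sum_le_sum fun i _ => hcb i).trans ?_
    simp
  have hrest : 0 ≤ 2 * ε + ε * Sχ + ε ^ 2 * Sφ + ε * SD := by positivity
  calc _ ≤ d * (C₂ * b) + s * (ε * Sχ + ε ^ 2 * Sφ + ε * SD) := by
        rw [hs]; linarith
    _ ≤ (d * C₂) * (2 * ε + b + ε * Sχ + ε ^ 2 * Sφ + ε * SD)
        + s * (2 * ε + b + ε * Sχ + ε ^ 2 * Sφ + ε * SD) := by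
        have : 0 ≤ d * C₂ := by positivity
        rw [← mul_assoc]
        gcongr <;> nlinarith
    _ = _ := by ring

/-! ### The norms of `H¹` and `H²` and the space `H¹_0` -/

lemma le_rpow_half_of_sq_le {x y : ℝ≥0∞} (h : x ^ 2 ≤ y) : x ≤ y ^ (1 / 2 : ℝ) := by
  calc x = (x ^ 2) ^ (1 / 2 : ℝ) := by
        rw [← ENNReal.rpow_natCast, ← ENNReal.rpow_mul]; norm_num
    _ ≤ _ := by gcongr

lemma rpow_half_le_of_le_sq {x y : ℝ≥0∞} (h : y ≤ x ^ 2) : y ^ (1 / 2 : ℝ) ≤ x := by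
  calc _ ≤ (x ^ 2) ^ (1 / 2 : ℝ) := by gcongr
    _ = x := by rw [← ENNReal.rpow_natCast, ← ENNReal.rpow_mul]; norm_num

lemma single_le_sum_ennreal {ι : Type*} [Fintype ι] (f : ι → ℝ≥0∞) (i : ι) : f i ≤ ∑ i, f i :=
  Finset.single_le_sum (f := f) (fun _ _ => zero_le) (Finset.mem_univ i)

lemma eLpNorm_le_h1Norm (Ω : Set (E d)) (u : Fin m → E d → ℝ) (α : Fin m) :
    eLpNorm (u α) 2 (volume.restrict Ω) ≤ h1Norm Ω u :=
  le_rpow_half_of_sq_le (le_self_add.trans (single_le_sum_ennreal (fun α =>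
    eLpNorm (u α) 2 (volume.restrict Ω) ^ 2 +
      ∑ i, eLpNorm (weakDeriv Ω i (u α)) 2 (volume.restrict Ω) ^ 2) α))

lemma eLpNorm_weakDeriv_le_h1Norm (Ω : Set (E d)) (u : Fin m → E d → ℝ) (i : Fin d) (α : Fin m) :
    eLpNorm (weakDeriv Ω i (u α)) 2 (volume.restrict Ω) ≤ h1Norm Ω u :=
  le_rpow_half_of_sq_le (((single_le_sum_ennreal (fun i =>
    eLpNorm (weakDeriv Ω i (u α)) 2 (volume.restrict Ω) ^ 2) i).trans le_add_self).trans
    (single_le_sum_ennreal (fun α => eLpNorm (u α) 2 (volume.restrict Ω) ^ 2 +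
      ∑ i, eLpNorm (weakDeriv Ω i (u α)) 2 (volume.restrict Ω) ^ 2) α))

lemma add_sum_sq_le {ι : Type*} [Fintype ι] (x : ℝ≥0∞) (y : ι → ℝ≥0∞) :
    x ^ 2 + ∑ i, y i ^ 2 ≤ (x + ∑ i, y i) ^ 2 := by
  refine (add_le_add_right (sum_sq_le_sq_sum y) _).trans ?_
  rw [add_sq]
  calc x ^ 2 + (∑ i, y i) ^ 2 ≤ x ^ 2 + (∑ i, y i) ^ 2 + 2 * x * ∑ i, y i := le_self_add
    _ = _ := by ring

lemma h1Norm_le_sum (Ω : Set (E d)) (u : Fin m → E d → ℝ) :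
    h1Norm Ω u ≤ ∑ α, sumNorm Ω (u α) (fun i => weakDeriv Ω i (u α)) := by
  refine rpow_half_le_of_le_sq (le_trans (Finset.sum_le_sum fun α _ => ?_) (sum_sq_le_sq_sum _))
  exact add_sum_sq_le _ _

lemma sumNorm_weakDeriv_le_h2Norm (Ω : Set (E d)) (u : Fin m → E d → ℝ) (i : Fin d) (α : Fin m) :
    sumNorm Ω (weakDeriv Ω i (u α)) (fun j => weakDeriv Ω j (weakDeriv Ω i (u α))) ≤
      (1 + d) * h2Norm Ω u := by
  have h0 := single_le_sum_ennreal (fun α => eLpNorm (u α) 2 (volume.restrict Ω) ^ 2 +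
    ∑ i, eLpNorm (weakDeriv Ω i (u α)) 2 (volume.restrict Ω) ^ 2 +
    ∑ i, ∑ j, eLpNorm (weakDeriv Ω j (weakDeriv Ω i (u α))) 2 (volume.restrict Ω) ^ 2) α
  have h1 : eLpNorm (weakDeriv Ω i (u α)) 2 (volume.restrict Ω) ≤ h2Norm Ω u :=
    le_rpow_half_of_sq_le ((((single_le_sum_ennreal (fun i =>
      eLpNorm (weakDeriv Ω i (u α)) 2 (volume.restrict Ω) ^ 2) i).trans
        le_add_self).trans le_self_add).trans h0)
  have h2 : ∀ j, eLpNorm (weakDeriv Ω j (weakDeriv Ω i (u α))) 2 (volume.restrict Ω) ≤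
      h2Norm Ω u := fun j =>
    le_rpow_half_of_sq_le ((((single_le_sum_ennreal (fun j =>
      eLpNorm (weakDeriv Ω j (weakDeriv Ω i (u α))) 2 (volume.restrict Ω) ^ 2) j).trans
      (single_le_sum_ennreal (fun i => ∑ j,
        eLpNorm (weakDeriv Ω j (weakDeriv Ω i (u α))) 2 (volume.restrict Ω) ^ 2) i)).trans
        le_add_self).trans h0)
  refine (add_le_add h1 (Finset.sum_le_sum fun j _ => h2 j)).trans (le_of_eq ?_)
  simp only [Finset.sum_const, Finset.card_univ, Fintype.card_fin, nsmul_eq_mul]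
  ring

lemma h2Norm_ne_top {Ω : Set (E d)} {u : Fin m → E d → ℝ} (hu : ∀ α, MemH2 Ω (u α)) :
    h2Norm Ω u ≠ ⊤ := by
  refine ENNReal.rpow_ne_top_of_nonneg (by norm_num) (ENNReal.sum_ne_top.2 fun α _ => ?_)
  refine ENNReal.add_ne_top.2 ⟨ENNReal.add_ne_top.2 ⟨?_, ENNReal.sum_ne_top.2 fun i _ => ?_⟩,
    ENNReal.sum_ne_top.2 fun i _ => ENNReal.sum_ne_top.2 fun j _ => ?_⟩
  · exact ENNReal.pow_ne_top (hu α).1.1.eLpNorm_ne_top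
  · exact ENNReal.pow_ne_top ((hu α).1.2 i).2.eLpNorm_ne_top
  · exact ENNReal.pow_ne_top (((hu α).2 i).2 j).2.eLpNorm_ne_top

/-- Members of `H¹_0(Ω)` through approximation by test functions in the single components. -/
lemma memH10_of_approx {Ω : Set (E d)} (hΩ : IsOpen Ω) {u : Fin m → E d → ℝ}
    {du : Fin d → Fin m → E d → ℝ} (hu : ∀ α, MemLp (u α) 2 (volume.restrict Ω))
    (hdu : ∀ i α, MemLp (du i α) 2 (volume.restrict Ω))
    (hw : ∀ i α, HasWeakDeriv Ω i (u α) (du i α))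
    (h : ∀ e : ℝ≥0∞, e ≠ 0 → ∃ φ : Fin m → E d → ℝ, (∀ α, IsTest Ω (φ α)) ∧ ∀ α,
      eLpNorm (fun x => u α x - φ α x) 2 (volume.restrict Ω) ≤ e ∧
        ∀ i, eLpNorm (fun x => du i α x - pderiv i (φ α) x) 2 (volume.restrict Ω) ≤ e) :
    MemH10 Ω u := by
  refine ⟨fun α => memH1_of_hasWeakDeriv hΩ (hu α) (fun i => hw i α) (fun i => hdu i α), ?_⟩
  have he : ∀ n : ℕ, ((n : ℝ≥0∞) + 1)⁻¹ ≠ 0 := fun n => by simp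
  choose φ hφ h1 using fun n : ℕ => h _ (he n)
  refine ⟨φ, hφ, ?_⟩
  have hb : ∀ n, h1Norm Ω (u - φ n) ≤ (m * (1 + d) : ℕ) * ((n : ℝ≥0∞) + 1)⁻¹ := by
    intro n
    refine (h1Norm_le_sum _ _).trans ?_
    calc _ ≤ ∑ _α : Fin m, (((n : ℝ≥0∞) + 1)⁻¹ + ∑ _i : Fin d, ((n : ℝ≥0∞) + 1)⁻¹) := by
          refine Finset.sum_le_sum fun α _ => add_le_add (h1 n α).1 (Finset.sum_le_sum fun i _ => ?_)
          refine le_trans (le_of_eq (eLpNorm_congr_ae ?_)) ((h1 n α).2 i)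
          exact ((hw i α).sub ((hφ n α).hasWeakDeriv Ω i)).weakDeriv_ae_eq hΩ
      _ = _ := by
          simp only [Finset.sum_const, Finset.card_univ, Fintype.card_fin, nsmul_eq_mul]
          push_cast; ring
  have hlim : Tendsto (fun n : ℕ => ((m * (1 + d) : ℕ) : ℝ≥0∞) * ((n : ℝ≥0∞) + 1)⁻¹) atTop
      (𝓝 0) := by
    have := ENNReal.Tendsto.const_mul (a := ((m * (1 + d) : ℕ) : ℝ≥0∞))
      (ENNReal.tendsto_inv_nat_nhds_zero.comp (tendsto_add_atTop_nat 1))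
      (Or.inr (ENNReal.natCast_ne_top _))
    simpa [Function.comp_def] using this
  exact tendsto_of_tendsto_of_tendsto_of_le_of_le tendsto_const_nhds hlim (fun _ => zero_le) hb

lemma MemH10.exists_approx {Ω : Set (E d)} (hΩ : IsOpen Ω) {u : Fin m → E d → ℝ}
    (hu : MemH10 Ω u) {e : ℝ≥0∞} (he : e ≠ 0) : ∃ φ : Fin m → E d → ℝ, (∀ α, IsTest Ω (φ α)) ∧
      ∀ α, eLpNorm (fun x => u α x - φ α x) 2 (volume.restrict Ω) ≤ e ∧
        ∀ i, eLpNorm (fun x => weakDeriv Ω i (u α) x - pderiv i (φ α) x) 2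
          (volume.restrict Ω) ≤ e := by
  obtain ⟨hu1, φ, hφ, hlim⟩ := hu
  obtain ⟨n, hn⟩ := (hlim.eventually (gt_mem_nhds (pos_iff_ne_zero.2 he))).exists
  refine ⟨φ n, hφ n, fun α => ⟨(eLpNorm_le_h1Norm Ω (u - φ n) α).trans hn.le, fun i => ?_⟩⟩
  refine le_trans (le_of_eq (eLpNorm_congr_ae ?_))
    ((eLpNorm_weakDeriv_le_h1Norm Ω (u - φ n) i α).trans hn.le)
  exact ((((hu1 α).2 i).1.sub ((hφ n α).hasWeakDeriv Ω i)).weakDeriv_ae_eq hΩ).symm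

/-- Subtracting an `H¹` function with compact support in `Ω` does not leave `H¹_0(Ω)`. -/
lemma MemH10.sub_of_compact {Ω K : Set (E d)} (hΩ : IsOpen Ω) (hK : IsCompact K) (hKΩ : K ⊆ Ω)
    {u z : Fin m → E d → ℝ} {dz : Fin d → Fin m → E d → ℝ} (hu : MemH10 Ω u)
    (hz : ∀ α, MemLp (z α) 2 volume) (hdz : ∀ i α, MemLp (dz i α) 2 volume)
    (hw : ∀ i α, HasWeakDeriv univ i (z α) (dz i α)) (hzK : ∀ α, ∀ x ∉ K, z α x = 0) :
    MemH10 Ω fun α x => u α x - z α x := by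
  have hu1 := hu.1
  refine memH10_of_approx hΩ (du := fun i α x => weakDeriv Ω i (u α) x - dz i α x)
    (fun α => (hu1 α).1.sub ((hz α).mono_measure Measure.restrict_le_self))
    (fun i α => ((hu1 α).2 i).2.sub ((hdz i α).mono_measure Measure.restrict_le_self))
    (fun i α => ((hu1 α).2 i).1.sub ((hw i α).mono (subset_univ _))) fun e he => ?_
  have he2 : e / 2 ≠ 0 := by simpa using he
  obtain ⟨φ, hφ, h1⟩ := hu.exists_approx hΩ he2
  choose θ hθ h2 h3 using fun α => exists_test_approx hΩ hK hKΩ (hz α) (fun i => hdz i α)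
    (fun i => hw i α) (hzK α) he2
  refine ⟨fun α x => φ α x - θ α x, fun α => (hφ α).sub (hθ α), fun α => ⟨?_, fun i => ?_⟩⟩
  · have e1 : (fun x => u α x - z α x - (φ α x - θ α x)) =
        (fun x => u α x - φ α x) + fun x => θ α x - z α x := by
      ext x; simp only [Pi.add_apply]; ring
    rw [e1, ← ENNReal.add_halves e]
    refine (eLpNorm_add_le (((hu1 α).1.sub ((hφ α).memLp 2 _)).1)
      ((((hθ α).memLp 2 _).sub (hz α)).mono_measure Measure.restrict_le_self).1
      (by norm_num)).trans ?_
    exact add_le_add (h1 α).1 ((eLpNorm_restrict_le _ _ _ _).trans (h2 α))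
  · have e1 : (fun x => weakDeriv Ω i (u α) x - dz i α x -
        pderiv i (fun x => φ α x - θ α x) x) =
        (fun x => weakDeriv Ω i (u α) x - pderiv i (φ α) x) +
          fun x => pderiv i (θ α) x - dz i α x := by
      ext x
      simp only [Pi.add_apply]
      rw [pderiv_sub (hφ α).differentiable (hθ α).differentiable]; ring
    rw [e1, ← ENNReal.add_halves e]
    refine (eLpNorm_add_le ((((hu1 α).2 i).2.sub (((hφ α).pderiv i).memLp 2 _)).1)
      (((((hθ α).pderiv i).memLp 2 _).sub (hdz i α)).mono_measure Measure.restrict_le_self).1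
      (by norm_num)).trans ?_
    exact add_le_add ((h1 α).2 i) ((eLpNorm_restrict_le _ _ _ _).trans (h3 α i))

/-! ### The energy estimate -/

lemma le_of_forall_pos_le_add_mul {X Y c : ℝ} (hc : 0 ≤ c) (h : ∀ e > 0, X ≤ Y + c * e) :
    X ≤ Y := by
  refine le_of_forall_pos_le_add fun e he => (h (e / (c + 1)) (by positivity)).trans ?_
  gcongr
  rw [mul_div_assoc', div_le_iff₀ (by positivity)]
  nlinarith

/-- The `L²(Ω)` norm as a real number. -/
def nrmOn (Ω : Set (E d)) (f : E d → ℝ) : ℝ := (eLpNorm f 2 (volume.restrict Ω)).toReal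

lemma nrmOn_nonneg (Ω : Set (E d)) (f : E d → ℝ) : 0 ≤ nrmOn Ω f := ENNReal.toReal_nonneg

lemma nrmOn_le_nrm (Ω : Set (E d)) {f : E d → ℝ} (hf : MemLp f 2 volume) : nrmOn Ω f ≤ nrm f :=
  ENNReal.toReal_mono hf.eLpNorm_ne_top (eLpNorm_restrict_le _ _ _ _)

lemma IsTest.nrmOn_eq {Ω : Set (E d)} (hΩ : IsOpen Ω) {f : E d → ℝ} (hf : IsTest Ω f) :
    nrmOn Ω f = nrm f := by
  rw [nrmOn, nrm, ← eLpNorm_indicator_eq_eLpNorm_restrict hΩ.measurableSet]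
  congr 2
  exact indicator_eq_self.2 fun x hx => by
    by_contra h; exact hx (hf.eq_zero h)

lemma nrmOn_sq {Ω : Set (E d)} {f : E d → ℝ} (hf : MemLp f 2 (volume.restrict Ω)) :
    nrmOn Ω f ^ 2 = ∫ x in Ω, f x ^ 2 := by
  have h := eLpNorm_two_sq f (volume.restrict Ω)
  simp only [enorm_sq_eq_ofReal] at h
  rw [← ofReal_integral_eq_lintegral_ofReal hf.integrable_sq
    (Eventually.of_forall fun x => sq_nonneg _)] at h
  rw [nrmOn, ← ENNReal.toReal_pow, h,
    ENNReal.toReal_ofReal (integral_nonneg fun x => sq_nonneg _)]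

/-- The bilinear form `∫_Ω a_{ij}^{αβ} p_j^β q_i^α`. -/
def formInt (Ω : Set (E d)) (A : Coeff d m) (p q : Fin d → Fin m → E d → ℝ) : ℝ :=
  ∫ x in Ω, ∑ i, ∑ j, ∑ α, ∑ β, A i j α β x * p j β x * q i α x

lemma memLp_bounded_mul {Ω : Set (E d)} {a f : E d → ℝ} (ha : AEMeasurable a volume) {M : ℝ}
    (hM : ∀ᵐ y, |a y| ≤ M) (hf : MemLp f 2 (volume.restrict Ω)) :
    MemLp (fun x => a x * f x) 2 (volume.restrict Ω) := by
  refine hf.of_le_mul (c := M) (ha.aestronglyMeasurable.restrict.mul hf.1) ?_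
  filter_upwards [ae_restrict_of_ae hM] with x hx
  rw [norm_mul]
  exact mul_le_mul_of_nonneg_right hx (norm_nonneg _)

lemma nrmOn_bounded_mul_le {Ω : Set (E d)} {a f : E d → ℝ} {M : ℝ} (hM0 : 0 ≤ M)
    (hM : ∀ᵐ y, |a y| ≤ M) (hf : MemLp f 2 (volume.restrict Ω)) :
    nrmOn Ω (fun x => a x * f x) ≤ M * nrmOn Ω f := by
  have h : eLpNorm (fun x => a x * f x) 2 (volume.restrict Ω) ≤
      ENNReal.ofReal M * eLpNorm f 2 (volume.restrict Ω) := by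
    refine eLpNorm_le_mul_eLpNorm_of_ae_le_mul ?_ 2
    filter_upwards [ae_restrict_of_ae hM] with x hx
    rw [norm_mul]
    exact mul_le_mul_of_nonneg_right hx (norm_nonneg _)
  refine (ENNReal.toReal_mono (by finiteness [hf.eLpNorm_ne_top]) h).trans (le_of_eq ?_)
  rw [ENNReal.toReal_mul, ENNReal.toReal_ofReal hM0, nrmOn]

section form

variable {Ω : Set (E d)} {A : Coeff d m} {p p' q q' : Fin d → Fin m → E d → ℝ} {M : ℝ}

lemma integrable_form_term (hAm : ∀ i j α β, AEMeasurable (A i j α β) volume)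
    (hM : ∀ i j α β, ∀ᵐ y, |A i j α β y| ≤ M)
    (hp : ∀ j β, MemLp (p j β) 2 (volume.restrict Ω))
    (hq : ∀ j β, MemLp (q j β) 2 (volume.restrict Ω)) (i j : Fin d) (α β : Fin m) :
    IntegrableOn (fun x => A i j α β x * p j β x * q i α x) Ω :=
  (memLp_bounded_mul (hAm i j α β) (hM i j α β) (hp j β)).integrable_mul (hq i α)

lemma integrable_form (hAm : ∀ i j α β, AEMeasurable (A i j α β) volume)
    (hM : ∀ i j α β, ∀ᵐ y, |A i j α β y| ≤ M)
    (hp : ∀ j β, MemLp (p j β) 2 (volume.restrict Ω))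
    (hq : ∀ j β, MemLp (q j β) 2 (volume.restrict Ω)) :
    IntegrableOn (fun x => ∑ i, ∑ j, ∑ α, ∑ β, A i j α β x * p j β x * q i α x) Ω :=
  integrable_finsetSum _ fun i _ => integrable_finsetSum _ fun j _ =>
    integrable_finsetSum _ fun α _ => integrable_finsetSum _ fun β _ =>
      integrable_form_term hAm hM hp hq i j α β

lemma abs_formInt_le (hAm : ∀ i j α β, AEMeasurable (A i j α β) volume)
    (hM : ∀ i j α β, ∀ᵐ y, |A i j α β y| ≤ M) (hM0 : 0 ≤ M)
    (hp : ∀ j β, MemLp (p j β) 2 (volume.restrict Ω))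
    (hq : ∀ j β, MemLp (q j β) 2 (volume.restrict Ω)) :
    |formInt Ω A p q| ≤ M * (∑ j, ∑ β, nrmOn Ω (p j β)) * ∑ i, ∑ α, nrmOn Ω (q i α) := by
  have ht := integrable_form_term hAm hM hp hq
  have h1 : formInt Ω A p q =
      ∑ i, ∑ j, ∑ α, ∑ β, ∫ x in Ω, A i j α β x * p j β x * q i α x := by
    rw [formInt, integral_finsetSum _ fun i _ => integrable_finsetSum _ fun j _ =>
      integrable_finsetSum _ fun α _ => integrable_finsetSum _ fun β _ => ht i j α β]
    refine Finset.sum_congr rfl fun i _ => ?_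
    rw [integral_finsetSum _ fun j _ =>
      integrable_finsetSum _ fun α _ => integrable_finsetSum _ fun β _ => ht i j α β]
    refine Finset.sum_congr rfl fun j _ => ?_
    rw [integral_finsetSum _ fun α _ => integrable_finsetSum _ fun β _ => ht i j α β]
    refine Finset.sum_congr rfl fun α _ => ?_
    rw [integral_finsetSum _ fun β _ => ht i j α β]
  have h2 : ∀ i j α β, |∫ x in Ω, A i j α β x * p j β x * q i α x| ≤
      M * nrmOn Ω (p j β) * nrmOn Ω (q i α) := fun i j α β =>
    (abs_integral_mul_le (memLp_bounded_mul (hAm i j α β) (hM i j α β) (hp j β)) (hq i α)).trans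
      (mul_le_mul_of_nonneg_right (nrmOn_bounded_mul_le hM0 (hM i j α β) (hp j β))
        (nrmOn_nonneg _ _))
  rw [h1]
  calc _ ≤ ∑ i, ∑ j, ∑ α, ∑ β, M * nrmOn Ω (p j β) * nrmOn Ω (q i α) := by
        refine (Finset.abs_sum_le_sum_abs _ _).trans (Finset.sum_le_sum fun i _ => ?_)
        refine (Finset.abs_sum_le_sum_abs _ _).trans (Finset.sum_le_sum fun j _ => ?_)
        refine (Finset.abs_sum_le_sum_abs _ _).trans (Finset.sum_le_sum fun α _ => ?_)
        exact (Finset.abs_sum_le_sum_abs _ _).trans (Finset.sum_le_sum fun β _ => h2 i j α β)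
    _ = _ := by
        simp only [Finset.mul_sum, Finset.sum_mul]
        refine Finset.sum_congr rfl fun i _ => ?_
        rw [Finset.sum_comm]

lemma formInt_sub_left (hAm : ∀ i j α β, AEMeasurable (A i j α β) volume)
    (hM : ∀ i j α β, ∀ᵐ y, |A i j α β y| ≤ M)
    (hp : ∀ j β, MemLp (p j β) 2 (volume.restrict Ω))
    (hp' : ∀ j β, MemLp (p' j β) 2 (volume.restrict Ω))
    (hq : ∀ j β, MemLp (q j β) 2 (volume.restrict Ω)) :
    formInt Ω A (fun j β x => p j β x - p' j β x) q = formInt Ω A p q - formInt Ω A p' q := by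
  rw [formInt, formInt, formInt,
    ← integral_sub (integrable_form hAm hM hp hq) (integrable_form hAm hM hp' hq)]
  congr 1; ext x
  simp only [mul_sub, sub_mul, Finset.sum_sub_distrib]

lemma formInt_sub_right (hAm : ∀ i j α β, AEMeasurable (A i j α β) volume)
    (hM : ∀ i j α β, ∀ᵐ y, |A i j α β y| ≤ M)
    (hp : ∀ j β, MemLp (p j β) 2 (volume.restrict Ω))
    (hq : ∀ j β, MemLp (q j β) 2 (volume.restrict Ω))
    (hq' : ∀ j β, MemLp (q' j β) 2 (volume.restrict Ω)) :
    formInt Ω A p (fun j β x => q j β x - q' j β x) = formInt Ω A p q - formInt Ω A p q' := by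
  rw [formInt, formInt, formInt,
    ← integral_sub (integrable_form hAm hM hp hq) (integrable_form hAm hM hp hq')]
  congr 1; ext x
  simp only [mul_sub, Finset.sum_sub_distrib]

lemma formInt_congr_left (h : ∀ j β, p j β =ᵐ[volume.restrict Ω] p' j β) :
    formInt Ω A p q = formInt Ω A p' q := by
  refine integral_congr_ae ?_
  have h' : ∀ᵐ x ∂volume.restrict Ω, ∀ j β, p j β x = p' j β x :=
    ae_all_iff.2 fun j => ae_all_iff.2 fun β => h j β
  filter_upwards [h'] with x hx
  simp only [hx]

end form

/-- A function in `H¹_0` is controlled by the right-hand side of the weak equation it satisfies: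
ellipticity, the Poincaré inequality and the density of test functions. -/
lemma exists_energy_estimate (hd : 1 ≤ d) {Ω : Set (E d)} (hΩ : IsOpen Ω)
    (hΩb : Bornology.IsBounded Ω) {μ : ℝ} (hμ : 0 < μ) : ∃ C : ℝ, 0 ≤ C ∧
      ∀ (A : Coeff d m) (M : ℝ), (∀ i j α β, AEMeasurable (A i j α β) volume) →
        (∀ i j α β, ∀ᵐ y, |A i j α β y| ≤ M) → 0 ≤ M → IsElliptic μ A →
        ∀ (w : Fin m → E d → ℝ) (K : ℝ), MemH10 Ω w → 0 ≤ K →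
        (∀ v : Fin m → E d → ℝ, (∀ α, IsTest Ω (v α)) →
          |formInt Ω A (fun j β => weakDeriv Ω j (w β)) (fun i α => pderiv i (v α))| ≤
            K * ∑ i, ∑ α, nrm (pderiv i (v α))) → (h1Norm Ω w).toReal ≤ C * K := by
  obtain ⟨R, hR0, hR⟩ := hΩb.subset_ball_lt 0 0
  refine ⟨(2 * R + 1) * (d * m / μ), by positivity, fun A M hAm hM hM0 hell w K hw hK h => ?_⟩
  have hdw : ∀ i α, MemLp (weakDeriv Ω i (w α)) 2 (volume.restrict Ω) := fun i α =>
    ((hw.1 α).2 i).2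
  set n : Fin d → Fin m → ℝ := fun i α => nrmOn Ω (weakDeriv Ω i (w α)) with hn
  have hn0 : ∀ i α, 0 ≤ n i α := fun i α => nrmOn_nonneg _ _
  set D := ∑ i, ∑ α, n i α with hD
  have hD0 : 0 ≤ D := Finset.sum_nonneg fun i _ => Finset.sum_nonneg fun α _ => hn0 i α
  -- approximation by test functions, in real numbers
  have happ : ∀ e : ℝ, 0 < e → ∃ φ : Fin m → E d → ℝ, (∀ α, IsTest Ω (φ α)) ∧
      (∀ α, nrmOn Ω (w α) ≤ e + nrm (φ α)) ∧
      (∀ i α, nrmOn Ω (fun x => weakDeriv Ω i (w α) x - pderiv i (φ α) x) ≤ e) ∧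
      ∀ i α, nrm (pderiv i (φ α)) ≤ n i α + e := by
    intro e he
    obtain ⟨φ, hφ, h1⟩ := hw.exists_approx hΩ (e := ENNReal.ofReal e) (by simpa using he)
    have tri : ∀ {f g : E d → ℝ}, MemLp f 2 (volume.restrict Ω) → IsTest Ω g →
        eLpNorm (fun x => f x - g x) 2 (volume.restrict Ω) ≤ ENNReal.ofReal e →
        nrmOn Ω f ≤ e + nrm g ∧ nrm g ≤ nrmOn Ω f + e := by
      intro f g hf hg hfg
      have hgL : MemLp g 2 (volume.restrict Ω) := hg.memLp 2 _
      have e1 : eLpNorm f 2 (volume.restrict Ω) ≤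
          ENNReal.ofReal e + eLpNorm g 2 (volume.restrict Ω) := by
        have : f = (fun x => f x - g x) + g := by ext x; simp
        conv_lhs => rw [this]
        exact (eLpNorm_add_le (hf.sub hgL).1 hgL.1 (by norm_num)).trans (add_le_add hfg le_rfl)
      have e2 : eLpNorm g 2 (volume.restrict Ω) ≤
          eLpNorm f 2 (volume.restrict Ω) + ENNReal.ofReal e := by
        have : g = f - (fun x => f x - g x) := by ext x; simp
        conv_lhs => rw [this]
        exact (eLpNorm_sub_le hf.1 (hf.sub hgL).1 (by norm_num)).trans (add_le_add le_rfl hfg)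
      have e3 := ENNReal.toReal_mono (by finiteness [hgL.eLpNorm_ne_top]) e1
      have e4 := ENNReal.toReal_mono (by finiteness [hf.eLpNorm_ne_top]) e2
      rw [ENNReal.toReal_add (by finiteness) hgL.eLpNorm_ne_top, ENNReal.toReal_ofReal he.le] at e3
      rw [ENNReal.toReal_add hf.eLpNorm_ne_top (by finiteness), ENNReal.toReal_ofReal he.le] at e4
      rw [← hg.nrmOn_eq hΩ]
      exact ⟨e3, e4⟩
    refine ⟨φ, hφ, fun α => (tri (hw.1 α).1 (hφ α) (h1 α).1).1, fun i α => ?_, fun i α =>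
      (tri (hdw i α) ((hφ α).pderiv i) ((h1 α).2 i)).2⟩
    exact ENNReal.toReal_le_of_le_ofReal he.le ((h1 α).2 i)
  have hcard : ∀ e : ℝ, ∑ _i : Fin d, ∑ _α : Fin m, e = d * m * e := fun e => by
    simp only [Finset.sum_const, Finset.card_univ, Fintype.card_fin, nsmul_eq_mul]; ring
  -- by density the hypothesis may be tested with `w` itself
  have hI : formInt Ω A (fun j β => weakDeriv Ω j (w β)) (fun i α => weakDeriv Ω i (w α)) ≤
      K * D := by
    refine le_of_forall_pos_le_add_mul (c := K * (d * m) + M * D * (d * m)) (by positivity)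
      fun e he => ?_
    obtain ⟨φ, hφ, -, h2, h3⟩ := happ e he
    have hφL : ∀ i α, MemLp (pderiv i (φ α)) 2 (volume.restrict Ω) := fun i α =>
      ((hφ α).pderiv i).memLp 2 _
    have h4 := formInt_sub_right (Ω := Ω) hAm hM hdw hdw hφL
    have h5 := abs_formInt_le (Ω := Ω) hAm hM hM0 hdw (fun i α => (hdw i α).sub (hφL i α))
    have h6 : ∑ i, ∑ α, nrm (pderiv i (φ α)) ≤ D + d * m * e := by
      rw [← hcard, hD, ← Finset.sum_add_distrib]
      refine Finset.sum_le_sum fun i _ => ?_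
      rw [← Finset.sum_add_distrib]
      exact Finset.sum_le_sum fun α _ => h3 i α
    have h7 : ∑ i, ∑ α, nrmOn Ω (fun x => weakDeriv Ω i (w α) x - pderiv i (φ α) x) ≤
        d * m * e := by
      rw [← hcard]
      exact Finset.sum_le_sum fun i _ => Finset.sum_le_sum fun α _ => h2 i α
    have h8 := (le_abs_self _).trans (h φ hφ)
    have h9 := (le_abs_self _).trans h5
    have h10 := mul_le_mul_of_nonneg_left h6 hK
    have h11 := mul_le_mul_of_nonneg_left h7 (mul_nonneg hM0 hD0)
    change formInt Ω A (fun j β => weakDeriv Ω j (w β))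
      (fun i α x => weakDeriv Ω i (w α) x - pderiv i (φ α) x) ≤ _ at h9
    rw [h4] at h9
    change _ ≤ M * D * ∑ i, ∑ α, nrmOn Ω (fun x => weakDeriv Ω i (w α) x - pderiv i (φ α) x) at h9
    linarith
  have hQ : μ * ∑ i, ∑ α, n i α ^ 2 ≤
      formInt Ω A (fun j β => weakDeriv Ω j (w β)) (fun i α => weakDeriv Ω i (w α)) := by
    have hsq : ∀ i α, IntegrableOn (fun x => weakDeriv Ω i (w α) x ^ 2) Ω := fun i α =>
      (hdw i α).integrable_sq
    have e1 : μ * ∑ i, ∑ α, n i α ^ 2 =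
        ∫ x in Ω, μ * ∑ i, ∑ α, weakDeriv Ω i (w α) x ^ 2 := by
      rw [integral_const_mul, integral_finsetSum _ fun i _ => integrable_finsetSum _
        fun α _ => hsq i α]
      congr 1
      refine Finset.sum_congr rfl fun i _ => ?_
      rw [integral_finsetSum _ fun α _ => hsq i α]
      exact Finset.sum_congr rfl fun α _ => nrmOn_sq (hdw i α)
    rw [e1]
    refine integral_mono_ae ((integrable_finsetSum _ fun i _ => integrable_finsetSum _
      fun α _ => hsq i α).const_mul μ) (integrable_form hAm hM hdw hdw) ?_
    filter_upwards [ae_restrict_of_ae hell] with x hx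
    refine (hx fun i α => weakDeriv Ω i (w α) x).1.trans (le_of_eq ?_)
    refine Finset.sum_congr rfl fun i _ => Finset.sum_congr rfl fun j _ =>
      Finset.sum_congr rfl fun α _ => Finset.sum_congr rfl fun β _ => by ring
  have hCS : D ^ 2 ≤ d * m * ∑ i, ∑ α, n i α ^ 2 := by
    have := sq_sum_le_card_mul_sum_sq (s := (Finset.univ : Finset (Fin d × Fin m)))
      (f := fun p => n p.1 p.2)
    rw [Fintype.sum_prod_type, Fintype.sum_prod_type] at this
    simpa using this
  have hDK : D ≤ d * m / μ * K := by
    rcases hD0.eq_or_lt with h0 | hpos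
    · rw [← h0]; positivity
    · rw [div_mul_eq_mul_div, le_div_iff₀ hμ]
      have h1 : μ * D ^ 2 ≤ d * m * (K * D) := by
        calc μ * D ^ 2 ≤ μ * (d * m * ∑ i, ∑ α, n i α ^ 2) := by gcongr
          _ = d * m * (μ * ∑ i, ∑ α, n i α ^ 2) := by ring
          _ ≤ _ := mul_le_mul_of_nonneg_left (hQ.trans hI) (by positivity)
      nlinarith
  have hP : ∀ α, nrmOn Ω (w α) ≤ 2 * R * ∑ i, n i α := by
    intro α
    refine le_of_forall_pos_le_add_mul (c := 1 + 2 * R * d) (by positivity) fun e he => ?_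
    obtain ⟨φ, hφ, h1, -, h3⟩ := happ e he
    have h4 := (hφ α).eLpNorm_le_of_bounded hd hR0.le hR
    have h5 : nrm (φ α) ≤ 2 * R * ∑ i, nrm (pderiv i (φ α)) := by
      have hfin : ∀ i, eLpNorm (pderiv i (φ α)) 2 volume ≠ ⊤ := fun i =>
        (((hφ α).pderiv i).memLp 2 _).eLpNorm_ne_top
      refine (ENNReal.toReal_mono (ENNReal.mul_ne_top ENNReal.ofReal_ne_top
        (ENNReal.sum_ne_top.2 fun i _ => hfin i)) h4).trans (le_of_eq ?_)
      rw [ENNReal.toReal_mul, ENNReal.toReal_ofReal (by positivity),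
        ENNReal.toReal_sum fun i _ => hfin i]
      rfl
    have h6 : ∑ i, nrm (pderiv i (φ α)) ≤ ∑ i, n i α + d * e := by
      refine (Finset.sum_le_sum fun i _ => h3 i α).trans (le_of_eq ?_)
      simp [Finset.sum_add_distrib]
    have h7 := mul_le_mul_of_nonneg_left h6 (by positivity : 0 ≤ 2 * R)
    linarith [h1 α]
  have hfin : ∀ α, sumNorm Ω (w α) (fun i => weakDeriv Ω i (w α)) ≠ ⊤ := fun α =>
    sumNorm_ne_top (hw.1 α).1 fun i => hdw i α
  calc (h1Norm Ω w).toReal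
      ≤ (∑ α, sumNorm Ω (w α) (fun i => weakDeriv Ω i (w α))).toReal :=
        ENNReal.toReal_mono (ENNReal.sum_ne_top.2 fun α _ => hfin α) (h1Norm_le_sum Ω w)
    _ = ∑ α, (nrmOn Ω (w α) + ∑ i, n i α) := by
        rw [ENNReal.toReal_sum fun α _ => hfin α]
        refine Finset.sum_congr rfl fun α _ => ?_
        rw [sumNorm, ENNReal.toReal_add (hw.1 α).1.eLpNorm_ne_top
          (ENNReal.sum_ne_top.2 fun i _ => (hdw i α).eLpNorm_ne_top),
          ENNReal.toReal_sum fun i _ => (hdw i α).eLpNorm_ne_top]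
        rfl
    _ ≤ ∑ α, (2 * R + 1) * ∑ i, n i α := Finset.sum_le_sum fun α _ => by
        linarith [hP α]
    _ = (2 * R + 1) * D := by rw [← Finset.mul_sum, Finset.sum_comm]
    _ ≤ (2 * R + 1) * (d * m / μ * K) := by gcongr
    _ = _ := by ring

/-! ### The two-scale expansion -/

lemma two_mul_le_errorParam {ε : ℝ} (hε : 0 < ε) (ψ : Coeff d m)
    (χ : Fin d → Fin m → Fin m → E d → ℝ) (φ : Coeff d m) :
    2 * ε ≤ errorParam ε⁻¹ ψ χ φ := by
  simp only [errorParam, inv_inv]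
  have h1 : ∀ a b : ℝ, ∀ x : ℝ≥0∞, a ≤ b → a ≤ b + x.toReal := fun a b x h =>
    h.trans (le_add_of_nonneg_right ENNReal.toReal_nonneg)
  have h2 : ∀ a b c : ℝ, ∀ x : ℝ≥0∞, 0 ≤ c → a ≤ b → a ≤ b + c * x.toReal := fun a b c x hc h =>
    h.trans (le_add_of_nonneg_right (mul_nonneg hc ENNReal.toReal_nonneg))
  exact h2 _ _ _ _ hε.le (h2 _ _ _ _ (by positivity) (h2 _ _ _ _ hε.le (h1 _ _ _ le_rfl)))

lemma mul_stepanovNorm_le_errorParam {ε : ℝ} (hε : 0 < ε) (ψ : Coeff d m)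
    (χ : Fin d → Fin m → Fin m → E d → ℝ) (φ : Coeff d m) :
    ε * (stepanovNorm (fun q : Fin d × Fin m × Fin m => χ q.1 q.2.1 q.2.2) 1).toReal ≤
      errorParam ε⁻¹ ψ χ φ := by
  simp only [errorParam, inv_inv]
  have h2 : ∀ a b c : ℝ, ∀ x : ℝ≥0∞, 0 ≤ c → a ≤ b → a ≤ b + c * x.toReal := fun a b c x hc h =>
    h.trans (le_add_of_nonneg_right (mul_nonneg hc ENNReal.toReal_nonneg))
  refine h2 _ _ _ _ hε.le (h2 _ _ _ _ (by positivity) ?_)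
  refine le_add_of_nonneg_left ?_
  have := ENNReal.toReal_nonneg (a := besicovitchSeminorm (fun q : Fin d × Fin d × Fin m × Fin m =>
    fun y => weakDeriv univ q.1 (χ q.2.1 q.2.2.1 q.2.2.2) y - ψ q.1 q.2.1 q.2.2.1 q.2.2.2 y))
  positivity

lemma IsElliptic.rescale {μ : ℝ} {A : Coeff d m} (h : IsElliptic μ A) {ε : ℝ} (hε : 0 < ε) :
    IsElliptic μ (_root_.rescale ε A) :=
  ae_comp_smul h (inv_ne_zero hε.ne')

lemma aemeasurable_rescale {A : Coeff d m} (h : ∀ i j α β, AEMeasurable (A i j α β) volume)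
    {ε : ℝ} (hε : 0 < ε) (i j : Fin d) (α β : Fin m) :
    AEMeasurable (rescale ε A i j α β) volume :=
  (aestronglyMeasurable_comp_smul (h i j α β).aestronglyMeasurable (inv_ne_zero hε.ne')).aemeasurable

lemma abs_rescale_le {A : Coeff d m} {M : ℝ} (h : ∀ i j α β, ∀ᵐ y, |A i j α β y| ≤ M)
    {ε : ℝ} (hε : 0 < ε) (i j : Fin d) (α β : Fin m) : ∀ᵐ y, |rescale ε A i j α β y| ≤ M :=
  ae_comp_smul (h i j α β) (inv_ne_zero hε.ne')

/-- The algebra behind the appearance of `b_T`: the contribution of `(Â - A) g` and of the terms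
`A ∇χ g` combine to `-b_T g`. -/
lemma sum_flux_regroup (a : Fin d → Fin d → Fin m → Fin m → ℝ)
    (ah X : Fin d → Fin d → Fin m → Fin m → ℝ) (g q : Fin d → Fin m → ℝ) :
    (∑ i, ∑ j, ∑ α, ∑ β, (ah i j α β - a i j α β) * g j β * q i α) -
      (∑ i, ∑ j, ∑ α, ∑ β, a i j α β * (∑ k, ∑ γ, g k γ * X j k β γ) * q i α) =
    -∑ j, ∑ α, ∑ β, ∑ i, (a i j α β + (∑ k, ∑ γ, a i k α γ * X k j γ β) - ah i j α β) *
      (g j β * q i α) := by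
  have h1 : (∑ i, ∑ j, ∑ α, ∑ β, a i j α β * (∑ k, ∑ γ, g k γ * X j k β γ) * q i α) =
      ∑ i, ∑ j, ∑ α, ∑ β, (∑ k, ∑ γ, a i k α γ * X k j γ β) * (g j β * q i α) := by
    refine Finset.sum_congr rfl fun i _ => ?_
    rw [Finset.sum_comm]
    conv_rhs => rw [Finset.sum_comm]
    refine Finset.sum_congr rfl fun α _ => ?_
    have h2 : ∀ j β, a i j α β * (∑ k, ∑ γ, g k γ * X j k β γ) * q i α =
        ∑ p : Fin d × Fin m, a i j α β * X j p.1 β p.2 * (g p.1 p.2 * q i α) := by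
      intro j β
      rw [Fintype.sum_prod_type]
      simp only [Finset.mul_sum, Finset.sum_mul]
      exact Finset.sum_congr rfl fun k _ => Finset.sum_congr rfl fun γ _ => by ring
    have h3 : ∀ j β, (∑ k, ∑ γ, a i k α γ * X k j γ β) * (g j β * q i α) =
        ∑ p : Fin d × Fin m, a i p.1 α p.2 * X p.1 j p.2 β * (g j β * q i α) := by
      intro j β
      rw [Fintype.sum_prod_type]
      simp only [Finset.sum_mul]
    simp only [h2, h3]
    rw [← Fintype.sum_prod_type' (f := fun j β =>
        ∑ p : Fin d × Fin m, a i j α β * X j p.1 β p.2 * (g p.1 p.2 * q i α)),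
      ← Fintype.sum_prod_type' (f := fun j β =>
        ∑ p : Fin d × Fin m, a i p.1 α p.2 * X p.1 j p.2 β * (g j β * q i α)), Finset.sum_comm]
  have h4 : ∀ f : Fin d → Fin d → Fin m → Fin m → ℝ,
      ∑ j, ∑ α, ∑ β, ∑ i, f i j α β = ∑ i, ∑ j, ∑ α, ∑ β, f i j α β := by
    intro f
    symm
    rw [Finset.sum_comm]
    refine Finset.sum_congr rfl fun j _ => ?_
    rw [Finset.sum_comm]
    refine Finset.sum_congr rfl fun α _ => ?_
    rw [Finset.sum_comm]
  rw [h1, h4]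
  simp only [← Finset.sum_sub_distrib, ← Finset.sum_neg_distrib]
  refine Finset.sum_congr rfl fun i _ => Finset.sum_congr rfl fun j _ =>
    Finset.sum_congr rfl fun α _ => Finset.sum_congr rfl fun β _ => by ring

lemma formInt_sub_coeff {Ω : Set (E d)} {A B : Coeff d m} {p q : Fin d → Fin m → E d → ℝ}
    {M M' : ℝ} (hAm : ∀ i j α β, AEMeasurable (A i j α β) volume)
    (hM : ∀ i j α β, ∀ᵐ y, |A i j α β y| ≤ M)
    (hBm : ∀ i j α β, AEMeasurable (B i j α β) volume)
    (hM' : ∀ i j α β, ∀ᵐ y, |B i j α β y| ≤ M')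
    (hp : ∀ j β, MemLp (p j β) 2 (volume.restrict Ω))
    (hq : ∀ j β, MemLp (q j β) 2 (volume.restrict Ω)) :
    formInt Ω (fun i j α β x => A i j α β x - B i j α β x) p q =
      formInt Ω A p q - formInt Ω B p q := by
  rw [formInt, formInt, formInt,
    ← integral_sub (integrable_form hAm hM hp hq) (integrable_form hBm hM' hp hq)]
  congr 1; ext x
  simp only [sub_mul, Finset.sum_sub_distrib]

/-- The flux terms of the energy identity as integrals of the rescaled `b_T`. -/
lemma formInt_flux {Ω : Set (E d)} {A : Coeff d m} {Ahat : Fin d → Fin d → Fin m → Fin m → ℝ}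
    {χ : Fin d → Fin m → Fin m → E d → ℝ} {ε : ℝ} (hε : 0 < ε)
    {B : Coeff d m} (hB : B = fun i j α β x => constCoeff Ahat i j α β x - rescale ε A i j α β x)
    {g : Fin d → Fin m → E d → ℝ} {v : Fin m → E d → ℝ} (hg : ∀ k γ, IsTest Ω (g k γ))
    (hv : ∀ α, IsTest Ω (v α)) (hb : ∀ i j α β, LocallyIntegrable (bT A Ahat χ i j α β))
    {G : Fin d → Fin m → E d → ℝ}
    (hG : G = fun j β x => ∑ k, ∑ γ, g k γ x * weakDeriv univ j (χ k β γ) (ε⁻¹ • x))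
    (i1 : IntegrableOn (fun x => ∑ i, ∑ j, ∑ α, ∑ β, B i j α β x * g j β x *
      pderiv i (v α) x) Ω)
    (i2 : IntegrableOn (fun x => ∑ i, ∑ j, ∑ α, ∑ β, rescale ε A i j α β x * G j β x *
      pderiv i (v α) x) Ω) :
    formInt Ω B g (fun i α => pderiv i (v α)) -
      formInt Ω (rescale ε A) G (fun i α => pderiv i (v α)) =
    -∑ j, ∑ α, ∑ β, ∑ i, ∫ x, bT A Ahat χ i j α β (ε⁻¹ • x) * (g j β x * pderiv i (v α) x) := by
  have ht : ∀ i j α β, IsTest Ω fun x => g j β x * pderiv i (v α) x := fun i j α β =>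
    ((hv α).pderiv i).mul_left (hg j β).1
  have hi : ∀ i j α β, Integrable fun x =>
      bT A Ahat χ i j α β (ε⁻¹ • x) * (g j β x * pderiv i (v α) x) := fun i j α β =>
    integrable_rescale_mul_test (hb i j α β) (ht i j α β).toUniv hε
  rw [formInt, formInt, ← integral_sub i1 i2]
  have e1 : ∀ i j α β, ∫ x, bT A Ahat χ i j α β (ε⁻¹ • x) * (g j β x * pderiv i (v α) x) =
      ∫ x in Ω, bT A Ahat χ i j α β (ε⁻¹ • x) * (g j β x * pderiv i (v α) x) := fun i j α β =>
    (setIntegral_mul_test (fun x => bT A Ahat χ i j α β (ε⁻¹ • x)) (ht i j α β)).symm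
  have hi' : ∀ i j α β, IntegrableOn (fun x =>
      bT A Ahat χ i j α β (ε⁻¹ • x) * (g j β x * pderiv i (v α) x)) Ω := fun i j α β =>
    (hi i j α β).integrableOn
  simp only [e1]
  have e2 : ∑ j, ∑ α, ∑ β, ∑ i,
      ∫ x in Ω, bT A Ahat χ i j α β (ε⁻¹ • x) * (g j β x * pderiv i (v α) x) =
      ∫ x in Ω, ∑ j, ∑ α, ∑ β, ∑ i,
        bT A Ahat χ i j α β (ε⁻¹ • x) * (g j β x * pderiv i (v α) x) := by
    rw [integral_finsetSum _ fun j _ => integrable_finsetSum _ fun α _ =>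
      integrable_finsetSum _ fun β _ => integrable_finsetSum _ fun i _ => hi' i j α β]
    refine Finset.sum_congr rfl fun j _ => ?_
    rw [integral_finsetSum _ fun α _ =>
      integrable_finsetSum _ fun β _ => integrable_finsetSum _ fun i _ => hi' i j α β]
    refine Finset.sum_congr rfl fun α _ => ?_
    rw [integral_finsetSum _ fun β _ => integrable_finsetSum _ fun i _ => hi' i j α β]
    refine Finset.sum_congr rfl fun β _ => ?_
    rw [integral_finsetSum _ fun i _ => hi' i j α β]
  rw [e2, ← integral_neg]
  congr 1; ext x
  simp only [hB, hG]
  exact sum_flux_regroup (fun i j α β => rescale ε A i j α β x)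
    (fun i j α β => constCoeff Ahat i j α β x)
    (fun l k β γ => weakDeriv univ l (χ k β γ) (ε⁻¹ • x)) (fun j β => g j β x)
    (fun i α => pderiv i (v α) x)

/-- The product of a rescaled approximate corrector with a derivative of a smoothed function. -/
lemma corrector_mul_pderiv_mollify {χ : Fin d → Fin m → Fin m → E d → ℝ}
    (hχ : ∀ j α β, MemH1LocUnif (χ j α β)) {ζ : E d → ℝ} (hζ : IsMollifier ζ) {Mζ : ℝ}
    (hMζ0 : 0 ≤ Mζ) (hMζ : ∀ x, ζ x ≤ Mζ) {ε : ℝ} (hε : 0 < ε) {j : Fin d} {F DF : E d → ℝ}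
    (hw : HasWeakDeriv univ j F DF) (hDF : MemLp DF 2 volume) (k : Fin d) (α β : Fin m) :
    MemLp (fun x => pderiv j (mollify (dilate ζ ε) F) x * (ε * χ k α β (ε⁻¹ • x))) 2 volume ∧
      nrm (fun x => pderiv j (mollify (dilate ζ ε) F) x * (ε * χ k α β (ε⁻¹ • x))) ≤
        √Mζ * √(ballVol d) * (ε * (stepanovNorm (fun q : Fin d × Fin m × Fin m =>
          χ q.1 q.2.1 q.2.2) 1).toReal) * nrm DF := by
  have hS := lintegral_le_stepanovNorm
    (f := fun q : Fin d × Fin m × Fin m => χ q.1 q.2.1 q.2.2) (fun q => (hχ _ _ _).1) (k, α, β)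
  set S := (stepanovNorm (fun q : Fin d × Fin m × Fin m => χ q.1 q.2.1 q.2.2) 1).toReal
  have hS0 : 0 ≤ S := ENNReal.toReal_nonneg
  obtain ⟨h1, h2⟩ := memLp_rescale_mul_mollify hζ hMζ0 hMζ hε (hχ k α β).1.1
    (by positivity) hS 0 hDF
  simp only [add_zero] at h1 h2
  have e : (fun x => pderiv j (mollify (dilate ζ ε) F) x * (ε * χ k α β (ε⁻¹ • x))) =
      ε • fun x => χ k α β (ε⁻¹ • x) * mollify (dilate ζ ε) DF x := by
    ext x
    rw [mollify_test (hζ.isKernel_dilate hε).test.toUniv hw]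
    simp only [Pi.smul_apply, smul_eq_mul]; ring
  rw [e]
  refine ⟨h1.const_smul ε, ?_⟩
  rw [nrm, eLpNorm_const_smul, ENNReal.toReal_mul, toReal_enorm, Real.norm_of_nonneg hε.le]
  calc _ ≤ ε * (√Mζ * (√(ballVol d) * S) * nrm DF) := by gcongr; exact h2
    _ = _ := by ring

lemma nrm_sum_le {ι : Type*} (s : Finset ι) {f : ι → E d → ℝ} (hf : ∀ i, MemLp (f i) 2 volume) :
    nrm (fun x => ∑ i ∈ s, f i x) ≤ ∑ i ∈ s, nrm (f i) := by
  have h := eLpNorm_sum_le (p := 2) (μ := (volume : Measure (E d))) (s := s) (f := f)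
    (fun i _ => (hf i).1) (by norm_num)
  have e : (fun x => ∑ i ∈ s, f i x) = ∑ i ∈ s, f i := by ext x; simp
  rw [nrm, e]
  refine (ENNReal.toReal_mono (ENNReal.sum_ne_top.2 fun i _ => (hf i).eLpNorm_ne_top) h).trans
    (le_of_eq ?_)
  exact ENNReal.toReal_sum fun i _ => (hf i).eLpNorm_ne_top

/-- The correction term `ε χ(x/ε) g` with test functions `g`. -/
def correction (ε : ℝ) (χ : Fin d → Fin m → Fin m → E d → ℝ) (g : Fin d → Fin m → E d → ℝ)
    (α : Fin m) (x : E d) : ℝ := ∑ k, ∑ γ, g k γ x * (ε * χ k α γ (ε⁻¹ • x))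

/-- The part of the derivative of the correction in which the corrector is differentiated. -/
def correctionGrad (ε : ℝ) (χ : Fin d → Fin m → Fin m → E d → ℝ) (g : Fin d → Fin m → E d → ℝ)
    (j : Fin d) (α : Fin m) (x : E d) : ℝ :=
  ∑ k, ∑ γ, g k γ x * weakDeriv univ j (χ k α γ) (ε⁻¹ • x)

/-- The part of the derivative of the correction in which `g` is differentiated. -/
def correctionRem (ε : ℝ) (χ : Fin d → Fin m → Fin m → E d → ℝ) (g : Fin d → Fin m → E d → ℝ)
    (j : Fin d) (α : Fin m) (x : E d) : ℝ :=
  ∑ k, ∑ γ, pderiv j (g k γ) x * (ε * χ k α γ (ε⁻¹ • x))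

section correction

variable {ε : ℝ} {χ : Fin d → Fin m → Fin m → E d → ℝ} {g : Fin d → Fin m → E d → ℝ}
  {Ω : Set (E d)}

lemma memLp_test_mul_rescale {Q θ : E d → ℝ} (hQ : MemL2Loc Q) (hε : 0 < ε) (hΩ : IsOpen Ω)
    (hΩb : Bornology.IsBounded Ω) (hθ : IsTest Ω θ) :
    MemLp (fun x => θ x * Q (ε⁻¹ • x)) 2 volume :=
  memLp_test_mul hΩ.measurableSet hθ ((hQ.comp_inv_smul hε).memLp_restrict hΩb)

lemma memLp_test_mul_const_rescale {Q θ : E d → ℝ} (hQ : MemL2Loc Q) (hε : 0 < ε)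
    (hΩ : IsOpen Ω) (hΩb : Bornology.IsBounded Ω) (hθ : IsTest Ω θ) :
    MemLp (fun x => θ x * (ε * Q (ε⁻¹ • x))) 2 volume :=
  memLp_test_mul hΩ.measurableSet hθ (((hQ.comp_inv_smul hε).memLp_restrict hΩb).const_mul ε)

lemma memLp_correction (hε : 0 < ε) (hχ : ∀ j α β, MemH1LocUnif (χ j α β)) (hΩ : IsOpen Ω)
    (hΩb : Bornology.IsBounded Ω) (hg : ∀ k γ, IsTest Ω (g k γ)) (α : Fin m) :
    MemLp (correction ε χ g α) 2 volume :=
  memLp_finsetSum _ fun k _ => memLp_finsetSum _ fun γ _ =>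
    memLp_test_mul_const_rescale (hχ k α γ).1.1 hε hΩ hΩb (hg k γ)

lemma memLp_correctionGrad (hε : 0 < ε) (hχ : ∀ j α β, MemH1LocUnif (χ j α β)) (hΩ : IsOpen Ω)
    (hΩb : Bornology.IsBounded Ω) (hg : ∀ k γ, IsTest Ω (g k γ)) (j : Fin d) (α : Fin m) :
    MemLp (correctionGrad ε χ g j α) 2 volume :=
  memLp_finsetSum _ fun k _ => memLp_finsetSum _ fun γ _ =>
    memLp_test_mul_rescale ((hχ k α γ).2 j).2.1 hε hΩ hΩb (hg k γ)

lemma memLp_correctionRem (hε : 0 < ε) (hχ : ∀ j α β, MemH1LocUnif (χ j α β)) (hΩ : IsOpen Ω)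
    (hΩb : Bornology.IsBounded Ω) (hg : ∀ k γ, IsTest Ω (g k γ)) (j : Fin d) (α : Fin m) :
    MemLp (correctionRem ε χ g j α) 2 volume :=
  memLp_finsetSum _ fun k _ => memLp_finsetSum _ fun γ _ =>
    memLp_test_mul_const_rescale (hχ k α γ).1.1 hε hΩ hΩb ((hg k γ).pderiv j)

lemma hasWeakDeriv_correction (hε : 0 < ε) (hχ : ∀ j α β, MemH1LocUnif (χ j α β))
    (hg : ∀ k γ, IsTest Ω (g k γ)) (j : Fin d) (α : Fin m) :
    HasWeakDeriv univ j (correction ε χ g α)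
      (fun x => correctionRem ε χ g j α x + correctionGrad ε χ g j α x) := by
  have h := HasWeakDeriv.sum (Finset.univ : Finset (Fin d)) fun k =>
    HasWeakDeriv.sum (Finset.univ : Finset (Fin m)) fun γ =>
      (((hχ k α γ).2 j).1.rescale (hχ k α γ).1.1 ((hχ k α γ).2 j).2.1 hε).mul_test (hg k γ).toUniv
  simp only [Finset.sum_add_distrib] at h
  exact h

lemma correction_eq_zero {x : E d} (hx : x ∉ ⋃ k, ⋃ γ, tsupport (g k γ)) (α : Fin m) :
    correction ε χ g α x = 0 := by
  refine Finset.sum_eq_zero fun k _ => Finset.sum_eq_zero fun γ _ => ?_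
  rw [image_eq_zero_of_notMem_tsupport fun h => hx (mem_iUnion₂.2 ⟨k, γ, h⟩), zero_mul]

end correction

lemma twoScaleError_eq (Ω : Set (E d)) (ζ η : E d → ℝ) (ε : ℝ)
    (χ : Fin d → Fin m → Fin m → E d → ℝ) (uε u₀ : Fin m → E d → ℝ) :
    twoScaleError Ω ζ η ε χ uε u₀ = fun α x => (uε - u₀) α x - correction ε χ
      (fun k γ => mollify (dilate ζ ε) fun x => η x * weakDeriv Ω k (u₀ γ) x) α x := by
  ext α x
  simp only [twoScaleError, correction, Pi.sub_apply, Finset.mul_sum]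
  congr 1
  refine Finset.sum_congr rfl fun k _ => Finset.sum_congr rfl fun γ _ => ?_
  rw [smoothing_eq_mollify]; ring

/-- The equation satisfied by the two-scale expansion error, tested with a test function. -/
lemma form_identity {Ω : Set (E d)} (hΩ : IsOpen Ω) (hΩb : Bornology.IsBounded Ω)
    {A : Coeff d m} {Ahat : Fin d → Fin d → Fin m → Fin m → ℝ}
    {χ : Fin d → Fin m → Fin m → E d → ℝ} {ε M M' : ℝ} (hε : 0 < ε)
    (hAm : ∀ i j α β, AEMeasurable (A i j α β) volume)
    (hM : ∀ i j α β, ∀ᵐ y, |A i j α β y| ≤ M) (hM' : ∀ i j α β, |Ahat i j α β| ≤ M')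
    (hχ : ∀ j α β, MemH1LocUnif (χ j α β))
    (hb : ∀ i j α β, LocallyIntegrable (bT A Ahat χ i j α β))
    {F : (Fin m → E d → ℝ) →ₗ[ℝ] ℝ} {uε u₀ w : Fin m → E d → ℝ}
    (huε : ∀ α, MemH1 Ω (uε α)) (hu₀ : ∀ α, MemH1 Ω (u₀ α))
    (hsε : IsWeakSolution Ω (rescale ε A) F uε) (hs₀ : IsWeakSolution Ω (constCoeff Ahat) F u₀)
    {g : Fin d → Fin m → E d → ℝ} (hg : ∀ k γ, IsTest Ω (g k γ))
    (hw : w = fun α x => (uε - u₀) α x - correction ε χ g α x)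
    {v : Fin m → E d → ℝ} (hv : ∀ α, IsTest Ω (v α)) :
    formInt Ω (rescale ε A) (fun j β => weakDeriv Ω j (w β)) (fun i α => pderiv i (v α)) =
      formInt Ω (fun i j α β x => constCoeff Ahat i j α β x - rescale ε A i j α β x)
        (fun j β x => weakDeriv Ω j (u₀ β) x - g j β x) (fun i α => pderiv i (v α)) -
      (∑ j, ∑ α, ∑ β, ∑ i, ∫ x, bT A Ahat χ i j α β (ε⁻¹ • x) * (g j β x * pderiv i (v α) x)) -
      formInt Ω (rescale ε A) (correctionRem ε χ g) (fun i α => pderiv i (v α)) := by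
  have hAεm := fun i j α β => aemeasurable_rescale hAm hε i j α β
  have hAεM := fun i j α β => abs_rescale_le hM hε i j α β
  have hcm : ∀ i j α β, AEMeasurable (constCoeff (d := d) Ahat i j α β) volume := fun i j α β =>
    aemeasurable_const
  have hcM : ∀ i j α β, ∀ᵐ y, |constCoeff (d := d) Ahat i j α β y| ≤ M' := fun i j α β =>
    Eventually.of_forall fun _ => hM' i j α β
  set B : Coeff d m := fun i j α β x => constCoeff Ahat i j α β x - rescale ε A i j α β x with hB
  have hBm : ∀ i j α β, AEMeasurable (B i j α β) volume := fun i j α β =>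
    (hcm i j α β).sub (hAεm i j α β)
  have hBM : ∀ i j α β, ∀ᵐ y, |B i j α β y| ≤ M' + M := fun i j α β => by
    filter_upwards [hcM i j α β, hAεM i j α β] with y h1 h2
    exact (abs_sub _ _).trans (add_le_add h1 h2)
  set q : Fin d → Fin m → E d → ℝ := fun i α => pderiv i (v α) with hq
  have hqL : ∀ i α, MemLp (q i α) 2 (volume.restrict Ω) := fun i α => ((hv α).pderiv i).memLp 2 _
  have hfεL : ∀ j β, MemLp (weakDeriv Ω j (uε β)) 2 (volume.restrict Ω) := fun j β =>
    ((huε β).2 j).2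
  have hf0L : ∀ j β, MemLp (weakDeriv Ω j (u₀ β)) 2 (volume.restrict Ω) := fun j β =>
    ((hu₀ β).2 j).2
  have hgL : ∀ j β, MemLp (g j β) 2 (volume.restrict Ω) := fun j β => (hg j β).memLp 2 _
  have hGL : ∀ j β, MemLp (correctionGrad ε χ g j β) 2 (volume.restrict Ω) := fun j β =>
    (memLp_correctionGrad hε hχ hΩ hΩb hg j β).mono_measure Measure.restrict_le_self
  have hPL : ∀ j β, MemLp (correctionRem ε χ g j β) 2 (volume.restrict Ω) := fun j β =>
    (memLp_correctionRem hε hχ hΩ hΩb hg j β).mono_measure Measure.restrict_le_self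
  have e1 : ∀ j β, weakDeriv Ω j (w β) =ᵐ[volume.restrict Ω] fun x =>
      weakDeriv Ω j (uε β) x - weakDeriv Ω j (u₀ β) x - correctionGrad ε χ g j β x -
        correctionRem ε χ g j β x := by
    intro j β
    rw [hw]
    have h1 := ((((huε β).2 j).1.sub ((hu₀ β).2 j).1).sub
      ((hasWeakDeriv_correction hε hχ hg j β).mono (subset_univ Ω))).weakDeriv_ae_eq hΩ
    refine h1.trans (Eventually.of_forall fun x => ?_)
    show _ - (_ + _) = _
    ring
  rw [formInt_congr_left e1,
    formInt_sub_left hAεm hAεM (p := fun j β x => weakDeriv Ω j (uε β) x -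
      weakDeriv Ω j (u₀ β) x - correctionGrad ε χ g j β x) (p' := correctionRem ε χ g)
      (fun j β => ((hfεL j β).sub (hf0L j β)).sub (hGL j β)) hPL hqL,
    formInt_sub_left hAεm hAεM (p := fun j β x => weakDeriv Ω j (uε β) x -
      weakDeriv Ω j (u₀ β) x) (p' := correctionGrad ε χ g)
      (fun j β => (hfεL j β).sub (hf0L j β)) hGL hqL,
    formInt_sub_left hAεm hAεM (p := fun j β => weakDeriv Ω j (uε β))
      (p' := fun j β => weakDeriv Ω j (u₀ β)) hfεL hf0L hqL,
    formInt_sub_left hBm hBM (p := fun j β => weakDeriv Ω j (u₀ β)) (p' := g) hf0L hgL hqL,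
    formInt_sub_coeff hcm hcM hAεm hAεM hf0L hqL]
  have e2 : formInt Ω (rescale ε A) (fun j β => weakDeriv Ω j (uε β)) q = F v := hsε v hv
  have e3 : formInt Ω (constCoeff Ahat) (fun j β => weakDeriv Ω j (u₀ β)) q = F v := hs₀ v hv
  have e4 := formInt_flux (Ω := Ω) hε hB hg hv hb rfl (integrable_form hBm hBM hgL hqL)
    (integrable_form hAεm hAεM hGL hqL)
  change formInt Ω B g q - formInt Ω (rescale ε A) (correctionGrad ε χ g) q = _ at e4
  rw [e2, e3]
  linarith

/-- The term of the correction in which the mollified function is differentiated: the corrector acts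
as a multiplier of norm `ε ‖χ_T‖_{S²_1} ≤ δ`. -/
lemma nrm_correctionRem_le {χ : Fin d → Fin m → Fin m → E d → ℝ}
    (hχ : ∀ j α β, MemH1LocUnif (χ j α β)) {ζ : E d → ℝ} (hζ : IsMollifier ζ) {Mζ : ℝ}
    (hMζ0 : 0 ≤ Mζ) (hMζ : ∀ x, ζ x ≤ Mζ) {ε δ S : ℝ} (hε : 0 < ε)
    (hδ : ε * (stepanovNorm (fun q : Fin d × Fin m × Fin m => χ q.1 q.2.1 q.2.2) 1).toReal ≤ δ)
    {F : Fin d → Fin m → E d → ℝ} {DF : Fin d → Fin m → Fin d → E d → ℝ}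
    (hw : ∀ k γ j, HasWeakDeriv univ j (F k γ) (DF k γ j))
    (hDF : ∀ k γ j, MemLp (DF k γ j) 2 volume) (hS : ∀ k γ j, δ * nrm (DF k γ j) ≤ S)
    (j : Fin d) (α : Fin m) :
    nrm (correctionRem ε χ (fun k γ => mollify (dilate ζ ε) (F k γ)) j α) ≤
      d * m * (√Mζ * √(ballVol d) * S) := by
  have h := fun k γ => corrector_mul_pderiv_mollify hχ hζ hMζ0 hMζ hε (hw k γ j) (hDF k γ j) k α γ
  have h1 : ∀ k γ, nrm (fun x => pderiv j (mollify (dilate ζ ε) (F k γ)) x *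
      (ε * χ k α γ (ε⁻¹ • x))) ≤ √Mζ * √(ballVol d) * S := fun k γ => by
    refine (h k γ).2.trans ?_
    rw [mul_assoc]
    refine mul_le_mul_of_nonneg_left ?_ (by positivity)
    exact (mul_le_mul_of_nonneg_right hδ (nrm_nonneg _)).trans (hS k γ j)
  have h2 : nrm (correctionRem ε χ (fun k γ => mollify (dilate ζ ε) (F k γ)) j α) ≤ _ :=
    nrm_sum_le Finset.univ fun k => memLp_finsetSum Finset.univ fun γ _ => (h k γ).1
  refine h2.trans ((Finset.sum_le_sum fun k _ => (nrm_sum_le Finset.univ fun γ =>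
    (h k γ).1).trans (Finset.sum_le_sum fun γ _ => h1 k γ)).trans (le_of_eq ?_))
  simp only [Finset.sum_const, Finset.card_univ, Fintype.card_fin, nsmul_eq_mul]; ring

end

theorem theorem10p5 (d m : ℕ) (hd : 1 ≤ d) (μ : ℝ) (hμ : 0 < μ) (A : Coeff d m)
    (hA : IsBoundedMeasurable A) (hell : IsElliptic μ A)
    (hAP : ∀ i j α β, IsAPW2 (A i j α β))
    (Ω : Set (E d)) (hΩ : IsBoundedLipschitzDomain Ω)
    (ζ : E d → ℝ) (hζ : IsMollifier ζ) (Cη : ℝ) :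
    ∃ C : ℝ, ∀ (ψ : Coeff d m) (Ahat : Fin d → Fin d → Fin m → Fin m → ℝ),
      IsPotentialCorrector A ψ → IsHomogenized A ψ Ahat →
      ∀ ε T : ℝ, 0 < ε → ε < 1 → T = ε⁻¹ →
      ∀ (χ : Fin d → Fin m → Fin m → E d → ℝ) (φ : Coeff d m),
      IsApproxCorrector A T χ → IsDualApproxCorrector A Ahat T χ φ →
      ∀ δ : ℝ, δ = errorParam T ψ χ φ →
      ∀ η : E d → ℝ, IsCutoff Ω Cη δ η →
      ∀ (F : (Fin m → E d → ℝ) →ₗ[ℝ] ℝ) (uε u₀ : Fin m → E d → ℝ),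
      IsHMinusOne Ω F →
      (∀ α, MemH1 Ω (uε α)) → (∀ α, MemH2 Ω (u₀ α)) →
      IsWeakSolution Ω (rescale ε A) F uε →
      IsWeakSolution Ω (constCoeff Ahat) F u₀ →
      MemH10 Ω (uε - u₀) →
      MemH10 Ω (twoScaleError Ω ζ η ε χ uε u₀) ∧
      (h1Norm Ω (twoScaleError Ω ζ η ε χ uε u₀)).toReal ≤
        C * δ ^ (1 / 2 : ℝ) * (h2Norm Ω u₀).toReal := by
  obtain ⟨hAm, M₀, hM₀⟩ := hA
  have hM : ∀ i j α β, ∀ᵐ y, |A i j α β y| ≤ |M₀| := fun i j α β => by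
    filter_upwards [hM₀ i j α β] with y hy using hy.trans (le_abs_self _)
  have hM0 := abs_nonneg M₀
  set M := |M₀|
  obtain ⟨M', hM'0, hM'⟩ := exists_homogenized_bound hμ hell hM hM0
  obtain ⟨C₁, hC₁, hsmooth⟩ := exists_smoothing_bounds hd hΩ Cη
  obtain ⟨C₂, hC₂, hflux⟩ := exists_abs_bT_le hd hμ hell hAm hM hM0 hζ
  obtain ⟨C₃, hC₃, henergy⟩ := exists_energy_estimate (m := m) hd hΩ.1 hΩ.2.1 hμ
  obtain ⟨Mζ, hMζ0, hMζ⟩ := hζ.1.exists_bound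
  set s := √Mζ * √(ballVol d) with hs
  have hs0 : 0 ≤ s := by positivity
  -- the three summands belong to the three terms of `form_identity`
  refine ⟨C₃ * (((M' + M) * (d * m) + d * m * m * C₂ + M * (d * m * (d * m * s))) *
    (C₁ * (1 + d))), ?_⟩
  rintro ψ Ahat hψ hh ε T hε - rfl χ φ hχ hφ δ rfl η hη F uε u₀ - huε hu₀ hsε hs₀ hbdry
  have hδ1 := two_mul_le_errorParam hε ψ χ φ
  have hδ2 := mul_stepanovNorm_le_errorParam hε ψ χ φ
  set δ := errorParam ε⁻¹ ψ χ φ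
  have hδ : 0 < δ := by linarith
  rw [← Real.sqrt_eq_rpow]
  set H := (h2Norm Ω u₀).toReal with hH
  have hH0 : 0 ≤ H := ENNReal.toReal_nonneg
  have hκ := hζ.isKernel_dilate hε
  -- the functions `∂_k u₀^γ`, their cut-offs and the derivatives of these
  set f : Fin d → Fin m → E d → ℝ := fun k γ => weakDeriv Ω k (u₀ γ) with hf
  set Φ : Fin d → Fin m → E d → ℝ := fun k γ x => η x * f k γ x with hΦ
  set DΦ : Fin d → Fin m → Fin d → E d → ℝ :=
    fun k γ j x => pderiv j η x * f k γ x + η x * weakDeriv Ω j (f k γ) x with hDΦ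
  set g : Fin d → Fin m → E d → ℝ := fun k γ => mollify (dilate ζ ε) (Φ k γ) with hg
  have hfL : ∀ k γ, MemLp (f k γ) 2 (volume.restrict Ω) := fun k γ => ((hu₀ γ).2 k).1
  have hfd : ∀ k γ j, MemLp (weakDeriv Ω j (f k γ)) 2 (volume.restrict Ω) := fun k γ j =>
    (((hu₀ γ).2 k).2 j).2
  have hfw : ∀ k γ j, HasWeakDeriv Ω j (f k γ) (weakDeriv Ω j (f k γ)) := fun k γ j =>
    (((hu₀ γ).2 k).2 j).1
  have hΦL : ∀ k γ, MemLp (Φ k γ) 2 volume := fun k γ =>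
    memLp_test_mul hΩ.1.measurableSet hη.1 (hfL k γ)
  have hDΦL : ∀ k γ j, MemLp (DΦ k γ j) 2 volume := fun k γ j =>
    (memLp_test_mul hΩ.1.measurableSet (hη.1.pderiv j) (hfL k γ)).add
      (memLp_test_mul hΩ.1.measurableSet hη.1 (hfd k γ j))
  have hΦw : ∀ k γ j, HasWeakDeriv univ j (Φ k γ) (DΦ k γ j) := fun k γ j =>
    (hfw k γ j).mul_test hη.1
  have hgT : ∀ k γ, IsTest Ω (g k γ) := fun k γ =>
    hη.isTest_mollify hΩ.1 hε.le (by linarith) hκ (hfL k γ)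
  have hb : ∀ i j α β, LocallyIntegrable (bT A Ahat χ i j α β) := fun i j α β =>
    let ⟨_, hc, _⟩ := (hφ i j α β).2
    hc.1
  set S := C₁ * (1 + d) * H with hS
  have hS0 : 0 ≤ S := by positivity
  have hN : ∀ k γ, (sumNorm Ω (f k γ) fun j => weakDeriv Ω j (f k γ)).toReal ≤ (1 + d) * H := by
    intro k γ
    refine (ENNReal.toReal_mono (ENNReal.mul_ne_top (by finiteness) (h2Norm_ne_top hu₀))
      (sumNorm_weakDeriv_le_h2Norm Ω u₀ k γ)).trans (le_of_eq ?_)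
    rw [ENNReal.toReal_mul, ENNReal.toReal_add ENNReal.one_ne_top (ENNReal.natCast_ne_top d),
      ENNReal.toReal_one, ENNReal.toReal_natCast]
  have hsb := fun k γ => hsmooth ε δ η (dilate ζ ε) hε hδ1 hη hκ (f k γ) _ (hfL k γ) (hfd k γ)
    (hfw k γ)
  have hNF : ∀ k γ, √δ * (nrm (Φ k γ) + ∑ j, nrm (DΦ k γ j)) ≤ S := fun k γ => by
    refine (hsb k γ).1.trans ?_
    rw [hS, mul_assoc]
    exact mul_le_mul_of_nonneg_left (hN k γ) hC₁
  -- the factor `δ` gained in the flux estimate and the loss `δ^{-1/2}` leave `δ^{1/2}`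
  have hNF' : ∀ k γ, δ * (nrm (Φ k γ) + ∑ j, nrm (DΦ k γ j)) ≤ √δ * S := fun k γ => by
    calc _ = √δ * (√δ * (nrm (Φ k γ) + ∑ j, nrm (DΦ k γ j))) := by
          rw [← mul_assoc, Real.mul_self_sqrt hδ.le]
      _ ≤ _ := mul_le_mul_of_nonneg_left (hNF k γ) (Real.sqrt_nonneg _)
  have hfg : ∀ k γ, nrmOn Ω (fun x => f k γ x - g k γ x) ≤ √δ * S := fun k γ => by
    refine (hsb k γ).2.trans ?_
    calc _ = √δ * (C₁ * (sumNorm Ω (f k γ) fun j => weakDeriv Ω j (f k γ)).toReal) := by ring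
      _ ≤ √δ * (C₁ * ((1 + d) * H)) := by gcongr; exact hN k γ
      _ = _ := by rw [hS]; ring
  have hDS : ∀ k γ j, δ * nrm (DΦ k γ j) ≤ √δ * S := fun k γ j => by
    refine le_trans ?_ (hNF' k γ)
    refine mul_le_mul_of_nonneg_left ?_ hδ.le
    exact (Finset.single_le_sum (f := fun j => nrm (DΦ k γ j)) (fun _ _ => nrm_nonneg _)
      (Finset.mem_univ j)).trans (le_add_of_nonneg_left (nrm_nonneg _))
  have hrem := nrm_correctionRem_le hχ.1 hζ hMζ0 (fun x => (le_abs_self _).trans (hMζ x)) hε hδ2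
    hΦw hDΦL hDS
  have hw := twoScaleError_eq Ω ζ η ε χ uε u₀
  have hw0 : MemH10 Ω (twoScaleError Ω ζ η ε χ uε u₀) := by
    rw [hw]
    exact hbdry.sub_of_compact hΩ.1
      (isCompact_iUnion fun k => isCompact_iUnion fun γ => (hgT k γ).2.1)
      (iUnion₂_subset fun k γ => (hgT k γ).2.2)
      (fun α => memLp_correction hε hχ.1 hΩ.1 hΩ.2.1 hgT α)
      (fun j α => (memLp_correctionRem hε hχ.1 hΩ.1 hΩ.2.1 hgT j α).add
        (memLp_correctionGrad hε hχ.1 hΩ.1 hΩ.2.1 hgT j α))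
      (fun j α => hasWeakDeriv_correction hε hχ.1 hgT j α)
      (fun α x hx => correction_eq_zero hx α)
  refine ⟨hw0, ?_⟩
  have hAεm := fun i j α β => aemeasurable_rescale hAm hε i j α β
  have hAεM := fun i j α β => abs_rescale_le hM hε i j α β
  refine (henergy (rescale ε A) M hAεm hAεM hM0 (hell.rescale hε) _
    (((M' + M) * (d * m) + d * m * m * C₂ + M * (d * m * (d * m * s))) * (√δ * S)) hw0
    (by positivity) fun v hv => ?_).trans (le_of_eq (by rw [hS]; ring))
  set V := ∑ i, ∑ α, nrm (pderiv i (v α)) with hV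
  have hV0 : 0 ≤ V := Finset.sum_nonneg fun _ _ => Finset.sum_nonneg fun _ _ => nrm_nonneg _
  have hqL : ∀ i α, MemLp (pderiv i (v α)) 2 (volume.restrict Ω) := fun i α =>
    ((hv α).pderiv i).memLp 2 _
  have hqV : ∑ i, ∑ α, nrmOn Ω (pderiv i (v α)) = V :=
    Finset.sum_congr rfl fun i _ => Finset.sum_congr rfl fun α _ =>
      ((hv α).pderiv i).nrmOn_eq hΩ.1
  have hcard : ∀ x : ℝ, ∑ _j : Fin d, ∑ _β : Fin m, x = d * m * x := fun x => by
    simp only [Finset.sum_const, Finset.card_univ, Fintype.card_fin, nsmul_eq_mul]; ring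
  rw [form_identity hΩ.1 hΩ.2.1 hε hAm hM (hM' ψ Ahat hψ hh) hχ.1 hb huε (fun α => (hu₀ α).1)
    hsε hs₀ hgT hw hv]
  -- the terms with `∇u₀ - g` and with the derivatives of `g`
  have b1 := abs_formInt_le (Ω := Ω) (M := M' + M)
    (A := fun i j α β x => constCoeff Ahat i j α β x - rescale ε A i j α β x)
    (p := fun j β x => f j β x - g j β x) (q := fun i α => pderiv i (v α))
    (fun i j α β => aemeasurable_const.sub (hAεm i j α β))
    (fun i j α β => by
      filter_upwards [hAεM i j α β] with y h2
      exact (abs_sub _ _).trans (add_le_add (hM' ψ Ahat hψ hh i j α β) h2))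
    (by positivity) (fun j β => (hfL j β).sub ((hgT j β).memLp 2 _)) hqL
  have b3 := abs_formInt_le (Ω := Ω) hAεm hAεM hM0 (p := correctionRem ε χ g)
    (q := fun i α => pderiv i (v α))
    (fun j β => (memLp_correctionRem hε hχ.1 hΩ.1 hΩ.2.1 hgT j β).mono_measure
      Measure.restrict_le_self) hqL
  rw [hqV] at b1 b3
  have c1 : ∑ j, ∑ β, nrmOn Ω (fun x => f j β x - g j β x) ≤ d * m * (√δ * S) := by
    rw [← hcard]
    exact Finset.sum_le_sum fun j _ => Finset.sum_le_sum fun β _ => hfg j β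
  have c3 : ∑ j, ∑ β, nrmOn Ω (correctionRem ε χ g j β) ≤ d * m * (d * m * (s * (√δ * S))) := by
    rw [← hcard]
    exact Finset.sum_le_sum fun j _ => Finset.sum_le_sum fun β _ =>
      (nrmOn_le_nrm Ω (memLp_correctionRem hε hχ.1 hΩ.1 hΩ.2.1 hgT j β)).trans (hrem j β)
  -- the flux term
  have b2 : ∀ j α β, |∑ i, ∫ x, bT A Ahat χ i j α β (ε⁻¹ • x) *
      (g j β x * pderiv i (v α) x)| ≤ C₂ * (√δ * S) * V := by
    intro j α β
    refine (hflux ψ Ahat hψ hh ε hε χ φ hχ hφ j α β (Φ j β) (DΦ j β) (v α) (hΦL j β)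
      (hDΦL j β) (hΦw j β) (hv α).toUniv).trans ?_
    rw [mul_assoc C₂]
    refine mul_le_mul (mul_le_mul_of_nonneg_left (hNF' j β) hC₂) ?_
      (Finset.sum_nonneg fun _ _ => nrm_nonneg _) (by positivity)
    exact Finset.sum_le_sum fun i _ => Finset.single_le_sum (f := fun α => nrm (pderiv i (v α)))
      (fun _ _ => nrm_nonneg _) (Finset.mem_univ α)
  have c2 : |∑ j, ∑ α, ∑ β, ∑ i, ∫ x, bT A Ahat χ i j α β (ε⁻¹ • x) *
      (g j β x * pderiv i (v α) x)| ≤ d * m * (m * (C₂ * (√δ * S) * V)) := by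
    rw [← hcard]
    refine (Finset.abs_sum_le_sum_abs _ _).trans (Finset.sum_le_sum fun j _ => ?_)
    refine (Finset.abs_sum_le_sum_abs _ _).trans (Finset.sum_le_sum fun α _ => ?_)
    refine (Finset.abs_sum_le_sum_abs _ _).trans ((Finset.sum_le_sum fun β _ =>
      b2 j α β).trans (le_of_eq ?_))
    simp
  have d1 := b1.trans (mul_le_mul_of_nonneg_right
    (mul_le_mul_of_nonneg_left c1 (by positivity : 0 ≤ M' + M)) hV0)
  have d3 := b3.trans (mul_le_mul_of_nonneg_right (mul_le_mul_of_nonneg_left c3 hM0) hV0)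
  refine (abs_sub _ _).trans ((add_le_add ((abs_sub _ _).trans (add_le_add d1 c2)) d3).trans
    (le_of_eq ?_))
  ring
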